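/- Let $n\ge 1$ and let $\mathfrak S_n$ act on $\mathbb C^n$ by permuting the basis $y_1,\dots,y_n$. The Weyl group $W=W(A_{n-1})$ is $\mathfrak S_n$ acting on the quotient $V=\mathbb C^n/\mathbb C(y_1+\cdots+y_n)\cong\mathbb C^{n-1}$. For a finite group $G$ acting linearly on a finite-dimensional complex vector space $E$ and the character $\chi$ of a finite-dimensional complex $G$-module $M$, put $$P_{G}(\chi;q,t)=\mathrm{Hilb}\big((S(E^*)\otimes\wedge E^*\otimes M^*)^G,q,t\big)=\sum_{i,k\ge 0}\dim\big(S^i(E^*)\otimes\wedge^kE^*\otimes M^*\big)^G\,q^it^k ,$$ where $E=\mathbb C^n$ when $G$ is written $\mathfrak S_n$, and $E=V$ when $G$ is written $W(A_{n-1})$. For a partition $\lambda$ of $n$ let $\chi^\lambda$ be the corresponding irreducible character of $\mathfrak S_n$ (the character of the Specht module of $\lambda$), let $n(\lambda)=\sum_{i\ge1}(i-1)\lambda_i$, and for a cell $x=(i,j)$ of the Ferrers diagram of $\lambda$ (row $i$, column $j$, $1\le j\le\lambda_i$) let $c(x)=j-i$ be its content and $h(x)=\lambda_i-j+\#\{k:\lambda_k\ge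 j\}-i+1$ its hook length. Write $(z;a)_k=(1-z)(1-za)\cdots(1-za^{k-1})$ and $\binom{m}{r}_q=\frac{(q;q)_m}{(q;q)_r(q;q)_{m-r}}$. All rational functions are expanded as series in $q$ at $q=0$. (a) For every partition $\lambda$ of $n$, $$P_{W(A_{n-1})}(\chi^\lambda;q,t)=\frac{1-q}{1+t}\,P_{\mathfrak S_n}(\chi^\lambda;q,t)=\frac{1-q}{1+t}\;q^{n(\lambda)}\prod_{x\in\lambda}\frac{1+t\,q^{c(x)}}{1-q^{h(x)}} .$$ (b) For every $r=0,1,\dots,n-1$, the character $\chi_{\wedge^rV}$ of $\wedge^r V$ satisfies $$P_{W(A_{n-1})}(\chi_{\wedge^rV};q,t)=q^{\,r+\binom r2}\binom{n-1}{r}_q\frac{(-tq;q)_{n-1-r}\,(-tq^{-1};q^{-1})_r}{(q^2;q)_{n-1}} .$$ (c) Let $e_1\le\dots\le e_{n-1}$ be the exponents of $W$ (the numbers $d_i=e_i+1$ are the degrees of homogeneous algebraically independent generators of the algebra $S(V^*)^W$), and let $e_1^*\le\dots\le e_{n-1}^*$ be its coexponents (the degrees, with respect to the grading of $S(V^*)$,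 of a homogeneous basis of the free $S(V^*)^W$-module $(S(V^*)\otimes V)^W$). Let $\sigma_r$ be the $r$-th elementary symmetric function, $\sigma_0=1$. Then $$\sum_{i,k,r\ge0}\dim\big(S^i(V^*)\otimes\wedge^kV^*\otimes\wedge^rV\big)^W q^it^ks^r=\sum_{r=0}^{n-1}s^r\,\sigma_r\big(q^{e_1^*},\dots,q^{e_{n-1}^*}\big)\,\frac{\prod_{i=1}^{r}(1+q^{-e_i^*}t)\;\prod_{i=1}^{n-1-r}(1+q^{e_i}t)}{\prod_{i=1}^{n-1}(1-q^{d_i})} .$$ -/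

import Mathlib

open scoped TensorProduct

noncomputable section

namespace MixedForms

/-! ### Symmetric and exterior powers of representations, graded multiplicities -/

section Representations

variable {G : Type*} [Group G] {V : Type*} [AddCommGroup V] [Module ℂ V]

/-- The action of `G` on the symmetric algebra `S(V)` by algebra automorphisms. -/
def symAlgRep (ρ : Representation ℂ G V) : Representation ℂ G (SymmetricAlgebra ℂ V) where
  toFun g := (SymmetricAlgebra.lift ((SymmetricAlgebra.ι ℂ V) ∘ₗ (ρ g))).toLinearMap
  map_one' := by
    have h : SymmetricAlgebra.lift ((SymmetricAlgebra.ι ℂ V) ∘ₗ (ρ 1)) =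
        AlgHom.id ℂ (SymmetricAlgebra ℂ V) := by
      apply SymmetricAlgebra.algHom_ext
      ext v
      simp
    rw [h]
    rfl
  map_mul' g h := by
    have H : SymmetricAlgebra.lift ((SymmetricAlgebra.ι ℂ V) ∘ₗ (ρ (g * h))) =
        (SymmetricAlgebra.lift ((SymmetricAlgebra.ι ℂ V) ∘ₗ (ρ g))).comp
          (SymmetricAlgebra.lift ((SymmetricAlgebra.ι ℂ V) ∘ₗ (ρ h))) := by
      apply SymmetricAlgebra.algHom_ext
      ext v
      simp
    rw [H]
    rfl

variable (V) in
/-- The homogeneous component `S^i(V)` of the symmetric algebra: the span of the products of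
`i` vectors. -/
def symPower (i : ℕ) : Submodule ℂ (SymmetricAlgebra ℂ V) :=
  LinearMap.range (SymmetricAlgebra.ι ℂ V) ^ i

variable (V) in
/-- `S^i(V)` as a vector space of its own. -/
def SymPow (i : ℕ) : Type _ := symPower V i

instance (i : ℕ) : AddCommGroup (SymPow V i) := inferInstanceAs (AddCommGroup (symPower V i))

instance (i : ℕ) : Module ℂ (SymPow V i) := inferInstanceAs (Module ℂ (symPower V i))

variable (V) in
/-- `⋀^k V` as a vector space of its own. -/
def ExtPow (k : ℕ) : Type _ := ⋀[ℂ]^k V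

instance (k : ℕ) : AddCommGroup (ExtPow V k) := inferInstanceAs (AddCommGroup (⋀[ℂ]^k V))

instance (k : ℕ) : Module ℂ (ExtPow V k) := inferInstanceAs (Module ℂ (⋀[ℂ]^k V))

/-- The action of `G` preserves the degree. -/
theorem symPower_le_comap (ρ : Representation ℂ G V) (i : ℕ) (g : G) :
    symPower V i ≤ (symPower V i).comap (symAlgRep ρ g) := by
  have h1 : (LinearMap.range (SymmetricAlgebra.ι ℂ V)).map (symAlgRep ρ g) ≤
      LinearMap.range (SymmetricAlgebra.ι ℂ V) := by
    rintro _ ⟨_, ⟨v, rfl⟩, rfl⟩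
    exact ⟨ρ g v, by simp [symAlgRep]⟩
  rw [← Submodule.map_le_iff_le_comap, symPower]
  refine le_trans (le_of_eq ?_) (pow_le_pow_left' h1 i)
  exact Submodule.map_pow _ (SymmetricAlgebra.lift ((SymmetricAlgebra.ι ℂ V) ∘ₗ (ρ g))) i

/-- The representation `S^i(V)`. -/
def symPowerRep (ρ : Representation ℂ G V) (i : ℕ) : Representation ℂ G (SymPow V i) where
  toFun g := ((symAlgRep ρ g).restrict (symPower_le_comap ρ i g) : symPower V i →ₗ[ℂ] symPower V i)
  map_one' := by
    refine LinearMap.ext fun x => Subtype.ext ?_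
    exact congrArg (fun f => f x.1) (symAlgRep ρ).map_one
  map_mul' g h := by
    refine LinearMap.ext fun x => Subtype.ext ?_
    exact congrArg (fun f => f x.1) ((symAlgRep ρ).map_mul g h)

/-- The representation `⋀^k V`. -/
def extPowerRep (ρ : Representation ℂ G V) (k : ℕ) : Representation ℂ G (ExtPow V k) where
  toFun g := (exteriorPower.map k (ρ g) : ⋀[ℂ]^k V →ₗ[ℂ] ⋀[ℂ]^k V)
  map_one' := by rw [map_one]; exact exteriorPower.map_id
  map_mul' g h := by
    rw [map_mul]
    exact exteriorPower.map_comp (ρ h) (ρ g)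

/-- The dimension of `(S^i(V*) ⊗ ⋀^k V* ⊗ U)^G`. -/
def mixedDim (ρ : Representation ℂ G V) {U : Type*} [AddCommGroup U] [Module ℂ U]
    (σ : Representation ℂ G U) (i k : ℕ) : ℕ :=
  Module.finrank ℂ
    (((symPowerRep ρ.dual i).tprod (extPowerRep ρ.dual k)).tprod σ).invariants

end Representations

/-! ### The field of the generating functions -/

/-- The field `ℚ(t)((q))` of Laurent series in `q` over the rational functions in `t`. It contains
the ring `ℤ[t][[q]]` of the Hilbert series as well as all rational functions in `q` and `t`, the
latter expanded at `q = 0`. -/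
abbrev QTField : Type := LaurentSeries (RatFunc ℚ)

/-- The variable `q`. -/
def q : QTField := HahnSeries.single (1 : ℤ) (1 : RatFunc ℚ)

/-- The variable `t`. -/
def t : QTField := HahnSeries.C (RatFunc.X : RatFunc ℚ)

section Series

variable {G : Type*} [Group G] {V : Type*} [AddCommGroup V] [Module ℂ V]
  {U : Type*} [AddCommGroup U] [Module ℂ U]

/-- The Hilbert series `Hilb((S(V*) ⊗ ⋀V* ⊗ U)^G, q, t)`: the coefficient of `q^i t^k` is
`dim (S^i(V*) ⊗ ⋀^k V* ⊗ U)^G`. -/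
def hilb (ρ : Representation ℂ G V) (σ : Representation ℂ G U) : QTField :=
  HahnSeries.ofPowerSeries ℤ (RatFunc ℚ) (PowerSeries.mk fun i =>
    ∑ k ∈ Finset.range (Module.finrank ℂ V + 1), (mixedDim ρ σ i k : RatFunc ℚ) * RatFunc.X ^ k)

/-- `P_G(χ; q, t) = Hilb((S(V*) ⊗ ⋀V* ⊗ M*)^G, q, t)`, where `χ` is the character of the
representation `σ` of `G` on `M`. -/
def multSeries (ρ : Representation ℂ G V) (σ : Representation ℂ G U) : QTField :=
  hilb ρ σ.dual

/-- The Hilbert series `Hilb((S(V*) ⊗ ⋀V* ⊗ ⋀V)^G, q, t, s)`, a polynomial in `s`: the coefficient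
of `q^i t^k s^r` is `dim (S^i(V*) ⊗ ⋀^k V* ⊗ ⋀^r V)^G`. -/
def mixedHilb (ρ : Representation ℂ G V) : Polynomial QTField :=
  ∑ r ∈ Finset.range (Module.finrank ℂ V + 1),
    Polynomial.C (hilb ρ (extPowerRep ρ r)) * Polynomial.X ^ r

/-- `d_1 ≤ ... ≤ d_m` are the degrees of `G` acting on `V`: the degrees of homogeneous,
algebraically independent generators of the algebra `S(V*)^G` (basic invariants). -/
def IsDegrees (ρ : Representation ℂ G V) {m : ℕ} (d : Fin m → ℕ) : Prop :=
  Monotone d ∧ ∃ f : Fin m → SymmetricAlgebra ℂ (Module.Dual ℂ V),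
    (∀ i, f i ∈ symPower (Module.Dual ℂ V) (d i)) ∧ AlgebraicIndependent ℂ f ∧
    ∀ p, p ∈ Algebra.adjoin ℂ (Set.range f) ↔ p ∈ (symAlgRep ρ.dual).invariants

/-- `e_1 ≤ ... ≤ e_m` are the exponents of `G` acting on `V`: the numbers `e_i + 1` are the
degrees. -/
def IsExponents (ρ : Representation ℂ G V) {m : ℕ} (e : Fin m → ℕ) : Prop :=
  IsDegrees ρ fun i => e i + 1

/-- `e_1 ≤ ... ≤ e_m` are the `U`-exponents of `G` acting on `V`: the degrees of a homogeneous
basis of the `S(V*)^G`-module `(S(V*) ⊗ U)^G`. -/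
def IsModuleExponents (ρ : Representation ℂ G V) (σ : Representation ℂ G U) {m : ℕ}
    (e : Fin m → ℕ) : Prop :=
  Monotone e ∧ ∃ θ : Fin m → SymmetricAlgebra ℂ (Module.Dual ℂ V) ⊗[ℂ] U,
    (∀ i, θ i ∈ LinearMap.range ((symPower (Module.Dual ℂ V) (e i)).subtype.rTensor U)) ∧
    (∀ i, θ i ∈ ((symAlgRep ρ.dual).tprod σ).invariants) ∧
    ∀ x ∈ ((symAlgRep ρ.dual).tprod σ).invariants,
      ∃! c : Fin m → SymmetricAlgebra ℂ (Module.Dual ℂ V),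
        (∀ i, c i ∈ (symAlgRep ρ.dual).invariants) ∧ x = ∑ i, c i • θ i

/-- The coexponents of `G` acting on `V` are the `V`-exponents. -/
def IsCoexponents (ρ : Representation ℂ G V) {m : ℕ} (e : Fin m → ℕ) : Prop :=
  IsModuleExponents ρ ρ e

end Series

/-! ### The symmetric group as `G(1,1,n)` and as the Weyl group of type `A_{n-1}` -/

/-- The permutation representation of `𝔖_n` on `ℂ^n`: `w` maps the basis vector `y_i` to
`y_{w(i)}`. -/
def permRep (n : ℕ) : Representation ℂ (Equiv.Perm (Fin n)) (Fin n → ℂ) where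
  toFun w := LinearMap.funLeft ℂ ℂ (w⁻¹ : Equiv.Perm (Fin n))
  map_one' := by ext; simp [LinearMap.funLeft]
  map_mul' w w' := by ext; simp [LinearMap.funLeft]

/-- The line `ℂ(y_1 + ... + y_n)` in `ℂ^n`. -/
def sumLine (n : ℕ) : Submodule ℂ (Fin n → ℂ) := Submodule.span ℂ {fun _ => 1}

theorem sumLine_le_comap (n : ℕ) (w : Equiv.Perm (Fin n)) :
    sumLine n ≤ (sumLine n).comap (permRep n w) := by
  rw [sumLine, Submodule.span_le, Set.singleton_subset_iff]
  exact Submodule.subset_span rfl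

/-- The Weyl group `W(A_{n-1})`: the action of `𝔖_n` on the quotient
`V = ℂ^n / ℂ(y_1 + ... + y_n)`, of dimension `n - 1`. -/
def weylARep (n : ℕ) : Representation ℂ (Equiv.Perm (Fin n)) ((Fin n → ℂ) ⧸ sumLine n) :=
  (permRep n).quotient (sumLine n) (sumLine_le_comap n)

/-! ### Irreducible characters of the symmetric group

A partition `λ` of `n` is given by its Ferrers diagram; the cells are indexed from `(0, 0)`. A
tableau of shape `λ` is a bijection from `{1, ..., n}` (as `Fin n`) to the cells. -/

section Specht

open scoped Classical in
/-- The Young symmetrizer `(∑ g) * (∑ sgn(h) h)` in `ℂ[𝔖_n]` of a tableau; `g` runs through the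
permutations preserving the rows and `h` through those preserving the columns of the tableau. -/
def youngSymmetrizer {n : ℕ} {lam : YoungDiagram} (T : Fin n ≃ lam.cells) :
    MonoidAlgebra ℂ (Equiv.Perm (Fin n)) :=
  (∑ g : Equiv.Perm (Fin n) with (∀ i, (T (g i)).1.1 = (T i).1.1),
      MonoidAlgebra.single g (1 : ℂ)) *
    (∑ h : Equiv.Perm (Fin n) with (∀ i, (T (h i)).1.2 = (T i).1.2),
      MonoidAlgebra.single h (((Equiv.Perm.sign h : ℤ) : ℂ)))

/-- The Specht module: the left ideal of `ℂ[𝔖_n]` generated by the Young symmetrizer. -/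
def spechtModule {n : ℕ} {lam : YoungDiagram} (T : Fin n ≃ lam.cells) :
    Submodule ℂ (MonoidAlgebra ℂ (Equiv.Perm (Fin n))) :=
  LinearMap.range (LinearMap.mulRight ℂ (youngSymmetrizer T))

theorem leftRegular_apply {n : ℕ} (g : Equiv.Perm (Fin n))
    (x : MonoidAlgebra ℂ (Equiv.Perm (Fin n))) :
    Representation.leftRegular ℂ (Equiv.Perm (Fin n)) g x = MonoidAlgebra.single g 1 * x := by
  induction x using MonoidAlgebra.induction_linear with
  | zero => simp
  | add x y hx hy => rw [map_add, hx, hy, mul_add]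
  | single h a => simp [MonoidAlgebra.single_mul_single]

theorem spechtModule_le_comap {n : ℕ} {lam : YoungDiagram} (T : Fin n ≃ lam.cells)
    (g : Equiv.Perm (Fin n)) :
    spechtModule T ≤
      (spechtModule T).comap (Representation.leftRegular ℂ (Equiv.Perm (Fin n)) g) := by
  rintro _ ⟨x, rfl⟩
  refine ⟨MonoidAlgebra.single g 1 * x, ?_⟩
  rw [leftRegular_apply]
  simp [mul_assoc]

/-- The action of `𝔖_n` on the Specht module by left multiplication. -/
def spechtRep {n : ℕ} {lam : YoungDiagram} (T : Fin n ≃ lam.cells) :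
    Representation ℂ (Equiv.Perm (Fin n)) (spechtModule T) :=
  (Representation.leftRegular ℂ (Equiv.Perm (Fin n))).subrepresentation (spechtModule T)
    (spechtModule_le_comap T)

/-- The irreducible character `χ^λ` of `𝔖_n`, computed from a tableau `T` of shape `λ` (it does not
depend on the choice of `T`). -/
def spechtCharacter {n : ℕ} {lam : YoungDiagram} (T : Fin n ≃ lam.cells) :
    Equiv.Perm (Fin n) → ℂ :=
  (spechtRep T).character

end Specht

/-- `n(λ) = ∑ (i - 1) λ_i`, with rows counted from `1`; here they are counted from `0`. -/
def nStat (lam : YoungDiagram) : ℕ := ∑ i ∈ Finset.range (lam.colLen 0), i * lam.rowLen i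

/-- The content `j - i` of the cell `(i, j)`. -/
def content (x : ℕ × ℕ) : ℤ := (x.2 : ℤ) - (x.1 : ℤ)

/-- The hook length of the cell `(i, j)` of `λ`: the number of cells weakly to the right in the
same row, plus the number of cells weakly below in the same column, minus one. -/
def hookLength (lam : YoungDiagram) (x : ℕ × ℕ) : ℕ :=
  (lam.rowLen x.1 - x.2) + (lam.colLen x.2 - x.1) - 1

/-- `q^{n(λ)} ∏_{x ∈ λ} (1 + t q^{c(x)}) / (1 - q^{h(x)})`. -/
def hookContentProduct (lam : YoungDiagram) : QTField :=
  q ^ nStat lam * ∏ x ∈ lam.cells, (1 + t * q ^ content x) / (1 - q ^ hookLength lam x)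

/-! ### `q`-Pochhammer symbols, `q`-binomial coefficients, elementary symmetric functions -/

/-- `(z; a)_k = (1 - z)(1 - za) ⋯ (1 - za^{k-1})`. -/
def qPochhammer (z a : QTField) (k : ℕ) : QTField := ∏ i ∈ Finset.range k, (1 - z * a ^ i)

/-- The `q`-binomial coefficient `(q;q)_n / ((q;q)_r (q;q)_{n-r})`, for `r ≤ n`. -/
def qBinomial (n r : ℕ) : QTField :=
  qPochhammer q q n / (qPochhammer q q r * qPochhammer q q (n - r))

/-- The elementary symmetric function `σ_r(x_1, ..., x_m)`. -/
def elemSymm {m : ℕ} (r : ℕ) (x : Fin m → QTField) : QTField :=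
  ∑ A ∈ Finset.powersetCard r (Finset.univ : Finset (Fin m)), ∏ i ∈ A, x i

end MixedForms

end

open MixedForms

/-! By Molien's formula every multiplicity series is an average over 𝔖_n of a character times the
bigraded trace on S(E*) ⊗ ⋀E*. For w acting on ℂ^n this trace is the product of p_l = (1 -
(-t)^l)/(1 - q^l) over the cycle lengths l of w. The quotient V loses one eigenvalue 1, which gives
the factor (1 - q)/(1 + t) for every character at once (`hilb_weyl`). The series for ℂ^n is thus a
symmetric function, the Frobenius characteristic of the character, evaluated at the power sums p_l.
Series in z are handled through their power sums: H = exp(Σ p_l z^l / l) is encoded by its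
differential equation, and over a ℚ-algebra two such series agree as soon as their power sums do
(`IsPowerSumExp.unique`).

For χ^λ the symmetric function is a Schur function. Let ψ(w) be the coefficient of x^{λ+δ} in a_δ
p_w(x), with a_δ the Vandermonde alternant (`frobChar`). Averaging ψ against a product of power sums
gives the Jacobi-Trudi determinant (`average_frobChar_mul_cycleProd`), and the bialternant formula
gives ψ norm one. The Young symmetrizer c satisfies c² = κc with κ ≠ 0, from which the Specht
character has norm one and inner product one with ψ. Both are real, so they coincide
(`spechtCharacter_eq_frobChar`). At the given p_l the complete functions are h_m = (-t;q)_m/(q;q)_m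
by the q-binomial theorem. After row factors are extracted, each column of the determinant consists
of values of one polynomial of degree less than N at the points q^{l_i}, where l = λ + δ. Its ratio
to the Vandermonde determinant is then independent of the points and can be read off at q^δ, where
the matrix is triangular. The remaining products rearrange into contents and hooks
(`det_shiftCoeff_eq_hookContent`).

For ⋀^r V, the identity ⋀^{r+1}ℂ^n = ⋀^{r+1}V ⊕ ⋀^r V of representations gives a two-term recursion,
whose right side is h_{n-r-1} times a coefficient of the series with power sums -p_l, up to sign;
the product formula solves it. Finally, the cases r = 0 and r = 1 at t = 0 are the Hilbert series of
the invariants and of the covariants. They force both exponents and coexponents to be 1, ..., n-1,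
and the finite q-binomial theorem identifies σ_r(q, ..., q^{n-1}) with the power of q and q-binomial
coefficient in the product formula. -/

open MixedForms

set_option linter.unusedSectionVars false

/-! ### Power series with prescribed power sums -/

/-- `H = exp (∑ p l z ^ l / l)`, expressed by the differential equation it satisfies. -/
structure IsPowerSumExp {R : Type*} [CommRing R] (p : ℕ → R) (H : PowerSeries R) : Prop where
  const : PowerSeries.constantCoeff H = 1
  deriv : PowerSeries.derivative R H = PowerSeries.mk (fun l => p (l + 1)) * H

namespace IsPowerSumExp

variable {R : Type*} [CommRing R] {p p' : ℕ → R} {H H' : PowerSeries R}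

/-- Coefficientwise the differential equation is Newton's identity (n+1) h_{n+1} = Σ p_{k+1}
h_{n-k}. -/
theorem coeff_succ (h : IsPowerSumExp p H) (n : ℕ) :
    ((n : R) + 1) * PowerSeries.coeff (n + 1) H =
      ∑ x ∈ Finset.HasAntidiagonal.antidiagonal n, p (x.1 + 1) * PowerSeries.coeff x.2 H := by
  have := congrArg (PowerSeries.coeff n) h.deriv
  rw [PowerSeries.coeff_derivative, PowerSeries.coeff_mul] at this
  simp only [PowerSeries.coeff_mk] at this
  rw [mul_comm, this]

theorem of_coeff (h0 : PowerSeries.coeff 0 H = 1)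
    (h : ∀ n : ℕ, ((n : R) + 1) * PowerSeries.coeff (n + 1) H =
      ∑ x ∈ Finset.HasAntidiagonal.antidiagonal n, p (x.1 + 1) * PowerSeries.coeff x.2 H) :
    IsPowerSumExp p H where
  const := by rwa [← PowerSeries.coeff_zero_eq_constantCoeff_apply]
  deriv := by
    ext n
    rw [PowerSeries.coeff_derivative, PowerSeries.coeff_mul, mul_comm, h n]
    simp only [PowerSeries.coeff_mk]

/-- Newton's recursion determines h_{n+1} from the earlier coefficients because n + 1 is invertible.
The value of p at 0 never enters, so it is not compared. -/
theorem unique [Algebra ℚ R] (h : IsPowerSumExp p H) (h' : IsPowerSumExp p' H')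
    (hp : ∀ l, p (l + 1) = p' (l + 1)) : H = H' := by
  ext n
  induction n using Nat.strong_induction_on with
  | _ n ih =>
    cases n with
    | zero =>
      rw [PowerSeries.coeff_zero_eq_constantCoeff_apply,
        PowerSeries.coeff_zero_eq_constantCoeff_apply, h.const, h'.const]
    | succ n =>
      have e : ((n : R) + 1) * PowerSeries.coeff (n + 1) H =
          ((n : R) + 1) * PowerSeries.coeff (n + 1) H' := by
        rw [h.coeff_succ, h'.coeff_succ]
        refine Finset.sum_congr rfl fun x hx => ?_
        rw [hp, ih x.2 (by have := Finset.HasAntidiagonal.mem_antidiagonal.1 hx; omega)]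
      have u : IsUnit ((n : R) + 1) := by
        have : ((n : R) + 1) = algebraMap ℚ R ((n : ℚ) + 1) := by simp
        rw [this]
        exact (IsUnit.mk0 _ (by positivity)).map _
      exact u.mul_left_cancel e

theorem congr_left (h : IsPowerSumExp p H) (hp : ∀ l, p (l + 1) = p' (l + 1)) :
    IsPowerSumExp p' H := by
  refine ⟨h.const, ?_⟩
  rw [h.deriv]
  congr 2
  funext l
  exact hp l

theorem zero_one : IsPowerSumExp (0 : ℕ → R) 1 := by
  refine ⟨by simp, ?_⟩
  have : PowerSeries.mk (fun l => (0 : ℕ → R) (l + 1)) = 0 := by ext; simp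
  rw [this, zero_mul, Derivation.map_one_eq_zero]

theorem mul (h : IsPowerSumExp p H) (h' : IsPowerSumExp p' H') :
    IsPowerSumExp (p + p') (H * H') := by
  refine ⟨by rw [map_mul, h.const, h'.const, one_mul], ?_⟩
  have : PowerSeries.mk (fun l => (p + p') (l + 1)) =
      PowerSeries.mk (fun l => p (l + 1)) + PowerSeries.mk (fun l => p' (l + 1)) := by
    ext; simp
  rw [Derivation.leibniz, h.deriv, h'.deriv, this]
  simp only [smul_eq_mul]
  ring

theorem prod {ι : Type*} (s : Finset ι) {P : ι → ℕ → R} {F : ι → PowerSeries R}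
    (h : ∀ i ∈ s, IsPowerSumExp (P i) (F i)) :
    IsPowerSumExp (∑ i ∈ s, P i) (∏ i ∈ s, F i) := by
  classical
  induction s using Finset.induction_on with
  | empty => simpa using zero_one
  | insert a s ha ih =>
    rw [Finset.sum_insert ha, Finset.prod_insert ha]
    exact (h a (by simp)).mul (ih fun i hi => h i (by simp [hi]))

theorem geom (a : R) : IsPowerSumExp (fun l => a ^ l) (PowerSeries.mk fun l => a ^ l) := by
  refine of_coeff (by simp) fun n => ?_
  have : ∀ x ∈ Finset.HasAntidiagonal.antidiagonal n,
      a ^ (x.1 + 1) * PowerSeries.coeff x.2 (PowerSeries.mk fun l => a ^ l) = a ^ (n + 1) := by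
    intro x hx
    rw [PowerSeries.coeff_mk, ← pow_add]
    have := Finset.HasAntidiagonal.mem_antidiagonal.1 hx
    congr 1
    omega
  rw [Finset.sum_congr rfl this]
  simp

/-- The logarithm of 1 - az is -Σ a^l z^l / l. With `geom` this supplies a variable a with
multiplicity 1 or -1. -/
theorem linear (a : R) :
    IsPowerSumExp (fun l => -a ^ l) (1 - PowerSeries.C a * PowerSeries.X) := by
  refine ⟨by simp, ?_⟩
  have : PowerSeries.mk (fun l => -a ^ (l + 1)) * (1 - PowerSeries.C a * PowerSeries.X) =
      - PowerSeries.C a := by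
    ext n
    cases n with
    | zero => simp [mul_sub]
    | succ n =>
      rw [mul_sub, mul_one, mul_left_comm, map_sub, PowerSeries.coeff_C_mul,
        PowerSeries.coeff_succ_mul_X, PowerSeries.coeff_mk, PowerSeries.coeff_mk]
      simp
      ring
  rw [this, map_sub, Derivation.map_one_eq_zero, Derivation.leibniz]
  simp [PowerSeries.derivative_C]

theorem rescale (h : IsPowerSumExp p H) (a : R) :
    IsPowerSumExp (fun l => p l * a ^ l) (PowerSeries.rescale a H) := by
  have h0 := h.const
  rw [← PowerSeries.coeff_zero_eq_constantCoeff_apply] at h0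
  refine of_coeff (by simp [PowerSeries.coeff_rescale, h0]) fun n => ?_
  rw [PowerSeries.coeff_rescale, mul_left_comm, h.coeff_succ, Finset.mul_sum]
  refine Finset.sum_congr rfl fun x hx => ?_
  rw [PowerSeries.coeff_rescale, ← Finset.HasAntidiagonal.mem_antidiagonal.1 hx]
  ring

theorem map {S : Type*} [CommRing S] (h : IsPowerSumExp p H) (f : R →+* S) :
    IsPowerSumExp (fun l => f (p l)) (PowerSeries.map f H) := by
  have h0 := h.const
  rw [← PowerSeries.coeff_zero_eq_constantCoeff_apply] at h0
  refine of_coeff (by rw [PowerSeries.coeff_map, h0, map_one]) fun n => ?_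
  have := congrArg f (h.coeff_succ n)
  simpa using this

end IsPowerSumExp

/-! ### The cycle index of the symmetric group -/

/-- The order of the centralizer of a permutation with cycle lengths `m`. -/
def centralizerOrder (m : Multiset ℕ) : ℕ := m.prod * ∏ a ∈ m.toFinset, (m.count a).factorial

/-- A new cycle of length a contributes a rotations, and the number of permutations of the cycles of
length a grows by the factor of their new number. -/
theorem centralizerOrder_cons (a : ℕ) (m : Multiset ℕ) :
    centralizerOrder (a ::ₘ m) = a * (a ::ₘ m).count a * centralizerOrder m := by
  classical
  have h : ∏ b ∈ (a ::ₘ m).toFinset, ((a ::ₘ m).count b).factorial =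
      (a ::ₘ m).count a * ∏ b ∈ m.toFinset, (m.count b).factorial := by
    have h1 : ∏ b ∈ m.toFinset, (m.count b).factorial =
        ∏ b ∈ (a ::ₘ m).toFinset, (m.count b).factorial := by
      refine Finset.prod_subset (fun x hx => by simp_all) fun x _ hx => ?_
      rw [Multiset.count_eq_zero_of_notMem (by simpa using hx), Nat.factorial_zero]
    have ha : a ∈ (a ::ₘ m).toFinset := by simp
    rw [h1, ← Finset.mul_prod_erase _ _ ha, ← Finset.mul_prod_erase _ _ ha, ← mul_assoc,
      Multiset.count_cons_self, Nat.factorial_succ]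
    congr 1
    refine Finset.prod_congr rfl fun b hb => ?_
    rw [Multiset.count_cons_of_ne (Finset.ne_of_mem_erase hb)]
  rw [centralizerOrder, h, Multiset.prod_cons, centralizerOrder]
  ring

theorem centralizerOrder_ne_zero {m : Multiset ℕ} (h : ∀ a ∈ m, 0 < a) :
    centralizerOrder m ≠ 0 := by
  refine mul_ne_zero (Multiset.prod_ne_zero fun h0 => (h 0 h0).ne' rfl)
    (Finset.prod_ne_zero_iff.2 fun a _ => Nat.factorial_ne_zero _)

section CycleIndex

variable {R : Type*} [CommRing R]

/-- The product of the power sums `p l` over all cycle lengths `l`, fixed points included. -/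
noncomputable def cycleProd {α : Type*} [Fintype α] [DecidableEq α] (p : ℕ → R)
    (w : Equiv.Perm α) : R :=
  (w.partition.parts.map p).prod

variable [Algebra ℚ R]

/-- The size n + 1 of μ is the sum of a · m_a(μ) over its distinct parts a. The weight a · m_a turns
1/z_μ into 1/z_ν, where ν is μ with one part a removed, and p_a splits off. This is Newton's
recursion for the sums over partitions. -/
theorem sum_partition_succ (p : ℕ → R) (n : ℕ) :
    ((n : R) + 1) * ∑ μ : (n + 1).Partition,
        (centralizerOrder μ.parts : ℚ)⁻¹ • (μ.parts.map p).prod =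
      ∑ x ∈ Finset.HasAntidiagonal.antidiagonal n, p (x.1 + 1) *
        ∑ ν : x.2.Partition, (centralizerOrder ν.parts : ℚ)⁻¹ • (ν.parts.map p).prod := by
  classical
  set F : Multiset ℕ → R := fun m => (centralizerOrder m : ℚ)⁻¹ • (m.map p).prod with hF
  have key : ∀ (a : ℕ) (m : Multiset ℕ), 0 < a → (a * (a ::ₘ m).count a : ℚ) • F (a ::ₘ m) = p a * F m := by
    intro a m ha
    have h1 : ((a : ℚ) * ((a ::ₘ m).count a : ℕ)) ≠ 0 := by
      rw [Multiset.count_cons_self]; positivity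
    simp only [hF]
    rw [centralizerOrder_cons, smul_smul, Multiset.map_cons, Multiset.prod_cons, mul_smul_comm]
    push_cast
    rw [mul_inv, ← mul_assoc, mul_inv_cancel₀ h1, one_mul]
  have h1 : ∀ μ : (n + 1).Partition, ((n : R) + 1) * F μ.parts =
      ∑ x ∈ Finset.HasAntidiagonal.antidiagonal n,
        if x.1 + 1 ∈ μ.parts then (((x.1 + 1 : ℕ) : ℚ) * μ.parts.count (x.1 + 1)) • F μ.parts
        else 0 := by
    intro μ
    have hs : (∑ x ∈ Finset.HasAntidiagonal.antidiagonal n, (x.1 + 1) * μ.parts.count (x.1 + 1)) = n + 1 := by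
      rw [Finset.Nat.sum_antidiagonal_eq_sum_range_succ_mk,
        ← Finset.sum_image (s := Finset.range n.succ) (g := fun a => a + 1)
          (f := fun a => a * μ.parts.count a) (fun a _ b _ h => by simpa using h)]
      conv_rhs => rw [← μ.parts_sum, Finset.sum_multiset_count]
      symm
      refine Finset.sum_subset_zero_on_sdiff ?_ ?_ ?_
      · intro a ha
        have ha' : a ∈ μ.parts := by simpa using ha
        have := μ.parts_pos ha'
        have := μ.le_of_mem_parts ha'
        exact Finset.mem_image.2 ⟨a - 1, by simp; omega, by omega⟩
      · intro a ha
        rw [Finset.mem_sdiff] at ha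
        rw [Multiset.count_eq_zero_of_notMem (by simpa using ha.2), mul_zero]
      · intro a _
        rw [smul_eq_mul, mul_comm]
    have e : ((n : R) + 1) * F μ.parts = ((n + 1 : ℕ) : ℚ) • F μ.parts := by
      rw [Algebra.smul_def]; simp
    rw [e, ← congrArg (Nat.cast (R := ℚ)) hs, Nat.cast_sum, Finset.sum_smul]
    refine Finset.sum_congr rfl fun x _ => ?_
    split_ifs with hx
    · push_cast; rfl
    · rw [Multiset.count_eq_zero_of_notMem hx]; simp
  rw [Finset.mul_sum, Finset.sum_congr rfl fun μ _ => h1 μ, Finset.sum_comm]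
  refine Finset.sum_congr rfl fun x hx => ?_
  have hx' := Finset.HasAntidiagonal.mem_antidiagonal.1 hx
  obtain ⟨a, b⟩ := x
  simp only at hx' ⊢
  obtain rfl : b = n + 1 - (a + 1) := by omega
  rw [← Finset.sum_filter, ← Finset.sum_subtype_eq_sum_filter, Finset.mul_sum,
    Finset.subtype_univ]
  -- Removing one part a + 1 is a bijection from the partitions of n + 1 that contain it to all
  -- partitions of n - a.
  refine Fintype.sum_equiv (Nat.Partition.partitionWithPartEquiv (by omega) (by omega)) _ _ ?_
  intro μ
  have h2 : μ.1.parts = (a + 1) ::ₘ (Nat.Partition.partitionWithPartEquiv (n := n + 1)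
      (a := a + 1) (by omega) (by omega) μ).parts := by
    rw [Nat.Partition.partitionWithPartEquiv_apply_parts, Multiset.cons_erase μ.2]
  have := key (a + 1) (Nat.Partition.partitionWithPartEquiv (n := n + 1)
      (a := a + 1) (by omega) (by omega) μ).parts (by omega)
  rw [← h2] at this
  exact this

/-- `Equiv.Perm.card_of_cycleType_mul_eq` counts by cycle type, which ignores fixed points, whereas
a partition records them as parts 1. The parts 1 are therefore split off, and their factorial is the
number of permutations of the fixed points. -/
theorem centralizerOrder_mul_card {α : Type*} [Fintype α] [DecidableEq α]
    (μ : (Fintype.card α).Partition) :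
    (Finset.univ.filter fun w : Equiv.Perm α => w.partition = μ).card *
      centralizerOrder μ.parts = (Fintype.card α).factorial := by
  classical
  set m := μ.parts.filter fun a => 2 ≤ a with hm
  have hsplit : μ.parts = m + Multiset.replicate (μ.parts.count 1) 1 := by
    conv_lhs => rw [← Multiset.filter_add_not (fun a => 2 ≤ a) μ.parts]
    congr 1
    rw [← Multiset.filter_eq']
    refine Multiset.filter_congr fun a ha => ?_
    have := μ.parts_pos ha
    omega
  have hsum : m.sum + μ.parts.count 1 = Fintype.card α := by
    have := μ.parts_sum
    rw [hsplit] at this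
    simpa using this
  have h1 : (Finset.univ.filter fun w : Equiv.Perm α => w.partition = μ) =
      Finset.univ.filter fun w : Equiv.Perm α => w.cycleType = m := by
    refine Finset.filter_congr fun w _ => ⟨fun h => ?_, fun h => ?_⟩
    · rw [← Equiv.Perm.filter_parts_partition_eq_cycleType, h]
    · ext1
      rw [Equiv.Perm.parts_partition, h, ← Equiv.Perm.sum_cycleType, h, hsplit]
      congr 2
      omega
  have h2 := Equiv.Perm.card_of_cycleType_mul_eq α m
  rw [if_pos ⟨by omega, fun a ha => (Multiset.mem_filter.1 ha).2⟩] at h2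
  rw [h1, ← h2]
  have hc : Fintype.card α - m.sum = μ.parts.count 1 := by omega
  rw [hc, centralizerOrder]
  have hp : μ.parts.prod = m.prod := by
    conv_lhs => rw [hsplit]
    simp
  have hf : ∏ a ∈ μ.parts.toFinset, (μ.parts.count a).factorial =
      (μ.parts.count 1).factorial * ∏ a ∈ m.toFinset, (m.count a).factorial := by
    have e1 : ∏ a ∈ m.toFinset, (m.count a).factorial =
        ∏ a ∈ m.toFinset, (μ.parts.count a).factorial := by
      refine Finset.prod_congr rfl fun a ha => ?_
      rw [Multiset.mem_toFinset, Multiset.mem_filter] at ha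
      rw [Multiset.count_filter, if_pos ha.2]
    have e2 : (1 : ℕ) ∉ m.toFinset := by
      rw [Multiset.mem_toFinset, Multiset.mem_filter]; omega
    rw [e1, ← Finset.prod_insert (f := fun a => (μ.parts.count a).factorial) e2]
    refine Finset.prod_subset ?_ ?_
    · intro a ha
      rw [Multiset.mem_toFinset] at ha
      have := μ.parts_pos ha
      rw [Finset.mem_insert, Multiset.mem_toFinset, Multiset.mem_filter]
      by_cases h : a = 1
      · exact Or.inl h
      · exact Or.inr ⟨ha, by omega⟩
    · intro a _ ha
      rw [Multiset.count_eq_zero_of_notMem (by simpa using ha), Nat.factorial_zero]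
  rw [hp, hf]
  ring

theorem average_cycleProd {α : Type*} [Fintype α] [DecidableEq α] (p : ℕ → R) :
    ((Fintype.card α).factorial : ℚ)⁻¹ • ∑ w : Equiv.Perm α, cycleProd p w =
      ∑ μ : (Fintype.card α).Partition,
        (centralizerOrder μ.parts : ℚ)⁻¹ • (μ.parts.map p).prod := by
  classical
  rw [← Finset.sum_fiberwise (s := Finset.univ) (g := fun w : Equiv.Perm α => w.partition),
    Finset.smul_sum]
  refine Finset.sum_congr rfl fun μ _ => ?_
  have : ∀ w ∈ Finset.univ.filter (fun w : Equiv.Perm α => w.partition = μ),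
      cycleProd p w = (μ.parts.map p).prod := by
    intro w hw
    rw [cycleProd, (Finset.mem_filter.1 hw).2]
  rw [Finset.sum_congr rfl this, Finset.sum_const, ← Nat.cast_smul_eq_nsmul ℚ, smul_smul]
  congr 1
  have h := centralizerOrder_mul_card μ
  have h0 := centralizerOrder_ne_zero fun a ha => μ.parts_pos (i := a) ha
  rw [← h]
  have h2 : (Finset.univ.filter fun w : Equiv.Perm α => w.partition = μ).card ≠ 0 := by
    intro h3
    rw [h3, zero_mul] at h
    exact Nat.factorial_ne_zero _ h.symm
  push_cast
  field_simp

/-- The cycle index series of the symmetric groups is the exponential of `∑ p l z ^ l / l`. -/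
theorem isPowerSumExp_cycleIndex (p : ℕ → R) :
    IsPowerSumExp p (PowerSeries.mk fun n =>
      (n.factorial : ℚ)⁻¹ • ∑ w : Equiv.Perm (Fin n), cycleProd p w) := by
  have e : ∀ n : ℕ, (n.factorial : ℚ)⁻¹ • ∑ w : Equiv.Perm (Fin n), cycleProd p w =
      ∑ μ : n.Partition, (centralizerOrder μ.parts : ℚ)⁻¹ • (μ.parts.map p).prod := by
    intro n
    have := average_cycleProd (α := Fin n) p
    rw [Fintype.card_fin] at this
    exact this
  refine IsPowerSumExp.of_coeff ?_ fun n => ?_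
  · rw [PowerSeries.coeff_mk, e]
    simp [centralizerOrder]
  · simp only [PowerSeries.coeff_mk, e]
    exact sum_partition_succ p n

end CycleIndex

/-! ### Orbits of a permutation -/

section Orbits

variable {α : Type*} [Fintype α] [DecidableEq α] (w : Equiv.Perm α)

/-- The set of orbits of a permutation. -/
abbrev PermOrbit : Type _ := Quotient (Equiv.Perm.SameCycle.setoid w)

noncomputable instance : Fintype (PermOrbit w) := Fintype.ofFinite _

noncomputable instance : DecidableEq (PermOrbit w) := Classical.decEq _

/-- The number of elements of an orbit. -/
noncomputable def orbitSize (o : PermOrbit w) : ℕ :=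
  (Finset.univ.filter fun i : α => (Quotient.mk _ i : PermOrbit w) = o).card

theorem permOrbit_mk_eq {i j : α} :
    (Quotient.mk _ i : PermOrbit w) = Quotient.mk _ j ↔ w.SameCycle i j := Quotient.eq

theorem orbitSize_pos (o : PermOrbit w) : 0 < orbitSize w o := by
  refine Finset.card_pos.2 ⟨o.out, ?_⟩
  simp

/-- The size of an orbit is the minimal period of each of its points. -/
theorem orbitSize_mk_dvd (i : α) (l : ℕ) :
    orbitSize w (Quotient.mk _ i) ∣ l ↔ (w ^ l) i = i := by
  classical
  have h1 : orbitSize w (Quotient.mk _ i) = Function.minimalPeriod w i := by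
    have h := MulAction.minimalPeriod_eq_card w i
    have e : (fun x : α => w • x) = w := rfl
    rw [e] at h
    rw [h, orbitSize, Fintype.card_of_subtype]
    intro j
    rw [Finset.mem_filter, permOrbit_mk_eq, Equiv.Perm.sameCycle_comm]
    simp only [Finset.mem_univ, true_and]
    constructor
    · rintro ⟨k, hk⟩
      exact ⟨⟨w ^ k, k, rfl⟩, hk⟩
    · rintro ⟨⟨_, k, rfl⟩, hk⟩
      exact ⟨k, hk⟩
  rw [h1, ← Function.isPeriodicPt_iff_minimalPeriod_dvd, Function.IsPeriodicPt,
    Function.IsFixedPt, ← Equiv.Perm.coe_pow]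

theorem prod_comp_mk {R : Type*} [CommMonoid R] (g : PermOrbit w → R) :
    ∏ i, g (Quotient.mk _ i) = ∏ o, g o ^ orbitSize w o := by
  rw [← Finset.prod_fiberwise (s := Finset.univ) (g := fun i : α => (Quotient.mk _ i : PermOrbit w))]
  refine Finset.prod_congr rfl fun o _ => ?_
  rw [orbitSize, ← Finset.prod_const]
  refine Finset.prod_congr rfl fun i hi => ?_
  rw [(Finset.mem_filter.1 hi).2]

theorem orbitSize_eq (i : α) :
    orbitSize w (Quotient.mk _ i) = (Finset.univ.filter fun j => w.SameCycle i j).card := by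
  rw [orbitSize]
  congr 1
  refine Finset.filter_congr fun j _ => ?_
  rw [permOrbit_mk_eq, Equiv.Perm.sameCycle_comm]

/-- The partition of w consists of the lengths of its nontrivial cycles and a part 1 for each fixed
point. The orbits are split accordingly, by whether w moves the chosen representative. -/
theorem cycleProd_eq_prod_orbits {R : Type*} [CommRing R] (p : ℕ → R) :
    cycleProd p w = ∏ o, p (orbitSize w o) := by
  classical
  rw [cycleProd, Equiv.Perm.parts_partition, Multiset.map_add, Multiset.prod_add,
    Multiset.map_replicate, Multiset.prod_replicate,
    ← Finset.prod_filter_mul_prod_filter_not Finset.univ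
      (fun o : PermOrbit w => w o.out ≠ o.out)]
  congr 1
  · rw [Equiv.Perm.cycleType, Multiset.map_map]
    symm
    change _ = ∏ c ∈ w.cycleFactorsFinset, p (c.support.card)
    refine Finset.prod_bij (fun o _ => w.cycleOf o.out) ?_ ?_ ?_ ?_
    · intro o ho
      rw [Equiv.Perm.cycleOf_mem_cycleFactorsFinset_iff, Equiv.Perm.mem_support]
      exact (Finset.mem_filter.1 ho).2
    · intro o ho o' ho' h
      rw [← Quotient.out_eq o, ← Quotient.out_eq o', permOrbit_mk_eq]
      have h1 := (Equiv.Perm.sameCycle_iff_cycleOf_eq_of_mem_support (g := w)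
        (x := o.out) (y := o'.out)
        (Equiv.Perm.mem_support.2 (Finset.mem_filter.1 ho).2)
        (Equiv.Perm.mem_support.2 (Finset.mem_filter.1 ho').2))
      exact h1.2 h
    · intro c hc
      have hc' := Equiv.Perm.mem_cycleFactorsFinset_iff.1 hc
      obtain ⟨x, hx⟩ := hc'.1.nonempty_support
      have hcx : c = w.cycleOf x := Equiv.Perm.cycle_is_cycleOf hx hc
      have hs : w.SameCycle (Quotient.mk _ x : PermOrbit w).out x :=
        (permOrbit_mk_eq w).1 (Quotient.out_eq _)
      have hwx : w x ≠ x := by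
        rw [← hc'.2 x hx]
        exact Equiv.Perm.mem_support.1 hx
      refine ⟨Quotient.mk _ x, Finset.mem_filter.2 ⟨Finset.mem_univ _, ?_⟩, ?_⟩
      · exact fun h => hwx (hs.apply_eq_self_iff.1 h)
      · rw [hcx]
        exact hs.cycleOf_eq
    · intro o ho
      congr 1
      conv_lhs => rw [← Quotient.out_eq o]
      rw [orbitSize_eq]
      congr 1
      ext j
      rw [Finset.mem_filter, Equiv.Perm.mem_support_cycleOf_iff, Equiv.Perm.mem_support]
      have := (Finset.mem_filter.1 ho).2
      simp [this]
  · have h1 : ∀ o ∈ Finset.univ.filter (fun o : PermOrbit w => ¬ w o.out ≠ o.out),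
        p (orbitSize w o) = p 1 := by
      intro o ho
      congr 1
      have h2 : (w ^ 1) o.out = o.out := by simpa using (Finset.mem_filter.1 ho).2
      rw [← orbitSize_mk_dvd, Quotient.out_eq] at h2
      exact Nat.dvd_one.1 h2
    rw [Finset.prod_congr rfl h1, Finset.prod_const]
    congr 1
    rw [← Finset.card_univ, ← Finset.card_sdiff_of_subset (Finset.subset_univ _)]
    symm
    refine Finset.card_bij (fun o _ => o.out) ?_ ?_ ?_
    · intro o ho
      simpa using (Finset.mem_filter.1 ho).2
    · intro o _ o' _ h
      exact Quotient.out_injective h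
    · intro x hx
      have hwx : w x = x := by simpa using hx
      have hs : w.SameCycle (Quotient.mk _ x : PermOrbit w).out x :=
        (permOrbit_mk_eq w).1 (Quotient.out_eq _)
      have e : (Quotient.mk _ x : PermOrbit w).out = x := by
        exact (hs.eq_of_right hwx)
      refine ⟨Quotient.mk _ x, Finset.mem_filter.2 ⟨Finset.mem_univ _, ?_⟩, e⟩
      rw [e]
      simpa using hwx

/-- The generating function of the colourings fixed by a permutation. -/
theorem sum_fixed_colourings {β R : Type*} [Fintype β] [DecidableEq β] [CommRing R] (x : β → R) :
    ∑ f : α → β with (∀ i, f (w i) = f i), ∏ i, x (f i) =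
      cycleProd (fun l => ∑ b, x b ^ l) w := by
  classical
  rw [cycleProd_eq_prod_orbits, Finset.prod_univ_sum, Fintype.piFinset_univ]
  symm
  refine Finset.sum_bij (fun g _ => fun i => g (Quotient.mk _ i)) ?_ ?_ ?_ ?_
  · intro g _
    refine Finset.mem_filter.2 ⟨Finset.mem_univ _, fun i => ?_⟩
    exact congrArg g ((permOrbit_mk_eq w).2 (Equiv.Perm.sameCycle_apply_left.2 (Equiv.Perm.SameCycle.refl w i)))
  · intro g _ g' _ h
    funext o
    induction o using Quotient.inductionOn with
    | _ i => exact congrFun h i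
  · intro f hf
    have hf' := (Finset.mem_filter.1 hf).2
    -- Invariance under w must be extended to all integer powers, since these define the orbits to
    -- which f descends.
    have hz : ∀ (k : ℤ) (i : α), f ((w ^ k) i) = f i := by
      have hn : ∀ (k : ℕ) (i : α), f ((w ^ k) i) = f i := by
        intro k
        induction k with
        | zero => intro i; rfl
        | succ k ih => intro i; rw [pow_succ, Equiv.Perm.mul_apply, ih, hf']
      intro k i
      cases k with
      | ofNat k => exact hn k i
      | negSucc k =>
        rw [zpow_negSucc]
        have := hn (k + 1) ((w ^ (k + 1))⁻¹ i)
        rw [← Equiv.Perm.mul_apply, mul_inv_cancel] at this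
        exact this.symm
    refine ⟨Quotient.lift f ?_, Finset.mem_univ _, rfl⟩
    rintro i j ⟨k, hk⟩
    rw [← hk, hz]
  · intro g _
    exact (prod_comp_mk w fun o => x (g o)).symm

theorem card_fixed_pow (l : ℕ) :
    (Finset.univ.filter fun i => (w ^ l) i = i).card =
      ∑ o : PermOrbit w, if orbitSize w o ∣ l then orbitSize w o else 0 := by
  rw [Finset.card_filter]
  -- Each orbit consists entirely of fixed points of w^l or of none. Writing ℕ multiplicatively
  -- turns the product over orbits into a sum.
  have h := prod_comp_mk (R := Multiplicative ℕ) w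
    (fun o => Multiplicative.ofAdd (if orbitSize w o ∣ l then 1 else 0))
  have h' := congrArg Multiplicative.toAdd h
  rw [toAdd_prod, toAdd_prod] at h'
  simp only [toAdd_ofAdd, toAdd_pow, smul_eq_mul] at h'
  simp only [orbitSize_mk_dvd] at h'
  rw [h']
  refine Finset.sum_congr rfl fun o _ => ?_
  split_ifs <;> simp

end Orbits

/-- The logarithm of 1 - z^c is -Σ z^{ck}/k, and z^{ck}/k = c z^l / l for l = ck. This is the factor
of a c-cycle in the reciprocal characteristic polynomial. -/
theorem isPowerSumExp_one_sub_pow {R : Type*} [CommRing R] {c : ℕ} (hc : 0 < c) :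
    IsPowerSumExp (fun l => -((if c ∣ l then c else 0 : ℕ) : R)) (1 - PowerSeries.X ^ c) := by
  refine ⟨by simp [hc.ne'], ?_⟩
  -- Multiplication by 1 - X^c telescopes the c-periodic coefficients and leaves only the first
  -- nonzero one, in degree c - 1.
  have h : PowerSeries.mk (fun l => -((if c ∣ l + 1 then c else 0 : ℕ) : R)) *
      (1 - PowerSeries.X ^ c) = -(c : PowerSeries R) * PowerSeries.X ^ (c - 1) := by
    ext n
    have hr : (PowerSeries.coeff n) (-(c : PowerSeries R) * PowerSeries.X ^ (c - 1)) =
        if n + 1 = c then -(c : R) else 0 := by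
      have : (-(c : PowerSeries R)) = PowerSeries.C (-(c : R)) := by simp
      rw [this, PowerSeries.coeff_C_mul, PowerSeries.coeff_X_pow]
      have : n = c - 1 ↔ n + 1 = c := by omega
      simp only [this, mul_ite, mul_one, mul_zero]
    rw [hr, mul_sub, mul_one, map_sub, PowerSeries.coeff_mul_X_pow', PowerSeries.coeff_mk]
    by_cases hn : c ≤ n
    · rw [if_pos hn, PowerSeries.coeff_mk, if_neg (show ¬ n + 1 = c by omega)]
      have : c ∣ n - c + 1 ↔ c ∣ n + 1 := by
        rw [show n + 1 = n - c + 1 + c by omega, Nat.dvd_add_self_right]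
      simp only [this, sub_self]
    · rw [if_neg hn, sub_zero]
      by_cases hn1 : n + 1 = c
      · simp [hn1]
      · rw [if_neg (Nat.not_dvd_of_pos_of_lt (by omega) (by omega)), if_neg hn1]
        simp
  rw [h, map_sub, Derivation.map_one_eq_zero, Derivation.leibniz_pow, PowerSeries.derivative_X]
  simp

/-- The reciprocal characteristic polynomial of a permutation, from its power sums. -/
theorem prod_one_sub_eigenvalues {α : Type*} [Fintype α] [DecidableEq α] (w : Equiv.Perm α)
    {ι R : Type*} [Fintype ι] [CommRing R] [Algebra ℚ R] (μ : ι → R)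
    (h : ∀ l : ℕ, ∑ j, μ j ^ l = ((Finset.univ.filter fun i => (w ^ l) i = i).card : R)) :
    ∏ j, (1 - PowerSeries.C (μ j) * PowerSeries.X) =
      cycleProd (fun l => (1 - PowerSeries.X ^ l : PowerSeries R)) w := by
  rw [cycleProd_eq_prod_orbits]
  refine (IsPowerSumExp.prod _ fun j _ => IsPowerSumExp.linear (μ j)).unique
    (IsPowerSumExp.prod _ fun o _ => isPowerSumExp_one_sub_pow (orbitSize_pos w o)) fun l => ?_
  simp only [Finset.sum_apply, Finset.sum_neg_distrib]
  rw [h, card_fixed_pow, Nat.cast_sum]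

/-! ### Traces on symmetric and exterior powers -/

section EigenBasis

variable {V : Type*} [AddCommGroup V] [Module ℂ V]

theorem trace_of_eigenbasis {ι : Type*} [Fintype ι] (b : Module.Basis ι ℂ V) (f : V →ₗ[ℂ] V)
    (μ : ι → ℂ) (h : ∀ i, f (b i) = μ i • b i) : LinearMap.trace ℂ V f = ∑ i, μ i := by
  classical
  rw [LinearMap.trace_eq_matrix_trace ℂ b, Matrix.trace]
  refine Finset.sum_congr rfl fun i _ => ?_
  rw [Matrix.diag_apply, LinearMap.toMatrix_apply, h]
  simp

/-- The polynomial X^m - 1 is separable over ℂ, so f is semisimple and its eigenspaces decompose V.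
-/
theorem exists_eigenbasis [FiniteDimensional ℂ V] (f : Module.End ℂ V) {m : ℕ} (hm : m ≠ 0)
    (hf : f ^ m = 1) :
    ∃ (b : Module.Basis (Fin (Module.finrank ℂ V)) ℂ V) (μ : Fin (Module.finrank ℂ V) → ℂ),
      ∀ i, f (b i) = μ i • b i := by
  classical
  have hs : f.IsSemisimple := by
    refine Module.End.isSemisimple_of_squarefree_aeval_eq_zero
      (p := Polynomial.X ^ m - Polynomial.C 1)
      (Polynomial.separable_X_pow_sub_C (1 : ℂ) (by exact_mod_cast hm) one_ne_zero).squarefree ?_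
    simp [hf]
  have hi : DirectSum.IsInternal fun μ : ℂ => f.eigenspace μ :=
    DirectSum.isInternal_submodule_of_iSupIndep_of_iSup_eq_top f.eigenspaces_iSupIndep
      hs.iSup_eigenspace_eq_top
  let b := hi.collectedBasis fun μ => Module.finBasis ℂ (f.eigenspace μ)
  have : Finite (Σ μ : ℂ, Fin (Module.finrank ℂ (f.eigenspace μ))) :=
    Module.Finite.finite_basis b
  let := Fintype.ofFinite (Σ μ : ℂ, Fin (Module.finrank ℂ (f.eigenspace μ)))
  have hc := Module.finrank_eq_card_basis b
  let e := Fintype.equivFinOfCardEq hc.symm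
  refine ⟨b.reindex e, fun i => (e.symm i).1, fun i => ?_⟩
  rw [Module.Basis.reindex_apply]
  exact Module.End.mem_eigenspace_iff.1 (hi.collectedBasis_mem _ _)

/-- A basis identifies S(V) with a polynomial ring; the i-th power of the span of the variables is
the space of forms of degree i. -/
theorem map_symPower {ι : Type*} (b : Module.Basis ι ℂ V) (i : ℕ) :
    (symPower V i).map (SymmetricAlgebra.equivMvPolynomial b).toLinearEquiv.toLinearMap =
      MvPolynomial.homogeneousSubmodule ι ℂ i := by
  have h1 : (LinearMap.range (SymmetricAlgebra.ι ℂ V)).map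
      (SymmetricAlgebra.equivMvPolynomial b).toLinearEquiv.toLinearMap =
        MvPolynomial.homogeneousSubmodule ι ℂ 1 := by
    rw [MvPolynomial.homogeneousSubmodule_one_eq_span_X, ← LinearMap.range_comp,
      LinearMap.range_eq_map, ← b.span_eq, Submodule.map_span, ← Set.range_comp]
    congr 2
    funext j
    simp
  have h2 := Submodule.map_pow (LinearMap.range (SymmetricAlgebra.ι ℂ V))
    (SymmetricAlgebra.equivMvPolynomial b).toAlgHom i
  refine h2.trans ?_
  refine (congrArg (· ^ i) h1).trans ?_
  exact MvPolynomial.homogeneousSubmodule_one_pow (σ := ι) (R := ℂ) i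

/-- The monomials of degree `i` in a basis of `V` form a basis of `S^i(V)`. -/
noncomputable def symPowBasis {ι : Type*} (b : Module.Basis ι ℂ V) (i : ℕ) :
    Module.Basis {d : ι →₀ ℕ | d.degree = i} ℂ (SymPow V i) :=
  have h := (map_symPower b i).trans (MvPolynomial.homogeneousSubmodule_eq_finsupp_supported ι ℂ i)
  (MvPolynomial.basisRestrictSupport ℂ {d : ι →₀ ℕ | d.degree = i}).map
    (((SymmetricAlgebra.equivMvPolynomial b).toLinearEquiv.submoduleMap (symPower V i)).trans
      (LinearEquiv.ofEq _ _ h)).symm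

/-- The inclusion of `S^i(V)` in the symmetric algebra. -/
def symPowVal (i : ℕ) : SymPow V i →ₗ[ℂ] SymmetricAlgebra ℂ V := (symPower V i).subtype

theorem symPowVal_injective (i : ℕ) : Function.Injective (symPowVal (V := V) i) :=
  Subtype.val_injective

theorem coe_symPowBasis {ι : Type*} (b : Module.Basis ι ℂ V) (i : ℕ)
    (d : {d : ι →₀ ℕ | d.degree = i}) :
    symPowVal i (symPowBasis b i d) =
      (SymmetricAlgebra.equivMvPolynomial b).symm (MvPolynomial.monomial d.1 1) := by
  have h : (MvPolynomial.basisRestrictSupport ℂ {d : ι →₀ ℕ | d.degree = i} d).1 =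
      MvPolynomial.monomial d.1 1 := by
    have hm : MvPolynomial.monomial d.1 (1 : ℂ) ∈
        MvPolynomial.restrictSupport ℂ {d : ι →₀ ℕ | d.degree = i} := by
      rw [MvPolynomial.restrictSupport_eq_span]
      exact Submodule.subset_span ⟨d.1, d.2, rfl⟩
    suffices hx : MvPolynomial.basisRestrictSupport ℂ {d : ι →₀ ℕ | d.degree = i} d =
        ⟨_, hm⟩ from congrArg Subtype.val hx
    rw [Module.Basis.apply_eq_iff]
    classical
    ext m
    have h1 : (MvPolynomial.basisRestrictSupport ℂ {d : ι →₀ ℕ | d.degree = i}).repr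
        ⟨_, hm⟩ m = MvPolynomial.coeff m.1 (MvPolynomial.monomial d.1 (1 : ℂ)) := rfl
    rw [h1, MvPolynomial.coeff_monomial, Finsupp.single_apply]
    simp only [Subtype.ext_iff]
  rw [← h]
  rfl

theorem setOf_degree_eq {ι : Type*} [Fintype ι] [DecidableEq ι] (i : ℕ) :
    {d : ι →₀ ℕ | d.degree = i} = ↑(Finset.finsuppAntidiag (Finset.univ : Finset ι) i) := by
  ext d
  simp [Finsupp.degree_eq_sum]

noncomputable instance {ι : Type*} [Fintype ι] (i : ℕ) :
    Fintype {d : ι →₀ ℕ | d.degree = i} := by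
  classical
  rw [setOf_degree_eq]
  infer_instance

instance {i : ℕ} [FiniteDimensional ℂ V] : FiniteDimensional ℂ (SymPow V i) :=
  Module.Finite.of_basis (symPowBasis (Module.finBasis ℂ V) i)

instance {k : ℕ} [FiniteDimensional ℂ V] : FiniteDimensional ℂ (ExtPow V k) :=
  inferInstanceAs (FiniteDimensional ℂ (⋀[ℂ]^k V))

variable {G : Type*} [Group G] (ρ : Representation ℂ G V)

/-- Monomials in an eigenbasis are eigenvectors, so the trace is the complete symmetric function h_i
of the eigenvalues. -/
theorem symPowerRep_trace {ι : Type*} [Fintype ι] (g : G) (b : Module.Basis ι ℂ V) (μ : ι → ℂ)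
    (h : ∀ i, ρ g (b i) = μ i • b i) (i : ℕ) :
    (symPowerRep ρ i).character g =
      PowerSeries.coeff i (∏ j, PowerSeries.mk fun l => μ j ^ l) := by
  classical
  have hb : ∀ d, symPowerRep ρ i g (symPowBasis b i d) = (∏ j, μ j ^ d.1 j) • symPowBasis b i d := by
    intro d
    apply symPowVal_injective
    rw [map_smul]
    have h1 : symPowVal i (symPowerRep ρ i g (symPowBasis b i d)) =
        symAlgRep ρ g (symPowVal i (symPowBasis b i d)) := rfl
    rw [h1, coe_symPowBasis]
    have h2 : (SymmetricAlgebra.lift ((SymmetricAlgebra.ι ℂ V) ∘ₗ (ρ g))).comp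
        (SymmetricAlgebra.equivMvPolynomial b).symm.toAlgHom =
        (SymmetricAlgebra.equivMvPolynomial b).symm.toAlgHom.comp
          (MvPolynomial.aeval fun j => MvPolynomial.C (μ j) * MvPolynomial.X j) := by
      apply MvPolynomial.algHom_ext
      intro j
      simp [h, MvPolynomial.C_mul']
    have h3 := DFunLike.congr_fun h2 (MvPolynomial.monomial d.1 1)
    refine Eq.trans h3 ?_
    rw [← map_smul]
    refine congrArg (SymmetricAlgebra.equivMvPolynomial b).symm ?_
    change MvPolynomial.aeval (fun j => MvPolynomial.C (μ j) * MvPolynomial.X j)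
      (MvPolynomial.monomial d.1 (1 : ℂ)) = _
    rw [MvPolynomial.aeval_monomial, map_one, one_mul, MvPolynomial.monomial_eq, Finsupp.prod_fintype _ _ (by simp),
      Finsupp.prod_fintype _ _ (by simp), ← MvPolynomial.C_mul', map_one, one_mul, map_prod,
      ← Finset.prod_mul_distrib]
    simp only [mul_pow, map_pow]
  rw [Representation.character, trace_of_eigenbasis (symPowBasis b i) _ _ hb,
    PowerSeries.coeff_prod]
  simp only [PowerSeries.coeff_mk]
  symm
  refine Finset.sum_subtype _ (fun d => ?_) _
  rw [setOf_degree_eq, Finset.mem_coe]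

/-- Wedge products of distinct eigenvectors are eigenvectors, so the trace is the elementary
symmetric function e_k of the eigenvalues. -/
theorem extPowerRep_trace {m : ℕ} (g : G) (b : Module.Basis (Fin m) ℂ V) (μ : Fin m → ℂ)
    (h : ∀ i, ρ g (b i) = μ i • b i) (k : ℕ) :
    (extPowerRep ρ k).character g =
      Polynomial.coeff (∏ j, (1 + Polynomial.C (μ j) * Polynomial.X)) k := by
  classical
  have hb : ∀ s, exteriorPower.map k (ρ g) (b.exteriorPower k s) =
      (∏ j ∈ s.1, μ j) • b.exteriorPower k s := by
    intro s
    rw [exteriorPower.basis_apply, exteriorPower.map_apply_ιMulti_family,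
      exteriorPower.ιMulti_family, exteriorPower.ιMulti_family]
    have e : (ρ g ∘ b) ∘ (Set.powersetCard.ofFinEmbEquiv.symm s) =
        fun l => μ (Set.powersetCard.ofFinEmbEquiv.symm s l) •
          (b ∘ (Set.powersetCard.ofFinEmbEquiv.symm s)) l := by
      funext l
      simp [h]
    rw [e, AlternatingMap.map_smul_univ]
    congr 1
    rw [← Finset.prod_coe_sort s.1 μ]
    exact Fintype.prod_equiv (Set.powersetCard.orderIsoOfFin s).toEquiv _ _ fun l => rfl
  have h1 : (extPowerRep ρ k).character g = ∑ s : Set.powersetCard (Fin m) k, ∏ j ∈ s.1, μ j :=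
    trace_of_eigenbasis (b.exteriorPower k) _ _ hb
  rw [h1, Finset.prod_one_add, Polynomial.finsetSum_coeff]
  have h2 : ∀ t ∈ (Finset.univ : Finset (Fin m)).powerset,
      (∏ j ∈ t, (Polynomial.C (μ j) * Polynomial.X)).coeff k =
        if t.card = k then ∏ j ∈ t, μ j else 0 := by
    intro t _
    rw [Finset.prod_mul_distrib, Finset.prod_const, ← map_prod, Polynomial.coeff_C_mul,
      Polynomial.coeff_X_pow]
    simp [eq_comm]
  rw [Finset.sum_congr rfl h2, ← Finset.sum_filter]
  symm
  refine Finset.sum_subtype _ (fun t => ?_) _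
  simp [Set.powersetCard]

end EigenBasis

/-! ### The Hilbert series as an average of traces -/

section Average

variable {G : Type*} [Group G] {V : Type*} [AddCommGroup V] [Module ℂ V]
  {U : Type*} [AddCommGroup U] [Module ℂ U]

/-- The Hilbert series as an element of `ℚ[t][[q]]`. -/
noncomputable def hilbPoly (ρ : Representation ℂ G V) (σ : Representation ℂ G U) :
    PowerSeries (Polynomial ℚ) :=
  PowerSeries.mk fun i => ∑ k ∈ Finset.range (Module.finrank ℂ V + 1),
    (mixedDim ρ σ i k : Polynomial ℚ) * Polynomial.X ^ k

/-- The embedding of `ℚ[t][[q]]` in `ℚ(t)((q))`. -/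
noncomputable def toQT : PowerSeries (Polynomial ℚ) →+* QTField :=
  (HahnSeries.ofPowerSeries ℤ (RatFunc ℚ)).comp
    (PowerSeries.map (algebraMap (Polynomial ℚ) (RatFunc ℚ)))

/-- The embedding of `ℚ[t][[q]]` in `ℂ[t][[q]]`. -/
noncomputable def toComplexSeries : PowerSeries (Polynomial ℚ) →+* PowerSeries (Polynomial ℂ) :=
  PowerSeries.map (Polynomial.mapRingHom (algebraMap ℚ ℂ))

theorem toComplexSeries_injective : Function.Injective toComplexSeries := by
  intro f g h
  ext i k
  have h1 := congrArg (fun s => Polynomial.coeff (PowerSeries.coeff i s) k) h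
  simpa [toComplexSeries] using h1

theorem toQT_X : toQT PowerSeries.X = q := by
  simp [toQT, q, HahnSeries.ofPowerSeries_X]

theorem toQT_C_X : toQT (PowerSeries.C Polynomial.X) = t := by
  simp [toQT, t]

theorem toQT_C_C (r : ℚ) : toQT (PowerSeries.C (Polynomial.C r)) = algebraMap ℚ QTField r :=
  RingHom.congr_fun (RingHom.ext_rat
    (toQT.comp ((PowerSeries.C (R := Polynomial ℚ)).comp Polynomial.C)) (algebraMap ℚ QTField)) r

theorem toQT_hilbPoly (ρ : Representation ℂ G V) (σ : Representation ℂ G U) :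
    toQT (hilbPoly ρ σ) = hilb ρ σ := by
  rw [toQT, hilb, RingHom.comp_apply]
  congr 1
  ext i
  simp [hilbPoly]

/-- The bigraded trace of `g` on `S(V*) ⊗ ⋀ V*`. -/
noncomputable def traceSeries (ρ : Representation ℂ G V) (g : G) : PowerSeries (Polynomial ℂ) :=
  PowerSeries.mk fun i => ∑ k ∈ Finset.range (Module.finrank ℂ V + 1),
    Polynomial.C ((symPowerRep ρ.dual i).character g * (extPowerRep ρ.dual k).character g) *
      Polynomial.X ^ k

theorem mixedDim_eq [Fintype G] [FiniteDimensional ℂ V] [FiniteDimensional ℂ U]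
    (ρ : Representation ℂ G V) (σ : Representation ℂ G U) (i k : ℕ) :
    (mixedDim ρ σ i k : ℂ) = (Fintype.card G : ℂ)⁻¹ * ∑ g, σ.character g *
      ((symPowerRep ρ.dual i).character g * (extPowerRep ρ.dual k).character g) := by
  have : Invertible (Nat.card G : ℂ) := invertibleOfNonzero (by
    rw [Nat.card_eq_fintype_card]; exact_mod_cast Fintype.card_ne_zero)
  rw [mixedDim, ← Representation.card_inv_mul_sum_char_eq_finrank, Nat.card_eq_fintype_card]
  congr 1
  refine Finset.sum_congr rfl fun g _ => ?_
  rw [Representation.char_tensor, Representation.char_tensor, Pi.mul_apply, Pi.mul_apply]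
  ring

/-- Molien's formula. Traces are complex numbers while dimensions are rational, so the identity
lives in ℂ[t][[q]]; injectivity of `toComplexSeries` brings consequences back to ℚ[t][[q]]. -/
theorem toComplexSeries_hilbPoly [Fintype G] [FiniteDimensional ℂ V] [FiniteDimensional ℂ U]
    (ρ : Representation ℂ G V) (σ : Representation ℂ G U) :
    toComplexSeries (hilbPoly ρ σ) = PowerSeries.C (Polynomial.C (Fintype.card G : ℂ)⁻¹) *
      ∑ g, PowerSeries.C (Polynomial.C (σ.character g)) * traceSeries ρ g := by
  ext1 i
  rw [PowerSeries.coeff_C_mul, map_sum]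
  simp only [PowerSeries.coeff_C_mul, toComplexSeries, PowerSeries.coeff_map, hilbPoly,
    PowerSeries.coeff_mk, traceSeries, Finset.mul_sum, map_sum]
  rw [Finset.sum_comm]
  refine Finset.sum_congr rfl fun k _ => ?_
  have h : Polynomial.mapRingHom (algebraMap ℚ ℂ) (mixedDim ρ σ i k : Polynomial ℚ) =
      Polynomial.C (mixedDim ρ σ i k : ℂ) := by simp
  rw [map_mul, h, mixedDim_eq, map_mul, map_sum, Finset.mul_sum, Finset.sum_mul]
  refine Finset.sum_congr rfl fun g _ => ?_
  simp only [map_mul, map_pow, Polynomial.coe_mapRingHom, Polynomial.map_X]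
  ring

theorem traceSeries_eq {m : ℕ} (ρ : Representation ℂ G V) (g : G)
    (hm : Module.finrank ℂ V = m)
    (b : Module.Basis (Fin m) ℂ (Module.Dual ℂ V)) (μ : Fin m → ℂ)
    (h : ∀ i, ρ.dual g (b i) = μ i • b i) :
    traceSeries ρ g = PowerSeries.C (∏ j, (1 + Polynomial.C (μ j) * Polynomial.X)) *
      PowerSeries.map Polynomial.C (∏ j, PowerSeries.mk fun l => μ j ^ l) := by
  ext1 i
  rw [PowerSeries.coeff_C_mul, traceSeries, PowerSeries.coeff_mk, PowerSeries.coeff_map,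
    ← symPowerRep_trace ρ.dual g b μ h i]
  -- The degree is at most dim V, so truncating the sum over k at dim V loses nothing.
  have hd : (∏ j : Fin m, (1 + Polynomial.C (μ j) * Polynomial.X)).natDegree < m + 1 := by
    rw [Nat.lt_succ_iff]
    refine (Polynomial.natDegree_prod_le _ _).trans ?_
    refine (Finset.sum_le_card_nsmul _ _ 1 fun j _ => ?_).trans (by simp)
    compute_degree
  conv_rhs => rw [Polynomial.as_sum_range' _ _ hd]
  rw [hm, Finset.sum_mul]
  refine Finset.sum_congr rfl fun k _ => ?_
  rw [← extPowerRep_trace ρ.dual g b μ h k, ← Polynomial.C_mul_X_pow_eq_monomial, map_mul]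
  ring

theorem exists_eigenbasis_dual [Finite G] [FiniteDimensional ℂ V] (ρ : Representation ℂ G V)
    (g : G) : ∃ (b : Module.Basis (Fin (Module.finrank ℂ V)) ℂ (Module.Dual ℂ V))
      (μ : Fin (Module.finrank ℂ V) → ℂ), ∀ i, ρ.dual g (b i) = μ i • b i := by
  have h := exists_eigenbasis (ρ.dual g) (m := orderOf g) (orderOf_pos g).ne'
    (by rw [← map_pow, pow_orderOf_eq_one, map_one])
  rwa [Subspace.dual_finrank_eq] at h

end Average

/-! ### The permutation representation and its quotient -/

theorem permRep_apply (n : ℕ) (w : Equiv.Perm (Fin n)) (y : Fin n → ℂ) (i : Fin n) :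
    permRep n w y i = y (w⁻¹ i) := rfl

theorem permRep_character (n : ℕ) (w : Equiv.Perm (Fin n)) :
    (permRep n).character w = ((Finset.univ.filter fun i => w i = i).card : ℂ) := by
  rw [Representation.character, LinearMap.trace_eq_matrix_trace ℂ (Pi.basisFun ℂ (Fin n)),
    Matrix.trace, Finset.card_filter, Nat.cast_sum]
  refine Finset.sum_congr rfl fun i _ => ?_
  rw [Matrix.diag_apply, LinearMap.toMatrix_apply]
  simp only [Pi.basisFun_apply, Pi.basisFun_repr]
  rw [permRep_apply, Pi.single_apply]
  have : w⁻¹ i = i ↔ w i = i := by rw [Equiv.Perm.inv_eq_iff_eq, eq_comm]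
  simp only [this]
  split_ifs <;> simp

/-- The l-th power sum of the eigenvalues is the trace of w^l on the dual, that is the number of
fixed points of w^{-l}, which are those of w^l. -/
theorem permRep_dual_power_sums (n : ℕ) (w : Equiv.Perm (Fin n)) {m : ℕ}
    (b : Module.Basis (Fin m) ℂ (Module.Dual ℂ (Fin n → ℂ))) (μ : Fin m → ℂ)
    (h : ∀ i, (permRep n).dual w (b i) = μ i • b i) (l : ℕ) :
    ∑ j, μ j ^ l = ((Finset.univ.filter fun i => (w ^ l) i = i).card : ℂ) := by
  have h1 : ∀ i, (permRep n).dual (w ^ l) (b i) = (μ i ^ l) • b i := by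
    intro i
    induction l with
    | zero => rw [pow_zero, map_one, pow_zero, one_smul]; rfl
    | succ l ih =>
      rw [pow_succ', map_mul, Module.End.mul_apply, ih, map_smul, h, smul_smul, pow_succ]
  have h2 := trace_of_eigenbasis b _ _ h1
  rw [← h2]
  change (permRep n).dual.character (w ^ l) = _
  rw [Representation.char_dual, permRep_character]
  congr 2
  ext i
  simp only [Finset.mem_filter, Finset.mem_univ, true_and]
  rw [Equiv.Perm.inv_eq_iff_eq, eq_comm]

theorem finrank_weyl {n : ℕ} (hn : 1 ≤ n) :
    Module.finrank ℂ ((Fin n → ℂ) ⧸ sumLine n) = n - 1 := by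
  have h1 := Submodule.finrank_quotient_add_finrank (sumLine n)
  have h2 : Module.finrank ℂ (sumLine n) = 1 := by
    refine finrank_span_singleton fun h => ?_
    exact one_ne_zero (congrFun h ⟨0, hn⟩)
  rw [h2, Module.finrank_fin_fun] at h1
  omega

/-- The eigenvalues of a permutation on `ℂ^n` are those on the quotient and `1`. -/
theorem exists_eigenbasis_perm {n : ℕ} (hn : 1 ≤ n) (w : Equiv.Perm (Fin n)) {m : ℕ}
    (hm : m + 1 = n)
    (b : Module.Basis (Fin m) ℂ (Module.Dual ℂ ((Fin n → ℂ) ⧸ sumLine n))) (μ : Fin m → ℂ)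
    (h : ∀ i, (weylARep n).dual w (b i) = μ i • b i) :
    ∃ b' : Module.Basis (Fin (m + 1)) ℂ (Module.Dual ℂ (Fin n → ℂ)),
      ∀ i, (permRep n).dual w (b' i) = (Fin.cons 1 μ : Fin (m + 1) → ℂ) i • b' i := by
  set s : Module.Dual ℂ (Fin n → ℂ) := ∑ i, LinearMap.proj i with hs
  set D := (sumLine n).mkQ.dualMap with hD
  have hDinj : Function.Injective D :=
    LinearMap.dualMap_injective_of_surjective (Submodule.mkQ_surjective _)
  have hli : LinearIndependent ℂ (Fin.cons s (D ∘ b) : Fin (m + 1) → _) := by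
    rw [linearIndependent_finCons]
    -- Functionals pulled back from V vanish on (1, ..., 1), while the sum of the coordinates takes
    -- the value n ≠ 0 there. This sum is the additional eigenvector, of eigenvalue 1.
    refine ⟨b.linearIndependent.map' D (LinearMap.ker_eq_bot.2 hDinj), fun hmem => ?_⟩
    have h1 : ∀ φ ∈ Submodule.span ℂ (Set.range (D ∘ b)), φ (fun _ => 1) = 0 := by
      intro φ hφ
      induction hφ using Submodule.span_induction with
      | mem x hx =>
        obtain ⟨i, rfl⟩ := hx
        have : (sumLine n).mkQ (fun _ => (1 : ℂ)) = 0 :=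
          (Submodule.Quotient.mk_eq_zero _).2 (Submodule.mem_span_singleton_self _)
        change b i ((sumLine n).mkQ fun _ => 1) = 0
        rw [this, map_zero]
      | zero => rfl
      | add x y _ _ hx hy => rw [LinearMap.add_apply, hx, hy, add_zero]
      | smul a x _ hx => rw [LinearMap.smul_apply, hx, smul_zero]
    have h2 := h1 s hmem
    rw [hs, LinearMap.sum_apply] at h2
    simp at h2
    omega
  refine ⟨basisOfLinearIndependentOfCardEqFinrank hli (by
    rw [Subspace.dual_finrank_eq, Module.finrank_fin_fun, Fintype.card_fin, hm]), fun i => ?_⟩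
  rw [coe_basisOfLinearIndependentOfCardEqFinrank]
  refine Fin.cases ?_ (fun j => ?_) i
  · rw [Fin.cons_zero, Fin.cons_zero, one_smul]
    ext y
    simp only [hs, Representation.dual_apply, LinearMap.comp_apply]
    change (∑ i, LinearMap.proj i : Module.Dual ℂ (Fin n → ℂ)) (permRep n w⁻¹ _) = _
    rw [LinearMap.sum_apply, LinearMap.sum_apply]
    simp only [LinearMap.proj_apply, permRep_apply, inv_inv]
    exact Equiv.sum_comp w (fun i => _)
  · rw [Fin.cons_succ, Fin.cons_succ, Function.comp_apply, ← map_smul, ← h]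
    rfl

/-- The series `(1 - X ^ l)⁻¹`. -/
noncomputable def geomSeries (R : Type*) [CommRing R] (l : ℕ) : PowerSeries R :=
  PowerSeries.invOfUnit (1 - PowerSeries.X ^ l) 1

theorem one_sub_pow_mul_geomSeries {R : Type*} [CommRing R] {l : ℕ} (hl : 0 < l) :
    (1 - PowerSeries.X ^ l) * geomSeries R l = 1 :=
  PowerSeries.mul_invOfUnit _ _ (by simp [hl.ne'])

theorem cycleProd_map {R S α : Type*} [CommRing R] [CommRing S] [Fintype α] [DecidableEq α]
    (f : R →+* S) (p : ℕ → R) (w : Equiv.Perm α) :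
    f (cycleProd p w) = cycleProd (fun l => f (p l)) w := by
  rw [cycleProd, map_multiset_prod, Multiset.map_map]
  rfl

theorem cycleProd_congr {R α : Type*} [CommRing R] [Fintype α] [DecidableEq α]
    {p p' : ℕ → R} (w : Equiv.Perm α) (h : ∀ l, 0 < l → p l = p' l) :
    cycleProd p w = cycleProd p' w := by
  rw [cycleProd_eq_prod_orbits, cycleProd_eq_prod_orbits]
  exact Finset.prod_congr rfl fun o _ => h _ (orbitSize_pos w o)

theorem cycleProd_mul {R α : Type*} [CommRing R] [Fintype α] [DecidableEq α]
    (p p' : ℕ → R) (w : Equiv.Perm α) :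
    cycleProd (fun l => p l * p' l) w = cycleProd p w * cycleProd p' w := by
  rw [cycleProd, Multiset.prod_map_mul]
  rfl

/-- The reciprocal characteristic polynomial at -X. The identity of power series is first read as
one of polynomials, where the substitution is allowed. -/
theorem prod_one_add_eigenvalues {n m : ℕ} (w : Equiv.Perm (Fin n)) (μ : Fin m → ℂ)
    (h : ∀ l : ℕ, ∑ j, μ j ^ l = ((Finset.univ.filter fun i => (w ^ l) i = i).card : ℂ)) :
    ∏ j, (1 + Polynomial.C (μ j) * Polynomial.X) =
      cycleProd (fun l => (1 - (-Polynomial.X) ^ l : Polynomial ℂ)) w := by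
  have h1 := prod_one_sub_eigenvalues w μ h
  have h2 : ∏ j, (1 - Polynomial.C (μ j) * Polynomial.X) =
      cycleProd (fun l => (1 - Polynomial.X ^ l : Polynomial ℂ)) w := by
    apply Polynomial.coe_injective
    have := cycleProd_map (Polynomial.coeToPowerSeries.ringHom (R := ℂ))
      (fun l => (1 - Polynomial.X ^ l : Polynomial ℂ)) w
    simp only [Polynomial.coeToPowerSeries.ringHom_apply] at this
    rw [this, ← Polynomial.coeToPowerSeries.ringHom_apply, map_prod]
    simpa using h1
  have h4 := congrArg (Polynomial.compRingHom (-Polynomial.X)) h2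
  rw [cycleProd_map, map_prod] at h4
  simpa using h4

/-- The bigraded trace of a permutation, with rational coefficients. -/
noncomputable def permSeries {n : ℕ} (w : Equiv.Perm (Fin n)) : PowerSeries (Polynomial ℚ) :=
  cycleProd (fun l => (1 - PowerSeries.C (-Polynomial.X) ^ l) * geomSeries (Polynomial ℚ) l) w

/-- Both sides become the exterior factor after multiplication by the product of 1 - q^l over the
cycles, which the symmetric factor inverts. -/
theorem toComplexSeries_permSeries {n : ℕ} (w : Equiv.Perm (Fin n)) {m : ℕ}
    (b : Module.Basis (Fin m) ℂ (Module.Dual ℂ (Fin n → ℂ))) (μ : Fin m → ℂ)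
    (h : ∀ i, (permRep n).dual w (b i) = μ i • b i) :
    toComplexSeries (permSeries w) =
      PowerSeries.C (∏ j, (1 + Polynomial.C (μ j) * Polynomial.X)) *
        PowerSeries.map Polynomial.C (∏ j, PowerSeries.mk fun l => μ j ^ l) := by
  have h1 := prod_one_sub_eigenvalues w μ (permRep_dual_power_sums n w b μ h)
  have h3 := prod_one_add_eigenvalues w μ (permRep_dual_power_sums n w b μ h)
  have h5 : (∏ j, PowerSeries.mk fun l => μ j ^ l) *
      cycleProd (fun l => (1 - PowerSeries.X ^ l : PowerSeries ℂ)) w = 1 := by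
    rw [← h1, ← Finset.prod_mul_distrib]
    refine Finset.prod_eq_one fun j _ => ?_
    refine (((IsPowerSumExp.geom (μ j)).mul (IsPowerSumExp.linear (μ j))).unique
      IsPowerSumExp.zero_one fun l => ?_)
    simp
  have h6 := congrArg (PowerSeries.map (Polynomial.C (R := ℂ))) h5
  rw [map_mul, cycleProd_map, map_one] at h6
  have h7 : toComplexSeries (permSeries w) *
      cycleProd (fun l => (1 - PowerSeries.X ^ l : PowerSeries (Polynomial ℂ))) w =
        PowerSeries.C (∏ j, (1 + Polynomial.C (μ j) * Polynomial.X)) := by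
    rw [permSeries, cycleProd_map, ← cycleProd_mul, h3, cycleProd_map]
    refine cycleProd_congr w fun l hl => ?_
    have h8 := congrArg toComplexSeries (one_sub_pow_mul_geomSeries (R := Polynomial ℚ) hl)
    have h9 : toComplexSeries (1 - PowerSeries.X ^ l) = 1 - PowerSeries.X ^ l := by
      simp [toComplexSeries]
    rw [map_mul, map_one, h9] at h8
    rw [map_mul, mul_assoc, mul_comm _ (1 - PowerSeries.X ^ l), h8, mul_one]
    simp [toComplexSeries]
  simp only [map_sub, map_one, map_pow, PowerSeries.map_X] at h6
  rw [← h7, mul_assoc, mul_comm (cycleProd _ _), h6, mul_one]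

/-- The additional eigenvalue 1 on ℂ^n contributes 1 + t to the exterior trace and 1/(1 - q) to the
symmetric one, for every w. -/
theorem traceSeries_perm {n : ℕ} (hn : 1 ≤ n) (w : Equiv.Perm (Fin n)) :
    traceSeries (permRep n) w = toComplexSeries (permSeries w) ∧
      PowerSeries.C (1 + Polynomial.X) * traceSeries (weylARep n) w =
        (1 - PowerSeries.X) * traceSeries (permRep n) w := by
  obtain ⟨b, μ, h⟩ := exists_eigenbasis_dual (weylARep n) w
  have hm := finrank_weyl hn
  obtain ⟨b', h'⟩ := exists_eigenbasis_perm hn w (by omega) b μ h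
  have e := traceSeries_eq (permRep n) w (by rw [Module.finrank_fin_fun]; omega) b' _ h'
  refine ⟨by rw [e, toComplexSeries_permSeries w b' _ h'], ?_⟩
  rw [e, traceSeries_eq (weylARep n) w rfl b μ h, Fin.prod_univ_succ, Fin.prod_univ_succ]
  simp only [Fin.cons_zero, Fin.cons_succ, map_one, one_mul, map_mul, one_pow]
  have h1 : (1 - PowerSeries.X) * PowerSeries.map (Polynomial.C (R := ℂ))
      (PowerSeries.mk fun _ => 1) = 1 := by
    rw [mul_comm]
    have : PowerSeries.map (Polynomial.C (R := ℂ)) (PowerSeries.mk fun _ => 1) =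
        PowerSeries.mk 1 := by ext; simp
    rw [this, PowerSeries.mk_one_mul_one_sub_eq_one]
  linear_combination (-PowerSeries.C (1 + Polynomial.X) * PowerSeries.C (∏ j, (1 + Polynomial.C (μ j) * Polynomial.X)) *
    PowerSeries.map (Polynomial.C (R := ℂ)) (∏ j, PowerSeries.mk fun l => μ j ^ l)) * h1

/-! ### Nonvanishing in `ℚ(t)((q))` -/

theorem toQT_injective : Function.Injective toQT := by
  intro f g h
  have h1 : PowerSeries.map (algebraMap (Polynomial ℚ) (RatFunc ℚ)) f =
      PowerSeries.map (algebraMap (Polynomial ℚ) (RatFunc ℚ)) g :=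
    HahnSeries.ofPowerSeries_injective h
  ext1 i
  have := congrArg (PowerSeries.coeff i) h1
  simp only [PowerSeries.coeff_map] at this
  exact RatFunc.algebraMap_injective ℚ this

theorem q_ne_zero : q ≠ 0 := by
  rw [← toQT_X, Ne, map_eq_zero_iff _ toQT_injective]
  exact PowerSeries.X_ne_zero

theorem one_sub_q_pow_ne_zero {l : ℕ} (hl : 0 < l) : 1 - q ^ l ≠ 0 := by
  have h := congrArg toQT (one_sub_pow_mul_geomSeries (R := Polynomial ℚ) hl)
  rw [map_mul, map_sub, map_one, map_pow, toQT_X] at h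
  exact left_ne_zero_of_mul_eq_one h

theorem one_add_t_mul_q_pow_ne_zero (l : ℕ) : 1 + t * q ^ l ≠ 0 := by
  have h : 1 + t * q ^ l = toQT (1 + PowerSeries.C Polynomial.X * PowerSeries.X ^ l) := by
    rw [map_add, map_one, map_mul, map_pow, toQT_X, toQT_C_X]
  rw [h, Ne, map_eq_zero_iff _ toQT_injective]
  intro h0
  have h1 := congrArg (fun s => Polynomial.eval 0 (PowerSeries.coeff 0 s)) h0
  rw [map_add, PowerSeries.coeff_C_mul, PowerSeries.coeff_X_pow, Polynomial.eval_add,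
    Polynomial.eval_mul, Polynomial.eval_X] at h1
  simp at h1

theorem q_pow_add_t_ne_zero (l : ℕ) : q ^ l + t ≠ 0 := by
  have h : q ^ l + t = toQT (PowerSeries.X ^ l + PowerSeries.C Polynomial.X) := by
    rw [map_add, map_pow, toQT_X, toQT_C_X]
  rw [h, Ne, map_eq_zero_iff _ toQT_injective]
  intro h0
  have h1 := congrArg (fun s => Polynomial.coeff (PowerSeries.coeff 0 s) 1) h0
  rw [map_add, Polynomial.coeff_add, PowerSeries.coeff_zero_C, PowerSeries.coeff_X_pow] at h1
  split_ifs at h1 <;> simp [Polynomial.coeff_one] at h1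

/-- Contents can be negative. For a negative exponent, multiplication by a power of q reduces the
claim to q^l + t ≠ 0. -/
theorem one_add_t_mul_q_zpow_ne_zero (k : ℤ) : 1 + t * q ^ k ≠ 0 := by
  cases k with
  | ofNat l => exact_mod_cast one_add_t_mul_q_pow_ne_zero l
  | negSucc l =>
    have h := q_pow_add_t_ne_zero (l + 1)
    rw [zpow_negSucc]
    intro h0
    apply h
    have h1 : q ^ (l + 1) * (1 + t * (q ^ (l + 1))⁻¹) = q ^ (l + 1) + t := by
      rw [mul_add, mul_one, mul_left_comm, mul_inv_cancel₀ (pow_ne_zero (l + 1) q_ne_zero),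
        mul_one]
    rw [← h1, h0, mul_zero]

theorem one_add_t_ne_zero : 1 + t ≠ 0 := by
  simpa using one_add_t_mul_q_pow_ne_zero 0

theorem toQT_permSeries {n : ℕ} (w : Equiv.Perm (Fin n)) :
    toQT (permSeries w) = cycleProd (fun l => (1 - (-t) ^ l) / (1 - q ^ l)) w := by
  rw [permSeries, cycleProd_map]
  refine cycleProd_congr w fun l hl => ?_
  have h := congrArg toQT (one_sub_pow_mul_geomSeries (R := Polynomial ℚ) hl)
  rw [map_mul, map_sub, map_one, map_pow, toQT_X] at h
  rw [map_mul, map_sub, map_one, map_pow, map_neg, map_neg, toQT_C_X,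
    eq_div_iff (one_sub_q_pow_ne_zero hl), mul_assoc, mul_comm (toQT _), h, mul_one]

/-! ### Multiplicity series for ℂ^n and V as averages over 𝔖_n -/

section Multiplicities

variable {n : ℕ} {U : Type*} [AddCommGroup U] [Module ℂ U] [FiniteDimensional ℂ U]
  (σ : Representation ℂ (Equiv.Perm (Fin n)) U)

/-- The ratio of the two traces does not depend on w, hence it factors out of the average whatever
the coefficient module is. -/
theorem hilb_weyl (hn : 1 ≤ n) :
    hilb (weylARep n) σ = (1 - q) / (1 + t) * hilb (permRep n) σ := by
  have h : PowerSeries.C (1 + Polynomial.X) * hilbPoly (weylARep n) σ =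
      (1 - PowerSeries.X) * hilbPoly (permRep n) σ := by
    apply toComplexSeries_injective
    have h1 : toComplexSeries (PowerSeries.C (1 + Polynomial.X)) =
        PowerSeries.C (1 + Polynomial.X) := by simp [toComplexSeries]
    have h2 : toComplexSeries (1 - PowerSeries.X) = 1 - PowerSeries.X := by simp [toComplexSeries]
    have h3 : ∀ w : Equiv.Perm (Fin n), PowerSeries.C (1 + Polynomial.X) *
        (PowerSeries.C (Polynomial.C (σ.character w)) * traceSeries (weylARep n) w) =
        (1 - PowerSeries.X) *
          (PowerSeries.C (Polynomial.C (σ.character w)) * traceSeries (permRep n) w) := by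
      intro w
      rw [mul_left_comm, (traceSeries_perm hn w).2, mul_left_comm]
    rw [map_mul, map_mul, h1, h2, toComplexSeries_hilbPoly, toComplexSeries_hilbPoly,
      mul_left_comm, Finset.mul_sum, Finset.sum_congr rfl fun w _ => h3 w, ← Finset.mul_sum,
      mul_left_comm]
  have h3 := congrArg toQT h
  rw [map_mul, map_mul, toQT_hilbPoly, toQT_hilbPoly, map_sub, map_one, toQT_X, map_add, map_one,
    map_add, map_one, toQT_C_X] at h3
  rw [div_mul_eq_mul_div, eq_div_iff one_add_t_ne_zero, mul_comm, h3]

theorem hilb_perm (hn : 1 ≤ n) (X : Equiv.Perm (Fin n) → ℚ) (hX : ∀ w, σ.character w = X w) :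
    hilb (permRep n) σ = algebraMap ℚ QTField (n.factorial : ℚ)⁻¹ * ∑ w, algebraMap ℚ QTField (X w) *
      cycleProd (fun l => (1 - (-t) ^ l) / (1 - q ^ l)) w := by
  have h : hilbPoly (permRep n) σ = PowerSeries.C (Polynomial.C (n.factorial : ℚ)⁻¹) *
      ∑ w, PowerSeries.C (Polynomial.C (X w)) * permSeries w := by
    apply toComplexSeries_injective
    have hc : ∀ r : ℚ, toComplexSeries (PowerSeries.C (Polynomial.C r)) =
        PowerSeries.C (Polynomial.C (r : ℂ)) := by
      intro r; simp [toComplexSeries]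
    rw [toComplexSeries_hilbPoly, map_mul, hc, map_sum, Fintype.card_perm, Fintype.card_fin]
    push_cast
    congr 1
    refine Finset.sum_congr rfl fun w _ => ?_
    rw [map_mul, hc, hX, (traceSeries_perm hn w).1]
  rw [← toQT_hilbPoly, h, map_mul, toQT_C_C, map_sum]
  congr 1
  refine Finset.sum_congr rfl fun w _ => ?_
  rw [map_mul, toQT_C_C, toQT_permSeries]

end Multiplicities

/-! ### Frobenius characters and the Jacobi-Trudi determinant -/

section Frobenius

variable {N : ℕ}

/-- The exponents `N - 1, ..., 1, 0`. -/
def stair (N : ℕ) (i : Fin N) : ℕ := N - 1 - i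

/-- The alternant `det (x_j ^ α_i)`. -/
noncomputable def alternant (R : Type*) [CommRing R] (α : Fin N → ℕ) : MvPolynomial (Fin N) R :=
  (Matrix.of fun i j => MvPolynomial.X j ^ α i).det

/-- A family of exponents as a finitely supported function. -/
noncomputable def expo (α : Fin N → ℕ) : Fin N →₀ ℕ := Finsupp.equivFunOnFinite.symm α

@[simp]
theorem expo_apply (α : Fin N → ℕ) (i : Fin N) : expo α i = α i := rfl

theorem prod_X_pow_eq_monomial (R : Type*) [CommRing R] (α : Fin N → ℕ) :
    ∏ i, (MvPolynomial.X i : MvPolynomial (Fin N) R) ^ α i = MvPolynomial.monomial (expo α) 1 := by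
  rw [MvPolynomial.monomial_eq, Finsupp.prod_fintype _ _ (by simp), map_one, one_mul]
  rfl

theorem alternant_eq_sum (R : Type*) [CommRing R] (α : Fin N → ℕ) :
    alternant R α = ∑ π : Equiv.Perm (Fin N),
      MvPolynomial.monomial (expo fun i => α (π i)) ((Equiv.Perm.sign π : ℤ) : R) := by
  rw [alternant, Matrix.det_apply']
  refine Finset.sum_congr rfl fun π _ => ?_
  simp only [Matrix.of_apply]
  rw [prod_X_pow_eq_monomial, ← mul_one (((Equiv.Perm.sign π : ℤ) : R)),
    ← MvPolynomial.C_mul_monomial]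
  simp

theorem coeff_alternant_mul {R : Type*} [CommRing R] (α δ : Fin N → ℕ)
    (F : MvPolynomial (Fin N) R) :
    MvPolynomial.coeff (expo α) (alternant R δ * F) =
      ∑ π : Equiv.Perm (Fin N), ((Equiv.Perm.sign π : ℤ) : R) *
        if (∀ i, δ (π i) ≤ α i) then MvPolynomial.coeff (expo fun i => α i - δ (π i)) F
        else 0 := by
  rw [alternant_eq_sum, Finset.sum_mul, MvPolynomial.coeff_sum]
  refine Finset.sum_congr rfl fun π _ => ?_
  rw [MvPolynomial.coeff_monomial_mul', mul_ite, mul_zero]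
  have h1 : (expo fun i => δ (π i)) ≤ expo α ↔ ∀ i, δ (π i) ≤ α i := Iff.rfl
  have h2 : expo α - (expo fun i => δ (π i)) = expo fun i => α i - δ (π i) := by
    ext i; rfl
  simp only [h1, h2]

/-- The coefficient of `z ^ (a - d)`, zero if `a < d`. -/
noncomputable def shiftCoeff {R : Type*} [CommRing R] (H : PowerSeries R) (a d : ℕ) : R :=
  if d ≤ a then PowerSeries.coeff (a - d) H else 0

/-- The i-th factor is H(x_i z) = Σ h_b x_i^b z^b, so x^β occurs exactly once in the product, with
z-degree |β|. -/
theorem coeff_coeff_prod_rescale {R : Type*} [CommRing R] (H : PowerSeries R) (n : ℕ)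
    (β : Fin N → ℕ) :
    MvPolynomial.coeff (expo β) (PowerSeries.coeff n (∏ i : Fin N,
      PowerSeries.rescale (MvPolynomial.X i) (PowerSeries.map (MvPolynomial.C (σ := Fin N)) H))) =
      if ∑ i, β i = n then ∏ i, PowerSeries.coeff (β i) H else 0 := by
  classical
  rw [PowerSeries.coeff_prod, MvPolynomial.coeff_sum]
  have h1 : ∀ d ∈ Finset.finsuppAntidiag (Finset.univ : Finset (Fin N)) n,
      MvPolynomial.coeff (expo β) (∏ i : Fin N, PowerSeries.coeff (d i)
        (PowerSeries.rescale (MvPolynomial.X i) (PowerSeries.map (MvPolynomial.C (σ := Fin N)) H))) =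
      if expo β = d then ∏ i, PowerSeries.coeff (β i) H else 0 := by
    intro d _
    simp only [PowerSeries.coeff_rescale, PowerSeries.coeff_map]
    rw [Finset.prod_mul_distrib, prod_X_pow_eq_monomial, ← map_prod, mul_comm,
      MvPolynomial.coeff_C_mul, MvPolynomial.coeff_monomial]
    have : expo (fun i => d i) = d := by ext; rfl
    rw [this]
    by_cases h : expo β = d
    · rw [if_pos h.symm, if_pos h, mul_one, ← h]; rfl
    · rw [if_neg (Ne.symm h), if_neg h, mul_zero]
  rw [Finset.sum_congr rfl h1, Finset.sum_ite_eq]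
  congr 1
  rw [Finset.mem_finsuppAntidiag, and_iff_left (Finset.subset_univ _)]
  rfl

/-- The Jacobi-Trudi determinant as a coefficient. -/
theorem coeff_alternant_mul_coeff {R : Type*} [CommRing R] (H : PowerSeries R) {n : ℕ}
    (α δ : Fin N → ℕ) (h : ∑ i, α i = n + ∑ i, δ i) :
    MvPolynomial.coeff (expo α) (alternant R δ * PowerSeries.coeff n (∏ i : Fin N,
      PowerSeries.rescale (MvPolynomial.X i) (PowerSeries.map (MvPolynomial.C (σ := Fin N)) H))) =
      (Matrix.of fun i j => shiftCoeff H (α i) (δ j)).det := by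
  rw [coeff_alternant_mul, ← Matrix.det_transpose, Matrix.det_apply']
  refine Finset.sum_congr rfl fun π _ => ?_
  congr 1
  simp only [Matrix.transpose_apply, Matrix.of_apply, shiftCoeff]
  split_ifs with h1
  · rw [coeff_coeff_prod_rescale, if_pos]
    · exact Finset.prod_congr rfl fun i _ => by rw [if_pos (h1 i)]
    -- The total degree is n for every π. When some difference α_i - δ_{π(i)} is negative, the
    -- default 0 of `shiftCoeff` kills the same term of the determinant.
    · have e : ∑ i, (α i - δ (π i)) + ∑ i, δ (π i) = ∑ i, α i := by
        rw [← Finset.sum_add_distrib]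
        exact Finset.sum_congr rfl fun i _ => Nat.sub_add_cancel (h1 i)
      rw [Equiv.sum_comp π δ] at e
      omega
  · obtain ⟨i, hi⟩ := not_forall.1 h1
    exact (Finset.prod_eq_zero (Finset.mem_univ i) (if_neg hi)).symm

/-- The class function of the symmetric group with `α = λ + δ` given by Frobenius' formula. -/
noncomputable def frobChar {n : ℕ} (α : Fin N → ℕ) (w : Equiv.Perm (Fin n)) : ℚ :=
  MvPolynomial.coeff (expo α)
    (alternant ℚ (stair N) * cycleProd (fun l => ∑ i, MvPolynomial.X i ^ l) w)

theorem map_frobChar {R : Type*} [CommRing R] [Algebra ℚ R] {n : ℕ} (α : Fin N → ℕ)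
    (w : Equiv.Perm (Fin n)) :
    algebraMap ℚ R (frobChar α w) = MvPolynomial.coeff (expo α)
      (alternant R (stair N) * cycleProd (fun l => ∑ i, MvPolynomial.X i ^ l) w) := by
  rw [frobChar, ← MvPolynomial.coeff_map, map_mul, cycleProd_map, alternant, RingHom.map_det]
  congr 2
  · rw [alternant]
    congr 1
    ext i j
    simp
  · congr 1
    funext l
    simp

/-- The Cauchy kernel Π_i H(x_i z): its power sums are the products of p_l with the power sums of
the variables. -/
theorem isPowerSumExp_prod_rescale {R : Type*} [CommRing R] {p : ℕ → R} {H : PowerSeries R}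
    (hH : IsPowerSumExp p H) : IsPowerSumExp
      (fun l => MvPolynomial.C (p l) * ∑ i : Fin N, (MvPolynomial.X i : MvPolynomial (Fin N) R) ^ l)
      (∏ i : Fin N, PowerSeries.rescale (MvPolynomial.X i)
        (PowerSeries.map (MvPolynomial.C (σ := Fin N)) H)) := by
  refine (IsPowerSumExp.prod Finset.univ fun i _ =>
    (hH.map (MvPolynomial.C (σ := Fin N))).rescale (MvPolynomial.X i)).congr_left fun l => ?_
  rw [Finset.sum_apply, Finset.mul_sum]

/-- By the cycle index, the coefficient of z^n in the Cauchy kernel is the average of p_w p_w(x).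
Multiplying by the alternant a_δ and extracting x^α yields the averaged Frobenius character on one
side and the Jacobi-Trudi determinant on the other. -/
theorem average_frobChar_mul_cycleProd {R : Type*} [CommRing R] [Algebra ℚ R] {p : ℕ → R}
    {H : PowerSeries R} (hH : IsPowerSumExp p H) {n : ℕ} (α : Fin N → ℕ)
    (h : ∑ i, α i = n + ∑ i, stair N i) :
    algebraMap ℚ R (n.factorial : ℚ)⁻¹ *
      ∑ w : Equiv.Perm (Fin n), algebraMap ℚ R (frobChar α w) * cycleProd p w =
      (Matrix.of fun i j => shiftCoeff H (α i) (stair N j)).det := by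
  rw [← coeff_alternant_mul_coeff H α (stair N) h]
  have h1 := (isPowerSumExp_prod_rescale (N := N) hH).unique
    (isPowerSumExp_cycleIndex fun l => MvPolynomial.C (p l) *
      ∑ i : Fin N, (MvPolynomial.X i : MvPolynomial (Fin N) R) ^ l) fun l => rfl
  rw [h1, PowerSeries.coeff_mk, Algebra.smul_def, mul_left_comm]
  have h2 : algebraMap ℚ (MvPolynomial (Fin N) R) (n.factorial : ℚ)⁻¹ =
      MvPolynomial.C (algebraMap ℚ R (n.factorial : ℚ)⁻¹) := by
    rw [← MvPolynomial.algebraMap_eq, ← IsScalarTower.algebraMap_apply]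
  rw [h2, MvPolynomial.coeff_C_mul]
  congr 1
  rw [Finset.mul_sum, MvPolynomial.coeff_sum]
  refine Finset.sum_congr rfl fun w _ => ?_
  rw [cycleProd_mul, ← cycleProd_map MvPolynomial.C p w, mul_left_comm, MvPolynomial.coeff_C_mul,
    ← map_frobChar, mul_comm]

/-- The bialternant formula: the Jacobi-Trudi determinant of the complete symmetric polynomials. -/
theorem alternant_mul_det (α : Fin N → ℕ) :
    alternant ℚ (stair N) * (Matrix.of fun i j => shiftCoeff
      (∏ k : Fin N, PowerSeries.mk fun l => (MvPolynomial.X k : MvPolynomial (Fin N) ℚ) ^ l)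
      (α i) (stair N j)).det = alternant ℚ α := by
  set R := MvPolynomial (Fin N) ℚ
  set H : PowerSeries R := ∏ k : Fin N, PowerSeries.mk fun l => (MvPolynomial.X k : R) ^ l with hH
  -- E j is the signed generating polynomial of the elementary symmetric functions in the variables
  -- other than x_j. All factors of H but the j-th cancel against it, leaving 1/(1 - x_j z).
  set E : Fin N → Polynomial R := fun j =>
    ∏ k ∈ Finset.univ.erase j, (1 - Polynomial.C (MvPolynomial.X k) * Polynomial.X) with hE
  set M : Matrix (Fin N) (Fin N) R := Matrix.of fun k j => (E j).coeff (stair N k) with hM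
  have hHE : ∀ j, H * (E j : PowerSeries R) = PowerSeries.mk fun l => (MvPolynomial.X j : R) ^ l := by
    intro j
    have e1 : (E j : PowerSeries R) = ∏ k ∈ Finset.univ.erase j,
        (1 - PowerSeries.C (MvPolynomial.X k) * PowerSeries.X) := by
      rw [hE, ← Polynomial.coeToPowerSeries.ringHom_apply, map_prod]
      simp
    rw [e1, hH, ← Finset.mul_prod_erase _ _ (Finset.mem_univ j), mul_assoc,
      ← Finset.prod_mul_distrib, Finset.prod_eq_one, mul_one]
    intro k _
    refine (((IsPowerSumExp.geom _).mul (IsPowerSumExp.linear _)).unique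
      IsPowerSumExp.zero_one fun l => ?_)
    simp
  have hdeg : ∀ j, (E j).natDegree < N := by
    intro j
    have hN : 0 < N := j.pos
    refine lt_of_le_of_lt (Polynomial.natDegree_prod_le _ _) ?_
    refine lt_of_le_of_lt (Finset.sum_le_card_nsmul _ _ 1 fun k _ => ?_) ?_
    · compute_degree
    · simp
      omega
  have hmul : ∀ α : Fin N → ℕ, (Matrix.of fun i j => shiftCoeff H (α i) (stair N j)) * M =
      Matrix.of fun i j => (MvPolynomial.X j : R) ^ α i := by
    intro α
    ext1 i j
    rw [Matrix.mul_apply, Matrix.of_apply]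
    have h1 := congrArg (PowerSeries.coeff (α i)) (hHE j)
    rw [PowerSeries.coeff_mk, mul_comm, PowerSeries.coeff_mul] at h1
    rw [← h1, Finset.Nat.sum_antidiagonal_eq_sum_range_succ_mk]
    have h2 : ∀ k : Fin N, (Matrix.of fun i j => shiftCoeff H (α i) (stair N j)) i k * M k j =
        shiftCoeff H (α i) (stair N k) * (E j).coeff (stair N k) := fun k => rfl
    simp only [h2]
    -- The staircase runs through 0, ..., N-1 in reverse, and E j has degree below N, so the matrix
    -- product is the full convolution.
    have h3 : ∑ k : Fin N, shiftCoeff H (α i) (stair N k) * (E j).coeff (stair N k) =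
        ∑ m ∈ Finset.range N, shiftCoeff H (α i) m * (E j).coeff m := by
      rw [← Finset.sum_range_reflect, Finset.sum_range]
      rfl
    rw [h3]
    have h4 : ∀ m, shiftCoeff H (α i) m * (E j).coeff m =
        if m ∈ Finset.range (α i).succ then (E j).coeff m * PowerSeries.coeff (α i - m) H
        else 0 := by
      intro m
      rw [shiftCoeff]
      by_cases hm : m ≤ α i
      · rw [if_pos hm, if_pos (by simpa [Nat.lt_succ_iff] using hm), mul_comm]
      · rw [if_neg hm, if_neg (by simpa [Nat.lt_succ_iff] using hm), zero_mul]
    simp only [Polynomial.coeff_coe]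
    rw [Finset.sum_congr rfl fun m _ => h4 m, Finset.sum_ite_mem, ← Finset.sum_subset
      (Finset.inter_subset_right (s₁ := Finset.range N) (s₂ := Finset.range (α i).succ))]
    intro m hm hm'
    rw [Polynomial.coeff_eq_zero_of_natDegree_lt, zero_mul]
    refine lt_of_lt_of_le (hdeg j) ?_
    by_contra hlt
    exact hm' (Finset.mem_inter.2 ⟨Finset.mem_range.2 (not_le.1 hlt), hm⟩)
  -- For α = δ the Jacobi-Trudi matrix is unitriangular, since H has constant coefficient 1.
  have hdet : M.det = alternant ℚ (stair N) := by
    have h1 := congrArg Matrix.det (hmul (stair N))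
    rw [Matrix.det_mul, Matrix.det_of_isUpperTriangular, Finset.prod_eq_one, one_mul] at h1
    · exact h1
    · intro i _
      have : PowerSeries.constantCoeff H = 1 := by
        rw [hH, map_prod]
        refine Finset.prod_eq_one fun k _ => ?_
        rw [← PowerSeries.coeff_zero_eq_constantCoeff_apply, PowerSeries.coeff_mk, pow_zero]
      simp [shiftCoeff, this]
    · intro i j hij
      have hij' : (j : ℕ) < i := hij
      rw [Matrix.of_apply, shiftCoeff, if_neg]
      simp only [stair]
      omega
  have h2 := congrArg Matrix.det (hmul α)
  rw [Matrix.det_mul, hdet, mul_comm] at h2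
  exact h2

/-- With distinct exponents only the identity permutation produces the monomial x^α. -/
theorem coeff_alternant_self {α : Fin N → ℕ} (hα : Function.Injective α) :
    MvPolynomial.coeff (expo α) (alternant ℚ α) = 1 := by
  classical
  rw [alternant_eq_sum, MvPolynomial.coeff_sum, Finset.sum_eq_single 1]
  · simp [MvPolynomial.coeff_monomial]
  · intro π _ hπ
    rw [MvPolynomial.coeff_monomial, if_neg]
    intro h
    apply hπ
    ext i
    rw [Equiv.Perm.one_apply]
    exact congrArg Fin.val (hα (DFunLike.congr_fun h i))
  · simp

/-- The Frobenius characters have norm one. -/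
theorem sum_frobChar_mul_self {n : ℕ} {α : Fin N → ℕ} (hα : Function.Injective α)
    (h : ∑ i, α i = n + ∑ i, stair N i) :
    ∑ w : Equiv.Perm (Fin n), frobChar α w * frobChar α w = n.factorial := by
  -- Taking p_l to be the power sums of the variables themselves makes the average a Schur
  -- polynomial. Multiplying by a_δ and extracting x^α a second time turns p_w(x) into the Frobenius
  -- character again, while the bialternant formula makes the result 1.
  have hp : IsPowerSumExp (fun l => ∑ i : Fin N, (MvPolynomial.X i : MvPolynomial (Fin N) ℚ) ^ l)
      (∏ k : Fin N, PowerSeries.mk fun l => (MvPolynomial.X k : MvPolynomial (Fin N) ℚ) ^ l) :=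
    (IsPowerSumExp.prod (Finset.univ : Finset (Fin N))
      fun k _ => IsPowerSumExp.geom (MvPolynomial.X k)).congr_left fun l => by
        rw [Finset.sum_apply]
  have h1 := average_frobChar_mul_cycleProd hp α h
  have h2 := alternant_mul_det α
  rw [← h1, mul_left_comm, Finset.mul_sum] at h2
  have h3 := congrArg (MvPolynomial.coeff (expo α)) h2
  have h4 : ∀ w : Equiv.Perm (Fin n), MvPolynomial.coeff (expo α) (alternant ℚ (stair N) *
      (algebraMap ℚ (MvPolynomial (Fin N) ℚ) (frobChar α w) *
        cycleProd (fun l => ∑ i, MvPolynomial.X i ^ l) w)) =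
      frobChar α w * frobChar α w := by
    intro w
    rw [MvPolynomial.algebraMap_eq, mul_left_comm, MvPolynomial.coeff_C_mul, ← frobChar]
  rw [coeff_alternant_self hα, MvPolynomial.algebraMap_eq, MvPolynomial.coeff_C_mul,
    MvPolynomial.coeff_sum, ← MvPolynomial.algebraMap_eq,
    Finset.sum_congr rfl fun w _ => h4 w] at h3
  have h5 : (n.factorial : ℚ) ≠ 0 := by exact_mod_cast n.factorial_ne_zero
  rw [inv_mul_eq_iff_eq_mul₀ h5, mul_one] at h3
  exact h3

end Frobenius

/-! ### Tableaux -/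

section Tableau

variable {n : ℕ} {lam : YoungDiagram} (T : Fin n ≃ lam.cells)

/-- The row of an entry of a tableau. -/
def tabRow (i : Fin n) : ℕ := (T i).1.1

/-- The column of an entry of a tableau. -/
def tabCol (i : Fin n) : ℕ := (T i).1.2

theorem tab_ext {i j : Fin n} (h1 : tabRow T i = tabRow T j) (h2 : tabCol T i = tabCol T j) :
    i = j :=
  T.injective (Subtype.ext (Prod.ext h1 h2))

theorem tabRow_lt (i : Fin n) : tabRow T i < lam.colLen (tabCol T i) :=
  YoungDiagram.mem_iff_lt_colLen.1 (YoungDiagram.mem_cells _ |>.1 (T i).2)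

theorem exists_tab {r c : ℕ} (h : r < lam.colLen c) : ∃ i, tabRow T i = r ∧ tabCol T i = c := by
  have hm : (r, c) ∈ lam.cells := YoungDiagram.mem_cells _ |>.2 (YoungDiagram.mem_iff_lt_colLen.2 h)
  refine ⟨T.symm ⟨(r, c), hm⟩, ?_, ?_⟩ <;> simp [tabRow, tabCol]

/-- A filling that is injective on columns and dominates the row filling arises from it by a
permutation of the columns. -/
theorem exists_column_perm (f : Fin n → ℕ)
    (h1 : ∀ i j, tabCol T i = tabCol T j → f i = f j → i = j)
    (h2 : ∀ k, (Finset.univ.filter fun i => tabRow T i < k).card ≤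
      (Finset.univ.filter fun i => f i < k).card) :
    ∃ h : Equiv.Perm (Fin n), (∀ i, tabCol T (h i) = tabCol T i) ∧ ∀ i, tabRow T (h i) = f i := by
  classical
  -- Suppose f i₀ is at least the length k of its column, and count the entries with value below k.
  -- In columns of length at most k all rows are counted, in longer columns injectivity allows f at
  -- most k entries, which the rows attain, and the column of i₀ falls strictly short. The
  -- domination hypothesis is violated.
  have hlt : ∀ i, f i < lam.colLen (tabCol T i) := by
    by_contra hne
    obtain ⟨i₀, hi₀⟩ := not_forall.1 hne
    set k := lam.colLen (tabCol T i₀) with hk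
    refine (h2 k).not_gt ?_
    have hm : ∀ (g : Fin n → ℕ), ∀ i ∈ Finset.univ.filter (fun i => g i < k),
        tabCol T i ∈ Finset.univ.image (tabCol T) :=
      fun g i _ => Finset.mem_image_of_mem _ (Finset.mem_univ _)
    rw [Finset.card_eq_sum_card_fiberwise (hm f), Finset.card_eq_sum_card_fiberwise (hm (tabRow T))]
    refine Finset.sum_lt_sum (fun c _ => ?_)
      ⟨tabCol T i₀, Finset.mem_image_of_mem _ (Finset.mem_univ _), ?_⟩
    · by_cases hc : lam.colLen c ≤ k
      · refine Finset.card_le_card fun i hi => ?_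
        simp only [Finset.mem_filter, Finset.mem_univ, true_and] at hi ⊢
        have := tabRow_lt T i
        rw [hi.2] at this
        exact ⟨by omega, hi.2⟩
      · have e1 : ((Finset.univ.filter fun i => f i < k).filter fun i => tabCol T i = c).card ≤
            (Finset.range k).card := by
          refine Finset.card_le_card_of_injOn f ?_ ?_
          · intro i hi
            simpa using (Finset.mem_filter.1 (Finset.mem_filter.1 hi).1).2
          · intro i hi j hj hij
            exact h1 i j ((Finset.mem_filter.1 hi).2.trans (Finset.mem_filter.1 hj).2.symm) hij
        have e2 : (Finset.range k).card ≤
            ((Finset.univ.filter fun i => tabRow T i < k).filter fun i => tabCol T i = c).card := by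
          refine Finset.card_le_card_of_surjOn (tabRow T) ?_
          intro r hr
          have hr' : r < k := by simpa using hr
          obtain ⟨i, hi1, hi2⟩ := exists_tab T (r := r) (c := c) (by omega)
          refine ⟨i, ?_, hi1⟩
          simp only [Finset.coe_filter, Finset.mem_filter, Finset.mem_univ, true_and]
          exact ⟨by rw [hi1]; exact hr', hi2⟩
        exact e1.trans e2
    · refine Finset.card_lt_card ?_
      rw [Finset.ssubset_iff_of_subset]
      · refine ⟨i₀, ?_, ?_⟩
        · simpa using tabRow_lt T i₀
        · simpa using hi₀
      · intro i hi
        simp only [Finset.mem_filter, Finset.mem_univ, true_and] at hi ⊢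
        have := tabRow_lt T i
        rw [hi.2] at this
        exact ⟨this, hi.2⟩
  -- The permutation sends i to the entry in row f i of the same column.
  choose g hg1 hg2 using fun i => exists_tab T (hlt i)
  have hg : Function.Injective g := by
    intro i j hij
    refine h1 i j ?_ ?_
    · rw [← hg2 i, ← hg2 j, hij]
    · rw [← hg1 i, ← hg1 j, hij]
  exact ⟨Equiv.ofBijective g (Finite.injective_iff_bijective.1 hg), hg2, hg1⟩

end Tableau

/-! ### Young symmetrizers -/

section Symmetrizer

variable {n : ℕ}

theorem perm_apply_inv {α : Type*} (w : Equiv.Perm α) (x : α) : w (w⁻¹ x) = x := by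
  rw [← Equiv.Perm.mul_apply, mul_inv_cancel, Equiv.Perm.one_apply]

/-- A shorthand for the group algebra of the symmetric group. -/
abbrev PermAlg (n : ℕ) : Type := MonoidAlgebra ℂ (Equiv.Perm (Fin n))

/-- A permutation as an element of the group algebra. -/
noncomputable def pe (w : Equiv.Perm (Fin n)) : PermAlg n := MonoidAlgebra.single w 1

theorem pe_mul (v w : Equiv.Perm (Fin n)) : pe v * pe w = pe (v * w) := by
  rw [pe, pe, MonoidAlgebra.single_mul_single, one_mul]; rfl

theorem pe_one : pe (1 : Equiv.Perm (Fin n)) = 1 := rfl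

theorem sum_smul_pe (x : PermAlg n) : x = ∑ w, x.coeff w • pe w := by
  ext g
  rw [MonoidAlgebra.coeff_sum, Finsupp.finsetSum_apply, Finset.sum_eq_single g]
  · simp [pe]
  · intro w _ hw
    simp [pe, hw]
  · simp

theorem coeff_mul_eq_sum (x y : PermAlg n) (g : Equiv.Perm (Fin n)) :
    (x * y).coeff g = ∑ w, x.coeff w * y.coeff (w⁻¹ * g) := by
  rw [MonoidAlgebra.coeff_mul_apply_left, Finsupp.sum_fintype _ _ (by simp)]

theorem coeff_pe_mul (v : Equiv.Perm (Fin n)) (y : PermAlg n) (g : Equiv.Perm (Fin n)) :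
    (pe v * y).coeff g = y.coeff (v⁻¹ * g) := by
  rw [coeff_mul_eq_sum, Finset.sum_eq_single v]
  · simp [pe]
  · intro w _ hw
    simp [pe, hw.symm]
  · simp

theorem trace_permAlg (F : PermAlg n →ₗ[ℂ] PermAlg n) :
    LinearMap.trace ℂ _ F = ∑ w, (F (pe w)).coeff w := by
  classical
  rw [LinearMap.trace_eq_matrix_trace ℂ (MonoidAlgebra.basis (Equiv.Perm (Fin n)) ℂ), Matrix.trace]
  refine Finset.sum_congr rfl fun w _ => ?_
  rw [Matrix.diag_apply, LinearMap.toMatrix_apply]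
  rfl

/-- The sum of the stabilizer of a colouring. -/
noncomputable def stabSum {β : Type*} [DecidableEq β] (f : Fin n → β) : PermAlg n :=
  ∑ w : Equiv.Perm (Fin n) with (∀ i, f (w i) = f i), pe w

theorem stabSum_mul_pe {β : Type*} [DecidableEq β] (f : Fin n → β) (v : Equiv.Perm (Fin n))
    (hv : ∀ i, f (v i) = f i) : stabSum f * pe v = stabSum f := by
  rw [stabSum, Finset.sum_mul]
  simp only [pe_mul]
  refine Finset.sum_bij (fun w _ => w * v) ?_ ?_ ?_ ?_
  · intro w hw
    simp only [Finset.mem_filter, Finset.mem_univ, true_and] at hw ⊢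
    intro i
    rw [Equiv.Perm.mul_apply, hw, hv]
  · intro w _ w' _ h
    exact mul_right_cancel h
  · intro w hw
    simp only [Finset.mem_filter, Finset.mem_univ, true_and] at hw
    refine ⟨w * v⁻¹, ?_, by simp⟩
    simp only [Finset.mem_filter, Finset.mem_univ, true_and]
    intro i
    rw [Equiv.Perm.mul_apply, hw, ← hv (v⁻¹ i), perm_apply_inv]
  · intro w _
    rfl

theorem stabSum_mul_self {β : Type*} [DecidableEq β] (f : Fin n → β) :
    stabSum f * stabSum f =
      ((Finset.univ.filter fun w : Equiv.Perm (Fin n) => ∀ i, f (w i) = f i).card : ℂ) •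
        stabSum f := by
  conv_lhs => enter [2]; rw [stabSum]
  rw [Finset.mul_sum, Finset.sum_congr rfl fun w hw =>
    stabSum_mul_pe f w (Finset.mem_filter.1 hw).2, Finset.sum_const, Nat.cast_smul_eq_nsmul]

theorem stabSum_comp {β : Type*} [DecidableEq β] (f : Fin n → β) (y : Equiv.Perm (Fin n)) :
    stabSum (fun i => f (y i)) = pe y⁻¹ * stabSum f * pe y := by
  rw [stabSum, stabSum, Finset.mul_sum, Finset.sum_mul]
  simp only [pe_mul]
  refine Finset.sum_bij (fun w _ => y * w * y⁻¹) ?_ ?_ ?_ ?_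
  · intro w hw
    simp only [Finset.mem_filter, Finset.mem_univ, true_and] at hw ⊢
    intro i
    have := hw (y⁻¹ i)
    rw [Equiv.Perm.mul_apply, Equiv.Perm.mul_apply, this, perm_apply_inv]
  · intro w _ w' _ h
    exact mul_left_cancel (mul_right_cancel h)
  · intro w hw
    simp only [Finset.mem_filter, Finset.mem_univ, true_and] at hw
    refine ⟨y⁻¹ * w * y, ?_, by group⟩
    simp only [Finset.mem_filter, Finset.mem_univ, true_and]
    intro i
    rw [Equiv.Perm.mul_apply, Equiv.Perm.mul_apply, perm_apply_inv, hw]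
  · intro w _
    congr 1
    group

variable {lam : YoungDiagram} (T : Fin n ≃ lam.cells)

/-- The signed sum of the column stabilizer. -/
noncomputable def colSum : PermAlg n :=
  ∑ h : Equiv.Perm (Fin n) with (∀ i, tabCol T (h i) = tabCol T i),
    ((Equiv.Perm.sign h : ℤ) : ℂ) • pe h

theorem youngSymmetrizer_eq : youngSymmetrizer T = stabSum (tabRow T) * colSum T := by
  rw [youngSymmetrizer, stabSum, colSum]
  congr 1
  refine Finset.sum_congr ?_ fun w _ => ?_
  · ext w
    rw [Finset.mem_filter, Finset.mem_filter]
    rfl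
  · rw [pe, MonoidAlgebra.smul_single, smul_eq_mul, mul_one]

theorem pe_mul_colSum (h : Equiv.Perm (Fin n)) (hh : ∀ i, tabCol T (h i) = tabCol T i) :
    pe h * colSum T = ((Equiv.Perm.sign h : ℤ) : ℂ) • colSum T := by
  have hs : ((Equiv.Perm.sign h : ℤ) : ℂ) * ((Equiv.Perm.sign h : ℤ) : ℂ) = 1 := by
    rw [← Int.cast_mul, ← Units.val_mul, Int.units_mul_self]; simp
  rw [colSum, Finset.mul_sum, Finset.smul_sum]
  simp only [mul_smul_comm, pe_mul, smul_smul]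
  refine Finset.sum_bij (fun w _ => h * w) ?_ ?_ ?_ ?_
  · intro w hw
    simp only [Finset.mem_filter, Finset.mem_univ, true_and] at hw ⊢
    intro i
    rw [Equiv.Perm.mul_apply, hh, hw]
  · intro w _ w' _ e
    exact mul_left_cancel e
  · intro w hw
    simp only [Finset.mem_filter, Finset.mem_univ, true_and] at hw
    refine ⟨h⁻¹ * w, ?_, by simp⟩
    simp only [Finset.mem_filter, Finset.mem_univ, true_and]
    intro i
    rw [Equiv.Perm.mul_apply, ← hh (h⁻¹ (w i)), perm_apply_inv, hw]
  · intro w _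
    rw [Equiv.Perm.sign_mul]
    push_cast
    rw [← mul_assoc, hs, one_mul]

/-- A transposition in both stabilizers kills the product. -/
theorem stabSum_mul_pe_mul_colSum_eq_zero {β : Type*} [DecidableEq β] (f : Fin n → β)
    (y : Equiv.Perm (Fin n)) {i j : Fin n} (hij : i ≠ j) (hc : tabCol T i = tabCol T j)
    (hf : f (y i) = f (y j)) : stabSum f * pe y * colSum T = 0 := by
  have h1 : ∀ x, f (Equiv.swap (y i) (y j) x) = f x := by
    intro x
    by_cases hx : x = y i
    · rw [hx, Equiv.swap_apply_left, hf]
    · by_cases hx' : x = y j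
      · rw [hx', Equiv.swap_apply_right, hf]
      · rw [Equiv.swap_apply_of_ne_of_ne hx hx']
  have h2 : ∀ x, tabCol T (Equiv.swap i j x) = tabCol T x := by
    intro x
    by_cases hx : x = i
    · rw [hx, Equiv.swap_apply_left, hc]
    · by_cases hx' : x = j
      · rw [hx', Equiv.swap_apply_right, hc]
      · rw [Equiv.swap_apply_of_ne_of_ne hx hx']
  have h3 : pe (Equiv.swap (y i) (y j)) * pe y = pe y * pe (Equiv.swap i j) := by
    rw [pe_mul, pe_mul, Equiv.mul_swap_eq_swap_mul]
  have h4 : stabSum f * pe y * colSum T = -(stabSum f * pe y * colSum T) := by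
    conv_lhs => rw [← stabSum_mul_pe f _ h1, mul_assoc (stabSum f), h3, mul_assoc, mul_assoc,
      pe_mul_colSum T _ h2, Equiv.Perm.sign_swap hij]
    simp [mul_assoc]
  have h5 : (2 : ℂ) • (stabSum f * pe y * colSum T) = 0 := by
    rw [two_smul]
    nth_rewrite 1 [h4]
    exact neg_add_cancel _
  exact (smul_eq_zero.1 h5).resolve_left two_ne_zero

theorem card_filter_comp_perm (p : Fin n → Prop) [DecidablePred p] (y : Equiv.Perm (Fin n)) :
    (Finset.univ.filter fun i => p (y i)).card = (Finset.univ.filter p).card := by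
  refine Finset.card_bij (fun i _ => y i) (fun i hi => by simpa using hi)
    (fun i _ j _ h => y.injective h) fun i hi => ⟨y⁻¹ i, by simpa using hi, by simp⟩

/-- `a x b` is a multiple of the Young symmetrizer `a b`. -/
theorem stabSum_mul_mul_colSum (x : PermAlg n) :
    ∃ s : ℂ, stabSum (tabRow T) * x * colSum T = s • youngSymmetrizer T := by
  have h : ∀ y : Equiv.Perm (Fin n),
      ∃ s : ℂ, stabSum (tabRow T) * pe y * colSum T = s • youngSymmetrizer T := by
    intro y
    -- If y sends two entries of one column to the same row, a transposition makes the product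
    -- vanish. Otherwise y is a row permutation times a column permutation, and both are absorbed up
    -- to sign.
    by_cases hy : ∃ i j, i ≠ j ∧ tabCol T i = tabCol T j ∧ tabRow T (y i) = tabRow T (y j)
    · obtain ⟨i, j, hij, hc, hf⟩ := hy
      exact ⟨0, by rw [zero_smul, stabSum_mul_pe_mul_colSum_eq_zero T _ y hij hc hf]⟩
    · push Not at hy
      obtain ⟨h, h1, h2⟩ := exists_column_perm T (fun i => tabRow T (y i))
        (fun i j hc hf => by_contra fun hij => hy i j hij hc hf)
        (fun k => (card_filter_comp_perm (fun i => tabRow T i < k) y).ge)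
      refine ⟨((Equiv.Perm.sign h : ℤ) : ℂ), ?_⟩
      have e : pe y = pe (y * h⁻¹) * pe h := by rw [pe_mul]; simp
      have h3 : ∀ i, tabRow T ((y * h⁻¹) i) = tabRow T i := by
        intro i
        rw [Equiv.Perm.mul_apply, ← h2, perm_apply_inv]
      rw [e, ← mul_assoc, stabSum_mul_pe _ _ h3, mul_assoc, pe_mul_colSum T h h1,
        mul_smul_comm, youngSymmetrizer_eq]
  choose s hs using h
  refine ⟨∑ y, x.coeff y * s y, ?_⟩
  conv_lhs => rw [sum_smul_pe x]
  rw [Finset.mul_sum, Finset.sum_mul, Finset.sum_smul]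
  refine Finset.sum_congr rfl fun y _ => ?_
  rw [mul_smul_comm, smul_mul_assoc, hs, smul_smul]

/-- Only the identity preserves both rows and columns, so 1 arises in a single way as a product. -/
theorem coeff_youngSymmetrizer_one : (youngSymmetrizer T).coeff 1 = 1 := by
  rw [youngSymmetrizer_eq, stabSum, Finset.sum_mul, MonoidAlgebra.coeff_sum,
    Finsupp.finsetSum_apply, Finset.sum_eq_single 1]
  · rw [pe_one, one_mul, colSum, MonoidAlgebra.coeff_sum, Finsupp.finsetSum_apply,
      Finset.sum_eq_single 1]
    · simp [pe]
    · intro h _ hh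
      simp [pe, hh]
    · simp
  · intro w hw hw1
    rw [coeff_pe_mul, mul_one, colSum, MonoidAlgebra.coeff_sum, Finsupp.finsetSum_apply]
    refine Finset.sum_eq_zero fun h hh => ?_
    have hne : h ≠ w⁻¹ := by
      rintro rfl
      apply hw1
      simp only [Finset.mem_filter, Finset.mem_univ, true_and] at hw hh
      ext i
      have h1 := hh (w i)
      rw [← Equiv.Perm.mul_apply, inv_mul_cancel, Equiv.Perm.one_apply] at h1
      rw [Equiv.Perm.one_apply]
      exact congrArg Fin.val (tab_ext T (hw i) h1.symm)
    simp [pe, hne]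
  · simp

theorem youngSymmetrizer_ne_zero : youngSymmetrizer T ≠ 0 := by
  intro h
  have := coeff_youngSymmetrizer_one T
  rw [h] at this
  simp at this

theorem youngSymmetrizer_mul_mul (x : PermAlg n) :
    ∃ s : ℂ, youngSymmetrizer T * x * youngSymmetrizer T = s • youngSymmetrizer T := by
  obtain ⟨s, hs⟩ := stabSum_mul_mul_colSum T (colSum T * x * stabSum (tabRow T))
  refine ⟨s, ?_⟩
  rw [← hs, youngSymmetrizer_eq]
  simp only [mul_assoc]

theorem exists_youngSymmetrizer_sq :
    ∃ κ : ℂ, youngSymmetrizer T * youngSymmetrizer T = κ • youngSymmetrizer T := by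
  obtain ⟨κ, h⟩ := youngSymmetrizer_mul_mul T 1
  exact ⟨κ, by rwa [mul_one] at h⟩

/-- The scalar `κ` with `c ^ 2 = κ c`, the product of the hook lengths. -/
noncomputable def hookScalar : ℂ := (exists_youngSymmetrizer_sq T).choose

theorem youngSymmetrizer_sq :
    youngSymmetrizer T * youngSymmetrizer T = hookScalar T • youngSymmetrizer T :=
  (exists_youngSymmetrizer_sq T).choose_spec

/-- If c² = 0, right multiplication by c is nilpotent and has trace 0. Its trace is n!, because c
has coefficient 1 at the identity. -/
theorem hookScalar_ne_zero : hookScalar T ≠ 0 := by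
  intro h0
  have h1 := youngSymmetrizer_sq T
  rw [h0, zero_smul] at h1
  have h2 : IsNilpotent (LinearMap.mulRight ℂ (youngSymmetrizer T)) := by
    refine ⟨2, LinearMap.ext fun x => ?_⟩
    rw [pow_two, Module.End.mul_apply, LinearMap.mulRight_apply, LinearMap.mulRight_apply,
      mul_assoc, h1, mul_zero, LinearMap.zero_apply]
  have h3 := (LinearMap.isNilpotent_trace_of_isNilpotent h2).eq_zero
  rw [trace_permAlg] at h3
  have h4 : ∀ w : Equiv.Perm (Fin n),
      (LinearMap.mulRight ℂ (youngSymmetrizer T) (pe w)).coeff w = 1 := by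
    intro w
    rw [LinearMap.mulRight_apply, coeff_pe_mul, inv_mul_cancel, coeff_youngSymmetrizer_one]
  rw [Finset.sum_congr rfl fun w _ => h4 w] at h3
  simp [Fintype.card_perm, Nat.factorial_ne_zero] at h3

instance : FiniteDimensional ℂ (PermAlg n) :=
  Module.Finite.of_basis (MonoidAlgebra.basis (Equiv.Perm (Fin n)) ℂ)

/-- The character of the Specht module in terms of the coefficients of the Young symmetrizer. -/
theorem hookScalar_mul_spechtCharacter (w : Equiv.Perm (Fin n)) :
    hookScalar T * spechtCharacter T w =
      ∑ y : Equiv.Perm (Fin n), (youngSymmetrizer T).coeff (y⁻¹ * (w⁻¹ * y)) := by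
  set F : PermAlg n →ₗ[ℂ] PermAlg n :=
    LinearMap.mulLeft ℂ (pe w) ∘ₗ LinearMap.mulRight ℂ (youngSymmetrizer T) with hF
  have hF' : ∀ x, F x = pe w * (x * youngSymmetrizer T) := fun x => rfl
  have hmem : ∀ x, F x ∈ spechtModule T := by
    intro x
    exact ⟨pe w * x, by rw [hF', LinearMap.mulRight_apply, mul_assoc]⟩
  have h1 := LinearMap.trace_restrict_eq_of_forall_mem (spechtModule T) F hmem
  -- Right multiplication by c maps onto the Specht module and is the scalar κ there. The trace of x
  -- ↦ w x c on the group algebra is therefore κ χ(w).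
  have h2 : F.restrict (fun x _ => hmem x) = hookScalar T • spechtRep T w := by
    refine LinearMap.ext fun x => Subtype.ext ?_
    obtain ⟨_, z, rfl⟩ := x
    change F (z * youngSymmetrizer T) = hookScalar T •
      (Representation.leftRegular ℂ _ w) (z * youngSymmetrizer T)
    rw [hF', leftRegular_apply, mul_assoc z, youngSymmetrizer_sq, mul_smul_comm, mul_smul_comm]
    rfl
  rw [h2, map_smul, smul_eq_mul, trace_permAlg] at h1
  rw [spechtCharacter, Representation.character, h1]
  refine Finset.sum_congr rfl fun y _ => ?_
  rw [hF', coeff_pe_mul, coeff_pe_mul]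

/-- The trace of `x ↦ u x v` when its image is spanned by the Young symmetrizer. -/
theorem sum_coeff_mul_mul (u v : PermAlg n)
    (h : ∀ x, ∃ s : ℂ, u * x * v = s • youngSymmetrizer T) {s : ℂ}
    (hs : u * youngSymmetrizer T * v = s • youngSymmetrizer T) :
    ∑ y, (u * pe y * v).coeff y = s := by
  set F : PermAlg n →ₗ[ℂ] PermAlg n := LinearMap.mulRight ℂ v ∘ₗ LinearMap.mulLeft ℂ u with hF
  have hF' : ∀ x, F x = u * x * v := fun x => rfl
  have hmem : ∀ x, F x ∈ Submodule.span ℂ {youngSymmetrizer T} := by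
    intro x
    obtain ⟨r, hr⟩ := h x
    rw [hF', hr]
    exact Submodule.smul_mem _ _ (Submodule.mem_span_singleton_self _)
  have h1 := LinearMap.trace_restrict_eq_of_forall_mem _ F hmem
  have h2 : F.restrict (fun x _ => hmem x) = s • LinearMap.id := by
    refine LinearMap.ext fun x => Subtype.ext ?_
    obtain ⟨x, hx⟩ := x
    obtain ⟨r, rfl⟩ := Submodule.mem_span_singleton.1 hx
    change F (r • youngSymmetrizer T) = s • (r • youngSymmetrizer T)
    rw [map_smul, hF', hs, smul_comm]
  rw [h2, map_smul, LinearMap.trace_id, finrank_span_singleton (youngSymmetrizer_ne_zero T),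
    Nat.cast_one, smul_eq_mul, mul_one, trace_permAlg] at h1
  exact h1.symm

/-- The inner product of the character of the Specht module with a class function. -/
theorem hookScalar_mul_sum (ψ : Equiv.Perm (Fin n) → ℂ)
    (hψ : ∀ y w : Equiv.Perm (Fin n), ψ (y * w⁻¹ * y⁻¹) = ψ w) :
    hookScalar T * ∑ w, spechtCharacter T w * ψ w =
      n.factorial * ∑ w, (youngSymmetrizer T).coeff w * ψ w := by
  rw [Finset.mul_sum]
  simp only [← mul_assoc, hookScalar_mul_spechtCharacter, Finset.sum_mul]
  rw [Finset.sum_comm]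
  have h : ∀ y : Equiv.Perm (Fin n),
      ∑ w, (youngSymmetrizer T).coeff (y⁻¹ * w⁻¹ * y) * ψ w =
        ∑ w, (youngSymmetrizer T).coeff w * ψ w := by
    intro y
    refine Fintype.sum_equiv ((Equiv.inv _).trans (MulAut.conj y⁻¹).toEquiv) _ _ fun w => ?_
    simp only [Equiv.trans_apply, Equiv.inv_apply, MulEquiv.toEquiv_eq_coe, EquivLike.coe_coe,
      MulAut.conj_apply, inv_inv]
    congr 1
    rw [← hψ y⁻¹ w, inv_inv]
  rw [Finset.sum_congr rfl fun y _ => h y]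
  simp [Fintype.card_perm]

/-- The trace of x ↦ c x c is computed twice: it is κ² because the image lies in the line through c,
and it is κ Σ c_w χ(w) from the coefficients. -/
theorem sum_coeff_mul_spechtCharacter :
    ∑ w, (youngSymmetrizer T).coeff w * spechtCharacter T w = hookScalar T := by
  have h1 : hookScalar T * ∑ w, (youngSymmetrizer T).coeff w * spechtCharacter T w =
      hookScalar T * hookScalar T := by
    rw [← sum_coeff_mul_mul T (youngSymmetrizer T) (youngSymmetrizer T)
      (youngSymmetrizer_mul_mul T) (s := hookScalar T * hookScalar T)
      (by rw [youngSymmetrizer_sq, smul_mul_assoc, youngSymmetrizer_sq, smul_smul]),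
      Finset.mul_sum]
    simp only [mul_left_comm (hookScalar T), hookScalar_mul_spechtCharacter, Finset.mul_sum]
    rw [Finset.sum_comm]
    refine Finset.sum_congr rfl fun y _ => ?_
    rw [mul_assoc, coeff_mul_eq_sum]
    simp only [coeff_pe_mul]
  exact mul_left_cancel₀ (hookScalar_ne_zero T) h1

theorem isConj_inv_perm (w : Equiv.Perm (Fin n)) : IsConj w⁻¹ w := by
  rw [Equiv.Perm.isConj_iff_cycleType_eq, Equiv.Perm.cycleType_inv]

theorem spechtCharacter_conj (y w : Equiv.Perm (Fin n)) :
    spechtCharacter T (y * w⁻¹ * y⁻¹) = spechtCharacter T w := by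
  obtain ⟨c, hc⟩ := isConj_iff.1 (isConj_inv_perm w)
  rw [spechtCharacter, Representation.char_conj]
  conv_rhs => rw [← hc]
  rw [Representation.char_conj]

/-- Irreducibility of the Specht module. -/
theorem sum_spechtCharacter_sq :
    ∑ w, spechtCharacter T w * spechtCharacter T w = n.factorial := by
  have h := hookScalar_mul_sum T (spechtCharacter T) (spechtCharacter_conj T)
  rw [sum_coeff_mul_spechtCharacter, mul_comm] at h
  exact mul_right_cancel₀ (hookScalar_ne_zero T) h

theorem coeff_youngSymmetrizer_real (g : Equiv.Perm (Fin n)) :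
    ∃ r : ℝ, (youngSymmetrizer T).coeff g = r := by
  refine ⟨∑ w : Equiv.Perm (Fin n) with (∀ i, tabRow T (w i) = tabRow T i),
    ∑ h : Equiv.Perm (Fin n) with (∀ i, tabCol T (h i) = tabCol T i),
      if w * h = g then ((Equiv.Perm.sign h : ℤ) : ℝ) else 0, ?_⟩
  rw [youngSymmetrizer_eq, stabSum, colSum, Finset.sum_mul, MonoidAlgebra.coeff_sum,
    Finsupp.finsetSum_apply, Complex.ofReal_sum]
  refine Finset.sum_congr rfl fun w _ => ?_
  rw [Finset.mul_sum, MonoidAlgebra.coeff_sum, Finsupp.finsetSum_apply, Complex.ofReal_sum]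
  refine Finset.sum_congr rfl fun h _ => ?_
  rw [mul_smul_comm, pe_mul]
  split_ifs with e
  · simp [pe, e]
  · simp [pe, Ne.symm e]

/-- The coefficients of c are real, κ is the coefficient of c² at 1, and κ χ(w) is a sum of
coefficients of c. Reality is needed for the sum of squares in the comparison with Frobenius'
formula. -/
theorem spechtCharacter_real (w : Equiv.Perm (Fin n)) : ∃ r : ℝ, spechtCharacter T w = r := by
  choose c hc using coeff_youngSymmetrizer_real T
  have h1 := congrArg (fun x => MonoidAlgebra.coeff x 1) (youngSymmetrizer_sq T)
  simp only [coeff_mul_eq_sum, MonoidAlgebra.coeff_smul, Finsupp.smul_apply, hc,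
    smul_eq_mul] at h1
  have h1' : (c 1 : ℂ) = 1 := by rw [← hc, coeff_youngSymmetrizer_one]
  rw [h1', mul_one] at h1
  have h2 := hookScalar_mul_spechtCharacter T w
  simp only [hc] at h2
  refine ⟨(∑ g, c g * c (g⁻¹ * 1))⁻¹ * ∑ y, c (y⁻¹ * (w⁻¹ * y)), ?_⟩
  push_cast
  rw [← h2, h1, inv_mul_cancel_left₀ (hookScalar_ne_zero T)]

end Symmetrizer

/-! ### The character of the Specht module by Frobenius' formula -/

section Content

variable {n N : ℕ}

/-- The number of entries of each colour. -/
def colourContent (f : Fin n → Fin N) (i : Fin N) : ℕ := (Finset.univ.filter fun x => f x = i).card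

theorem prod_X_colouring (f : Fin n → Fin N) :
    ∏ x, (MvPolynomial.X (f x) : MvPolynomial (Fin N) ℚ) =
      MvPolynomial.monomial (expo (colourContent f)) 1 := by
  rw [← prod_X_pow_eq_monomial, ← Finset.prod_fiberwise (s := Finset.univ) (g := f)]
  refine Finset.prod_congr rfl fun i _ => ?_
  rw [colourContent, ← Finset.prod_const]
  exact Finset.prod_congr rfl fun x hx => by rw [(Finset.mem_filter.1 hx).2]

/-- The alternant is expanded over π and the power sums over the colourings fixed by w. For each
colouring the condition on w says that w lies in its stabilizer. -/
theorem frobChar_eq_sum (α : Fin N → ℕ) (w : Equiv.Perm (Fin n)) :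
    frobChar α w = ∑ π : Equiv.Perm (Fin N), ((Equiv.Perm.sign π : ℤ) : ℚ) *
      ∑ f : Fin n → Fin N with (∀ i, colourContent f i + stair N (π i) = α i),
        if (∀ x, f (w x) = f x) then 1 else 0 := by
  rw [frobChar, coeff_alternant_mul]
  refine Finset.sum_congr rfl fun π _ => ?_
  congr 1
  rw [← sum_fixed_colourings w, MvPolynomial.coeff_sum]
  simp only [prod_X_colouring, MvPolynomial.coeff_monomial]
  split_ifs with h
  · rw [Finset.sum_filter, Finset.sum_filter]
    refine Finset.sum_congr rfl fun f _ => ?_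
    have e : (expo (colourContent f) = expo fun i => α i - stair N (π i)) ↔
        ∀ i, colourContent f i + stair N (π i) = α i := by
      rw [DFunLike.ext_iff]
      refine forall_congr' fun i => ?_
      have := h i
      simp only [expo_apply]
      omega
    simp only [e]
    split_ifs <;> rfl
  · rw [Finset.filter_eq_empty_iff.2, Finset.sum_empty]
    intro f _ hf
    exact h fun i => by have := hf i; omega

theorem card_filter_lt (f : Fin n → Fin N) (k : ℕ) :
    (Finset.univ.filter fun x => (f x : ℕ) < k).card =
      ∑ i : Fin N, (if (i : ℕ) < k then 1 else 0) * colourContent f i := by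
  rw [Finset.card_eq_sum_card_fiberwise (f := f) (t := Finset.univ) (fun _ _ => Finset.mem_univ _)]
  refine Finset.sum_congr rfl fun i _ => ?_
  rw [colourContent]
  split_ifs with h
  · rw [one_mul]
    congr 1
    ext x
    simp only [Finset.mem_filter, Finset.mem_univ, true_and]
    exact ⟨fun hx => hx.2, fun hx => ⟨by rw [hx]; exact h, hx⟩⟩
  · rw [zero_mul, Finset.card_eq_zero, Finset.filter_eq_empty_iff]
    intro x hx hxi
    rw [Finset.mem_filter, hxi] at hx
    exact h hx.2

/-- The rearrangement inequality: the staircase decreases, so its first k values are its largest. -/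
theorem sum_lt_stair_perm (π : Equiv.Perm (Fin N)) (k : ℕ) :
    ∑ i : Fin N, (if (i : ℕ) < k then 1 else 0) * stair N (π i) ≤
      ∑ i : Fin N, (if (i : ℕ) < k then 1 else 0) * stair N i := by
  refine Monovary.sum_mul_comp_perm_le_sum_mul ?_
  intro i j hij
  have hij' : (j : ℕ) < i := by simp only [stair] at hij; omega
  simp only
  split_ifs <;> omega

end Content

section Specht

variable {n : ℕ} {lam : YoungDiagram} (T : Fin n ≃ lam.cells)

theorem colLen_le_colLen_zero (j : ℕ) : lam.colLen j ≤ lam.colLen 0 :=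
  lam.colLen_anti 0 j (Nat.zero_le j)

/-- The row of an entry, as an element of `Fin N` with `N` the number of rows. -/
def tabRowFin (x : Fin n) : Fin (lam.colLen 0) :=
  ⟨tabRow T x, (tabRow_lt T x).trans_le (colLen_le_colLen_zero _)⟩

theorem colourContent_tabRowFin (i : Fin (lam.colLen 0)) :
    colourContent (tabRowFin T) i = lam.rowLen i := by
  rw [colourContent, YoungDiagram.rowLen_eq_card]
  refine Finset.card_bij (fun x _ => (T x).1) ?_ ?_ ?_
  · intro x hx
    rw [YoungDiagram.mem_row_iff]
    refine ⟨(YoungDiagram.mem_cells _).1 (T x).2, ?_⟩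
    exact congrArg Fin.val (Finset.mem_filter.1 hx).2
  · intro x _ y _ h
    exact T.injective (Subtype.ext h)
  · intro c hc
    rw [YoungDiagram.mem_row_iff] at hc
    refine ⟨T.symm ⟨c, (YoungDiagram.mem_cells _).2 hc.1⟩, ?_, by simp⟩
    simp [tabRowFin, tabRow, Fin.ext_iff, hc.2]

variable (lam) in
/-- The strictly decreasing sequence `λ + δ`. -/
def shiftedRow (i : Fin (lam.colLen 0)) : ℕ := lam.rowLen i + stair (lam.colLen 0) i

theorem shiftedRow_lt {i j : Fin (lam.colLen 0)} (h : i < j) :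
    shiftedRow lam j < shiftedRow lam i := by
  have h1 := lam.rowLen_anti i j h.le
  have h2 : (i : ℕ) < j := h
  simp only [shiftedRow, stair]
  omega

theorem shiftedRow_injective : Function.Injective (shiftedRow lam) :=
  (show StrictAnti (shiftedRow lam) from fun _ _ h => shiftedRow_lt h).injective

theorem sum_shiftedRow {n : ℕ} {lam : YoungDiagram} (T : Fin n ≃ lam.cells) :
    ∑ i, shiftedRow lam i = n + ∑ i, stair (lam.colLen 0) i := by
  simp only [shiftedRow, Finset.sum_add_distrib]
  congr 1
  rw [← Finset.sum_congr rfl fun i _ => colourContent_tabRowFin T i]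
  have h := Finset.card_eq_sum_card_fiberwise (s := Finset.univ) (f := tabRowFin T)
    (t := Finset.univ) (fun _ _ => Finset.mem_univ _)
  rw [Finset.card_univ, Fintype.card_fin] at h
  exact h.symm

/-- The sum of the coefficients of the Young symmetrizer over the stabilizer of a colouring. -/
noncomputable def stabCoeff {β : Type*} [DecidableEq β] (f : Fin n → β) : ℂ :=
  ∑ w : Equiv.Perm (Fin n) with (∀ x, f (w x) = f x), (youngSymmetrizer T).coeff w

/-- The stabilizer is closed under inversion. As a coefficient of a product, the sum becomes
accessible to the vanishing and trace arguments for c. -/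
theorem stabCoeff_eq {β : Type*} [DecidableEq β] (f : Fin n → β) :
    stabCoeff T f = (stabSum f * youngSymmetrizer T).coeff 1 := by
  rw [stabSum, Finset.sum_mul, MonoidAlgebra.coeff_sum, Finsupp.finsetSum_apply, stabCoeff]
  refine Finset.sum_bij (fun w _ => w⁻¹) ?_ ?_ ?_ ?_
  · intro w hw
    simp only [Finset.mem_filter, Finset.mem_univ, true_and] at hw ⊢
    intro x
    rw [← hw (w⁻¹ x), perm_apply_inv]
  · intro w _ w' _ h
    exact inv_injective h
  · intro w hw
    simp only [Finset.mem_filter, Finset.mem_univ, true_and] at hw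
    refine ⟨w⁻¹, ?_, inv_inv w⟩
    simp only [Finset.mem_filter, Finset.mem_univ, true_and]
    intro x
    rw [← hw (w⁻¹ x), perm_apply_inv]
  · intro w _
    rw [coeff_pe_mul, inv_inv, mul_one]

/-- Only colourings of content `λ` contribute. -/
theorem stabCoeff_eq_zero {π : Equiv.Perm (Fin (lam.colLen 0))} (hπ : π ≠ 1)
    (f : Fin n → Fin (lam.colLen 0))
    (hf : ∀ i, colourContent f i + stair _ (π i) = shiftedRow lam i) : stabCoeff T f = 0 := by
  -- The content is λ + δ - πδ, which dominates λ by the rearrangement inequality.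
  have hdom : ∀ k, (Finset.univ.filter fun x => tabRow T x < k).card ≤
      (Finset.univ.filter fun x => (f x : ℕ) < k).card := by
    intro k
    have h1 := card_filter_lt (tabRowFin T) k
    have h2 := card_filter_lt f k
    have h3 := sum_lt_stair_perm π k
    have h4 : ∑ i : Fin (lam.colLen 0), (if (i : ℕ) < k then 1 else 0) * colourContent f i +
        ∑ i : Fin (lam.colLen 0), (if (i : ℕ) < k then 1 else 0) * stair _ (π i) =
        ∑ i : Fin (lam.colLen 0), (if (i : ℕ) < k then 1 else 0) *
            colourContent (tabRowFin T) i +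
          ∑ i : Fin (lam.colLen 0), (if (i : ℕ) < k then 1 else 0) * stair _ i := by
      rw [← Finset.sum_add_distrib, ← Finset.sum_add_distrib]
      refine Finset.sum_congr rfl fun i _ => ?_
      rw [← mul_add, ← mul_add, hf, colourContent_tabRowFin, shiftedRow]
    change (Finset.univ.filter fun x => (tabRowFin T x : ℕ) < k).card ≤ _
    omega
  -- A nonzero term would make f ∘ y injective on columns, hence the row filling composed with a
  -- column permutation. Then f has content λ, which forces πδ = δ and π = 1.
  have hkill : ∀ y : Equiv.Perm (Fin n), stabSum f * pe y * colSum T = 0 := by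
    intro y
    by_contra hne
    have hinj : ∀ i j, tabCol T i = tabCol T j → (f (y i) : ℕ) = f (y j) → i = j := by
      intro i j hc hfy
      by_contra hij
      exact hne (stabSum_mul_pe_mul_colSum_eq_zero T f y hij hc (Fin.ext hfy))
    obtain ⟨h, -, h2⟩ := exists_column_perm T (fun i => (f (y i) : ℕ)) hinj fun k => by
      rw [card_filter_comp_perm (fun x => (f x : ℕ) < k) y]
      exact hdom k
    apply hπ
    have hc : ∀ i, colourContent f i = lam.rowLen i := by
      intro i
      rw [← colourContent_tabRowFin T, colourContent, colourContent,
        ← card_filter_comp_perm (fun x => f x = i) y,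
        ← card_filter_comp_perm (fun x => tabRowFin T x = i) h]
      congr 1
      ext x
      simp only [Finset.mem_filter, Finset.mem_univ, true_and, Fin.ext_iff]
      rw [← h2]
      rfl
    ext i
    have h3 := hf i
    rw [hc, shiftedRow] at h3
    have h4 := (π i).2
    have h5 := i.2
    simp only [stair] at h3
    rw [Equiv.Perm.one_apply]
    omega
  rw [stabCoeff_eq, youngSymmetrizer_eq, ← mul_assoc]
  conv_lhs => rw [stabSum.eq_1 (f := tabRow T)]
  rw [Finset.mul_sum, Finset.sum_mul, Finset.sum_eq_zero fun y _ => hkill y]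
  rfl

theorem exists_perm_of_colourContent {N : ℕ} (f g : Fin n → Fin N)
    (h : ∀ i, colourContent f i = colourContent g i) :
    ∃ y : Equiv.Perm (Fin n), ∀ x, g (y x) = f x := by
  have e : ∀ i, Nonempty ({x // f x = i} ≃ {x // g x = i}) := by
    intro i
    refine ⟨Fintype.equivOfCardEq ?_⟩
    rw [Fintype.card_subtype, Fintype.card_subtype]
    exact h i
  exact ⟨Equiv.ofFiberEquiv fun i => (e i).some, fun x => Equiv.ofFiberEquiv_map _ x⟩

/-- The colourings of content λ are the fillings row ∘ y, each obtained from as many y as there are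
row permutations. The sum over all y is the trace of x ↦ a x c, where a is the row sum, and a c =
|R| c makes this trace |R| κ. -/
theorem sum_stabCoeff :
    ∑ f : Fin n → Fin (lam.colLen 0) with (∀ i, colourContent f i = lam.rowLen i),
      stabCoeff T f = hookScalar T := by
  classical
  set r := Finset.univ.filter fun w : Equiv.Perm (Fin n) => ∀ x, tabRow T (w x) = tabRow T x
    with hr
  have hr0 : (r.card : ℂ) ≠ 0 := by
    have : (1 : Equiv.Perm (Fin n)) ∈ r := by simp [hr]
    exact_mod_cast (Finset.card_pos.2 ⟨1, this⟩).ne'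
  have h1 : ∑ y : Equiv.Perm (Fin n), stabCoeff T (fun x => tabRow T (y x)) =
      r.card * hookScalar T := by
    rw [← sum_coeff_mul_mul T (stabSum (tabRow T)) (youngSymmetrizer T)
      (s := r.card * hookScalar T)]
    · refine Finset.sum_congr rfl fun y _ => ?_
      rw [stabCoeff_eq, stabSum_comp, mul_assoc, mul_assoc, coeff_pe_mul, inv_inv, mul_one,
        mul_assoc]
    · intro x
      obtain ⟨s, hs⟩ := stabSum_mul_mul_colSum T (x * stabSum (tabRow T))
      refine ⟨s, ?_⟩
      rw [← hs, youngSymmetrizer_eq]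
      simp only [mul_assoc]
    · have h2 : stabSum (tabRow T) * youngSymmetrizer T = (r.card : ℂ) • youngSymmetrizer T := by
        rw [youngSymmetrizer_eq, ← mul_assoc, stabSum_mul_self, smul_mul_assoc]
      rw [h2, smul_mul_assoc, youngSymmetrizer_sq, smul_smul]
  have h2 : ∑ y : Equiv.Perm (Fin n), stabCoeff T (fun x => tabRow T (y x)) =
      r.card * ∑ f : Fin n → Fin (lam.colLen 0) with (∀ i, colourContent f i = lam.rowLen i),
        stabCoeff T f := by
    rw [← Finset.sum_fiberwise_of_maps_to (s := Finset.univ)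
      (t := Finset.univ.filter fun f : Fin n → Fin (lam.colLen 0) =>
        ∀ i, colourContent f i = lam.rowLen i)
      (g := fun (y : Equiv.Perm (Fin n)) x => tabRowFin T (y x)), Finset.mul_sum]
    · refine Finset.sum_congr rfl fun f hf => ?_
      have hf' := (Finset.mem_filter.1 hf).2
      obtain ⟨y₀, hy₀⟩ := exists_perm_of_colourContent f (tabRowFin T) fun i => by
        rw [hf', colourContent_tabRowFin]
      have h3 : ∀ y ∈ Finset.univ.filter (fun y : Equiv.Perm (Fin n) =>
          (fun x => tabRowFin T (y x)) = f), stabCoeff T (fun x => tabRow T (y x)) =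
            stabCoeff T f := by
        intro y hy
        rw [← (Finset.mem_filter.1 hy).2, stabCoeff, stabCoeff]
        refine Finset.sum_congr ?_ fun _ _ => rfl
        ext w
        simp only [Finset.mem_filter, Finset.mem_univ, true_and, Fin.ext_iff]
        rfl
      rw [Finset.sum_congr rfl h3, Finset.sum_const, nsmul_eq_mul]
      congr 2
      refine Finset.card_bij (fun y _ => y * y₀⁻¹) ?_ ?_ ?_
      · intro y hy
        simp only [hr, Finset.mem_filter, Finset.mem_univ, true_and] at hy ⊢
        intro x
        have h4 := congrFun hy (y₀⁻¹ x)
        rw [← hy₀, perm_apply_inv] at h4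
        exact congrArg Fin.val h4
      · intro y _ y' _ h
        exact mul_right_cancel h
      · intro w hw
        simp only [hr, Finset.mem_filter, Finset.mem_univ, true_and] at hw
        refine ⟨w * y₀, ?_, by simp⟩
        simp only [Finset.mem_filter, Finset.mem_univ, true_and]
        funext x
        rw [← hy₀, Fin.ext_iff]
        exact hw (y₀ x)
    · intro y _
      simp only [Finset.mem_filter, Finset.mem_univ, true_and]
      intro i
      rw [← colourContent_tabRowFin T, colourContent, colourContent]
      exact card_filter_comp_perm (fun x => tabRowFin T x = i) y
  rw [h1] at h2
  exact (mul_left_cancel₀ hr0 h2).symm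

/-- Only π = 1 survives in the expansion, and it leaves exactly the colourings of content λ.
Together with `hookScalar_mul_sum` this gives inner product one. -/
theorem sum_coeff_mul_frobChar :
    ∑ w : Equiv.Perm (Fin n), (youngSymmetrizer T).coeff w *
      (frobChar (shiftedRow lam) w : ℂ) = hookScalar T := by
  have h1 : ∀ w : Equiv.Perm (Fin n), (youngSymmetrizer T).coeff w *
      (frobChar (shiftedRow lam) w : ℂ) = ∑ π : Equiv.Perm (Fin (lam.colLen 0)),
        ((Equiv.Perm.sign π : ℤ) : ℂ) * ∑ f : Fin n → Fin (lam.colLen 0) with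
          (∀ i, colourContent f i + stair _ (π i) = shiftedRow lam i),
            if (∀ x, f (w x) = f x) then (youngSymmetrizer T).coeff w else 0 := by
    intro w
    rw [frobChar_eq_sum]
    push_cast
    rw [Finset.mul_sum]
    refine Finset.sum_congr rfl fun π _ => ?_
    rw [mul_left_comm, Finset.mul_sum]
    congr 1
    refine Finset.sum_congr rfl fun f _ => ?_
    split_ifs <;> simp
  rw [Finset.sum_congr rfl fun w _ => h1 w, Finset.sum_comm, Finset.sum_eq_single 1]
  · rw [← Finset.mul_sum, Finset.sum_comm, ← sum_stabCoeff T, Equiv.Perm.sign_one, Units.val_one,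
      Int.cast_one, one_mul]
    refine Finset.sum_congr ?_ fun f _ => ?_
    · ext f
      simp only [Finset.mem_filter, Finset.mem_univ, true_and, shiftedRow, add_left_inj,
        Equiv.Perm.one_apply]
    · rw [stabCoeff, Finset.sum_filter]
  · intro π _ hπ
    rw [← Finset.mul_sum, Finset.sum_comm, Finset.sum_eq_zero, mul_zero]
    intro f hf
    rw [← Finset.sum_filter]
    exact stabCoeff_eq_zero T hπ f (Finset.mem_filter.1 hf).2
  · simp

theorem cycleProd_conj {R : Type*} [CommRing R] (p : ℕ → R) (y w : Equiv.Perm (Fin n)) :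
    cycleProd p (y * w⁻¹ * y⁻¹) = cycleProd p w := by
  rw [cycleProd, cycleProd, Equiv.Perm.partition_eq_of_isConj.1]
  exact (isConj_iff.2 ⟨y, rfl⟩ : IsConj w⁻¹ (y * w⁻¹ * y⁻¹)).symm.trans (isConj_inv_perm w)

/-- Frobenius' character formula. -/
theorem spechtCharacter_eq_frobChar (w : Equiv.Perm (Fin n)) :
    spechtCharacter T w = (frobChar (shiftedRow lam) w : ℂ) := by
  have h1 := hookScalar_mul_sum T (fun w => (frobChar (shiftedRow lam) w : ℂ)) fun y w => by
    simp only [frobChar, cycleProd_conj]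
  rw [sum_coeff_mul_frobChar, mul_comm] at h1
  have h2 := mul_right_cancel₀ (hookScalar_ne_zero T) h1
  have h3 := sum_frobChar_mul_self (shiftedRow_injective (lam := lam)) (sum_shiftedRow T)
  have h4 := sum_spechtCharacter_sq T
  choose X hX using spechtCharacter_real T
  simp only [hX] at h2 h4 ⊢
  have h2' : ∑ w : Equiv.Perm (Fin n), X w * (frobChar (shiftedRow lam) w : ℝ) = n.factorial := by
    exact_mod_cast h2
  have h4' : ∑ w, X w * X w = n.factorial := by exact_mod_cast h4
  have h3' : ∑ w : Equiv.Perm (Fin n), (frobChar (shiftedRow lam) w : ℝ) *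
      (frobChar (shiftedRow lam) w : ℝ) = n.factorial := by exact_mod_cast h3
  -- Two real functions of norm one with inner product one have difference of norm 1 - 2 + 1 = 0.
  have h5 : ∑ w : Equiv.Perm (Fin n), (X w - (frobChar (shiftedRow lam) w : ℝ)) ^ 2 = 0 := by
    have : ∀ w : Equiv.Perm (Fin n), (X w - (frobChar (shiftedRow lam) w : ℝ)) ^ 2 =
        X w * X w - 2 * (X w * (frobChar (shiftedRow lam) w : ℝ)) +
          (frobChar (shiftedRow lam) w : ℝ) * (frobChar (shiftedRow lam) w : ℝ) := by
      intro w; ring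
    rw [Finset.sum_congr rfl fun w _ => this w, Finset.sum_add_distrib, Finset.sum_sub_distrib,
      ← Finset.mul_sum, h2', h3', h4']
    ring
  rw [Finset.sum_eq_zero_iff_of_nonneg fun w _ => sq_nonneg _] at h5
  have h6 := sub_eq_zero.1 (pow_eq_zero_iff two_ne_zero |>.1 (h5 w (Finset.mem_univ w)))
  rw [h6]
  simp

end Specht

/-! ### Evaluation of a Jacobi-Trudi determinant by hooks and contents -/

section HookContent

variable {K : Type*} [Field K] {q u : K}

/-- `(u; q)_m / (q; q)_m`. -/
def pochRatio (q u : K) (m : ℕ) : K := ∏ i ∈ Finset.range m, (1 - u * q ^ i) / (1 - q ^ (i + 1))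

theorem pochRatio_succ (q u : K) (m : ℕ) :
    pochRatio q u (m + 1) = pochRatio q u m * ((1 - u * q ^ m) / (1 - q ^ (m + 1))) :=
  Finset.prod_range_succ _ _

/-- The q-binomial theorem. Comparing power sums gives H(z)(1 - z) = H(qz)(1 - uz), whose
coefficients satisfy the recursion of the ratios. -/
theorem coeff_eq_pochRatio [Algebra ℚ K] (hq : ∀ l, 0 < l → 1 - q ^ l ≠ 0) {H : PowerSeries K}
    (hH : IsPowerSumExp (fun l => (1 - u ^ l) / (1 - q ^ l)) H) (m : ℕ) :
    PowerSeries.coeff m H = pochRatio q u m := by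
  have h1 : H * (1 - PowerSeries.C 1 * PowerSeries.X) =
      PowerSeries.rescale q H * (1 - PowerSeries.C u * PowerSeries.X) := by
    refine (hH.mul (IsPowerSumExp.linear 1)).unique ((hH.rescale q).mul (IsPowerSumExp.linear u))
      fun l => ?_
    have := hq (l + 1) l.succ_pos
    simp only [Pi.add_apply]
    field_simp
    ring
  induction m with
  | zero =>
    rw [PowerSeries.coeff_zero_eq_constantCoeff_apply, hH.const]
    simp [pochRatio]
  | succ m ih =>
    have h2 := congrArg (PowerSeries.coeff (m + 1)) h1
    rw [mul_sub, mul_sub, map_sub, map_sub, mul_one, mul_one, ← mul_assoc, ← mul_assoc,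
      PowerSeries.coeff_succ_mul_X, PowerSeries.coeff_succ_mul_X, PowerSeries.coeff_mul_C,
      PowerSeries.coeff_mul_C, PowerSeries.coeff_rescale, PowerSeries.coeff_rescale, ih] at h2
    rw [pochRatio_succ, ← mul_div_assoc, eq_div_iff (hq (m + 1) m.succ_pos)]
    linear_combination h2

theorem pochRatio_sub_mul (hq : ∀ l, 0 < l → 1 - q ^ l ≠ 0) {k l : ℕ} (h : k ≤ l) :
    pochRatio q u (l - k) * ∏ s ∈ Finset.range k, (1 - u * q ^ ((l : ℤ) - 1 - s)) =
      pochRatio q u l * ∏ s ∈ Finset.range k, (1 - q ^ ((l : ℤ) - s)) := by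
  induction k with
  | zero => simp
  | succ k ih =>
    have ih := ih (by omega)
    have e : l - k = (l - (k + 1)) + 1 := by omega
    have e1 : ((l - (k + 1) : ℕ) : ℤ) = (l : ℤ) - 1 - k := by omega
    have e2 : ((l - k : ℕ) : ℤ) = (l : ℤ) - k := by omega
    have hne := hq (l - k) (by omega)
    rw [Finset.prod_range_succ, Finset.prod_range_succ, ← e1, ← e2, zpow_natCast, zpow_natCast]
    rw [e, pochRatio_succ, ← e] at ih
    rw [← mul_assoc (pochRatio q u l), ← ih]
    field_simp

/-- The polynomial whose values at `q ^ l` are, up to a factor that depends only on `l`, the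
entries of a column of the Jacobi-Trudi matrix. -/
noncomputable def columnPoly (q u : K) (N k : ℕ) : Polynomial K :=
  (∏ s ∈ Finset.range k, (1 - Polynomial.C (q ^ (-(s : ℤ))) * Polynomial.X)) *
    ∏ s ∈ Finset.Ico k (N - 1), (1 - Polynomial.C (u * q ^ (-(s : ℤ) - 1)) * Polynomial.X)

theorem eval_columnPoly (hq0 : q ≠ 0) (N k l : ℕ) :
    (columnPoly q u N k).eval (q ^ l) = (∏ s ∈ Finset.range k, (1 - q ^ ((l : ℤ) - s))) *
      ∏ s ∈ Finset.Ico k (N - 1), (1 - u * q ^ ((l : ℤ) - 1 - s)) := by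
  rw [columnPoly, Polynomial.eval_mul, Polynomial.eval_prod, Polynomial.eval_prod]
  congr 1
  · refine Finset.prod_congr rfl fun s _ => ?_
    rw [Polynomial.eval_sub, Polynomial.eval_one, Polynomial.eval_C_mul, Polynomial.eval_X,
      ← zpow_natCast, ← zpow_add₀ hq0]
    congr 2
    ring
  · refine Finset.prod_congr rfl fun s _ => ?_
    rw [Polynomial.eval_sub, Polynomial.eval_one, Polynomial.eval_C_mul, Polynomial.eval_X,
      ← zpow_natCast, mul_assoc, ← zpow_add₀ hq0]
    congr 3
    ring

theorem natDegree_columnPoly_lt (q u : K) {N k : ℕ} (hk : k < N) :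
    (columnPoly q u N k).natDegree < N := by
  have h : ∀ a : K, (1 - Polynomial.C a * Polynomial.X).natDegree ≤ 1 := by
    intro a
    refine (Polynomial.natDegree_sub_le _ _).trans (max_le (by simp) ?_)
    exact (Polynomial.natDegree_C_mul_le _ _).trans Polynomial.natDegree_X_le
  have h1 := Polynomial.natDegree_mul_le
    (p := ∏ s ∈ Finset.range k, (1 - Polynomial.C (q ^ (-(s : ℤ))) * Polynomial.X))
    (q := ∏ s ∈ Finset.Ico k (N - 1), (1 - Polynomial.C (u * q ^ (-(s : ℤ) - 1)) * Polynomial.X))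
  have h2 := Polynomial.natDegree_prod_le (Finset.range k)
    fun s => 1 - Polynomial.C (q ^ (-(s : ℤ))) * Polynomial.X
  have h3 := Polynomial.natDegree_prod_le (Finset.Ico k (N - 1))
    fun s => 1 - Polynomial.C (u * q ^ (-(s : ℤ) - 1)) * Polynomial.X
  have h4 := Finset.sum_le_card_nsmul (Finset.range k)
    (fun s => (1 - Polynomial.C (q ^ (-(s : ℤ))) * Polynomial.X).natDegree) 1 fun s _ => h _
  have h5 := Finset.sum_le_card_nsmul (Finset.Ico k (N - 1))
    (fun s => (1 - Polynomial.C (u * q ^ (-(s : ℤ) - 1)) * Polynomial.X).natDegree) 1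
      fun s _ => h _
  simp only [Finset.card_range, Nat.card_Ico, smul_eq_mul, mul_one] at h4 h5
  rw [columnPoly]
  omega

/-- The matrix of values is a Vandermonde matrix times the matrix of coefficients. The ratio of
determinants thus does not depend on the points; it is stated without division. -/
theorem det_eval_mul_det_vandermonde {N : ℕ} (p : Fin N → Polynomial K)
    (hp : ∀ j, (p j).natDegree < N) (v v' : Fin N → K) :
    (Matrix.of fun i j => (p j).eval (v i)).det * (Matrix.vandermonde v').det =
      (Matrix.of fun i j => (p j).eval (v' i)).det * (Matrix.vandermonde v).det := by
  have h : ∀ v : Fin N → K, (Matrix.of fun i j => (p j).eval (v i)) =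
      Matrix.vandermonde v * Matrix.of fun (i j : Fin N) => (p j).coeff i := by
    intro v
    ext i j
    rw [Matrix.of_apply, Polynomial.eval_eq_sum_range' (hp j), Matrix.mul_apply,
      ← Fin.sum_univ_eq_sum_range fun k => (p j).coeff k * v i ^ k]
    exact Finset.sum_congr rfl fun k _ => by
      rw [Matrix.vandermonde_apply, Matrix.of_apply, mul_comm]
  rw [h v, h v', Matrix.det_mul, Matrix.det_mul]
  ring

theorem shiftCoeff_mul_prod (hq0 : q ≠ 0) (hq : ∀ l, 0 < l → 1 - q ^ l ≠ 0) {H : PowerSeries K}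
    (hH : ∀ m, PowerSeries.coeff m H = pochRatio q u m) {N k : ℕ} (hk : k < N) (l : ℕ) :
    shiftCoeff H l k * ∏ s ∈ Finset.range (N - 1), (1 - u * q ^ ((l : ℤ) - 1 - s)) =
      pochRatio q u l * (columnPoly q u N k).eval (q ^ l) := by
  rw [eval_columnPoly hq0, shiftCoeff]
  split_ifs with h
  · rw [hH, ← Finset.prod_range_mul_prod_Ico _ (show k ≤ N - 1 by omega), ← mul_assoc,
      pochRatio_sub_mul hq h]
    ring
  -- For l < k the factor s = l vanishes, in agreement with the default 0 of `shiftCoeff`.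
  · have h0 : ∏ s ∈ Finset.range k, (1 - q ^ ((l : ℤ) - s)) = 0 :=
      Finset.prod_eq_zero (i := l) (Finset.mem_range.2 (by omega)) (by simp)
    rw [h0]
    simp

/-- Below the diagonal δ_i < δ_j, and the factor s = δ_i of the column polynomial vanishes at
q^{δ_i}. -/
theorem det_eval_stair (hq0 : q ≠ 0) (N : ℕ) :
    (Matrix.of fun i j : Fin N => (columnPoly q u N (stair N j)).eval (q ^ stair N i)).det =
      ∏ i, (columnPoly q u N (stair N i)).eval (q ^ stair N i) := by
  refine Matrix.det_of_isUpperTriangular fun i j hij => ?_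
  have h : (j : ℕ) < i := hij
  have := i.2
  rw [Matrix.of_apply, eval_columnPoly hq0,
    Finset.prod_eq_zero (i := stair N i) (Finset.mem_range.2 (by simp only [stair]; omega)) (by simp),
    zero_mul]

/-- Both sides are the product of 1 - u q^e for e from -i to r + N - 2 - i, cut at e = 0 on the left
and at e = r - i on the right. The contents of row i are -i, ..., r - i - 1. -/
theorem prod_contents (q u : K) (r i : ℕ) {N : ℕ} (hi : i < N) :
    (∏ a ∈ Finset.range (r + (N - 1 - i)), (1 - u * q ^ a)) *
        ∏ s ∈ Finset.Ico (N - 1 - i) (N - 1), (1 - u * q ^ (((N - 1 - i : ℕ) : ℤ) - 1 - s)) =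
      (∏ j ∈ Finset.range r, (1 - u * q ^ ((j : ℤ) - i))) *
        ∏ s ∈ Finset.range (N - 1), (1 - u * q ^ (((r + (N - 1 - i) : ℕ) : ℤ) - 1 - s)) := by
  have h1 : ∏ s ∈ Finset.Ico (N - 1 - i) (N - 1), (1 - u * q ^ (((N - 1 - i : ℕ) : ℤ) - 1 - s)) =
      ∏ x ∈ Finset.range i, (1 - u * q ^ ((x : ℤ) - i)) := by
    rw [Finset.prod_Ico_eq_prod_range, show N - 1 - (N - 1 - i) = i by omega,
      ← Finset.prod_range_reflect]
    refine Finset.prod_congr rfl fun x hx => ?_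
    have := Finset.mem_range.1 hx
    congr 3
    omega
  have h2 : ∏ s ∈ Finset.range (N - 1), (1 - u * q ^ (((r + (N - 1 - i) : ℕ) : ℤ) - 1 - s)) =
      ∏ x ∈ Finset.range (N - 1), (1 - u * q ^ (((r + x : ℕ) : ℤ) - i)) := by
    rw [← Finset.prod_range_reflect]
    refine Finset.prod_congr rfl fun x hx => ?_
    have := Finset.mem_range.1 hx
    congr 3
    omega
  have h3 : ∏ a ∈ Finset.range (r + (N - 1 - i)), (1 - u * q ^ a) =
      ∏ a ∈ Finset.range (r + (N - 1 - i)), (1 - u * q ^ (((i + a : ℕ) : ℤ) - i)) := by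
    refine Finset.prod_congr rfl fun x hx => ?_
    rw [Nat.cast_add, add_sub_cancel_left, zpow_natCast]
  rw [h1, h2, h3, mul_comm, ← Finset.prod_range_add (fun x => 1 - u * q ^ ((x : ℤ) - i)),
    ← Finset.prod_range_add (fun x => 1 - u * q ^ ((x : ℤ) - i))]
  congr 2
  omega

end HookContent

/-! ### Hook lengths and differences of shifted row lengths -/

section Hooks

variable {lam : YoungDiagram} {M : Type*} [CommMonoid M] (f : ℕ → M)

/-- The hook lengths of row i and the differences l_i - l_j for j > i together are the numbers 1,
..., l_i, each occurring once. -/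
theorem prod_hooks_row (i : Fin (lam.colLen 0)) :
    ∏ a ∈ Finset.range (shiftedRow lam i), f (a + 1) =
      (∏ j ∈ Finset.range (lam.rowLen i), f (hookLength lam (i, j))) *
        ∏ j ∈ Finset.Ioi i, f (shiftedRow lam i - shiftedRow lam j) := by
  classical
  have hmem : ∀ a b : ℕ, b < lam.rowLen a ↔ a < lam.colLen b := fun a b => by
    rw [← YoungDiagram.mem_iff_lt_rowLen, YoungDiagram.mem_iff_lt_colLen]
  have hle : ∀ b, lam.colLen b ≤ lam.colLen 0 := fun b => lam.colLen_anti 0 b b.zero_le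
  have hi := i.2
  have hA : Set.InjOn (fun j => hookLength lam (i, j)) (Finset.range (lam.rowLen i)) := by
    intro a ha b hb hab
    have ha := Finset.mem_range.1 ha
    have hb := Finset.mem_range.1 hb
    have ha' := (hmem _ _).1 ha
    have hb' := (hmem _ _).1 hb
    simp only [hookLength] at hab
    rcases lt_trichotomy a b with h | h | h
    · have := lam.colLen_anti a b h.le
      omega
    · exact h
    · have := lam.colLen_anti b a h.le
      omega
  have hB : Set.InjOn (fun j => shiftedRow lam i - shiftedRow lam j) (Finset.Ioi i) := by
    intro a ha b hb hab
    have ha := shiftedRow_lt (Finset.mem_Ioi.1 ha)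
    have hb := shiftedRow_lt (Finset.mem_Ioi.1 hb)
    apply shiftedRow_injective (lam := lam)
    simp only at hab
    omega
  have hdisj : Disjoint ((Finset.range (lam.rowLen i)).image fun j => hookLength lam (i, j))
      ((Finset.Ioi i).image fun j => shiftedRow lam i - shiftedRow lam j) := by
    rw [Finset.disjoint_left]
    intro x hx hx'
    obtain ⟨j, hj, rfl⟩ := Finset.mem_image.1 hx
    obtain ⟨k, hk, h⟩ := Finset.mem_image.1 hx'
    have hj := Finset.mem_range.1 hj
    have hj' := (hmem _ _).1 hj
    have hk := Finset.mem_Ioi.1 hk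
    have hk' := shiftedRow_lt hk
    have hk'' : (i : ℕ) < k := hk
    have := k.2
    have := hle j
    have hc := hmem k j
    simp only [hookLength, shiftedRow, stair] at h hk'
    -- Equality would mean λ'_j - 1 - k = j - λ_k, with rows and columns counted from 0. If the cell
    -- (k, j) is in λ, the left side is nonnegative and the right negative; otherwise it is the
    -- reverse.
    by_cases hjk : j < lam.rowLen k
    · have := hc.1 hjk
      omega
    · have : ¬ (k : ℕ) < lam.colLen j := fun h => hjk (hc.2 h)
      omega
  have hunion : ((Finset.range (lam.rowLen i)).image fun j => hookLength lam (i, j)) ∪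
      ((Finset.Ioi i).image fun j => shiftedRow lam i - shiftedRow lam j) =
        Finset.Icc 1 (shiftedRow lam i) := by
    apply Finset.eq_of_subset_of_card_le
    · refine Finset.union_subset ?_ ?_ <;> intro x hx <;> obtain ⟨j, hj, rfl⟩ := Finset.mem_image.1 hx
      · have hj := Finset.mem_range.1 hj
        have hj' := (hmem _ _).1 hj
        have := hle j
        simp only [hookLength, shiftedRow, stair, Finset.mem_Icc]
        omega
      · have := shiftedRow_lt (Finset.mem_Ioi.1 hj)
        rw [Finset.mem_Icc]
        omega
    · rw [Finset.card_union_of_disjoint hdisj, Finset.card_image_of_injOn hA,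
        Finset.card_image_of_injOn hB, Finset.card_range, Fin.card_Ioi, Nat.card_Icc]
      simp only [shiftedRow, stair]
      omega
  rw [← Finset.prod_image (f := f) hA, ← Finset.prod_image (f := f) hB,
    ← Finset.prod_union hdisj, hunion, Finset.range_eq_Ico, Finset.prod_Ico_add' f,
    ← Finset.Ico_add_one_right_eq_Icc]

theorem prod_stair_sub {N : ℕ} (i : Fin N) :
    ∏ s ∈ Finset.range (stair N i), f (stair N i - s) =
      ∏ j ∈ Finset.Ioi i, f (stair N i - stair N j) := by
  symm
  refine Finset.prod_bij (fun j _ => stair N j) ?_ ?_ ?_ fun _ _ => rfl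
  · intro j hj
    have h := Fin.lt_def.1 (Finset.mem_Ioi.1 hj)
    have := j.2
    rw [Finset.mem_range]
    simp only [stair]
    omega
  · intro a _ b _ h
    have := a.2
    have := b.2
    simp only [stair] at h
    omega
  · intro s hs
    have hs := Finset.mem_range.1 hs
    simp only [stair] at hs
    refine ⟨⟨N - 1 - s, by omega⟩, ?_, ?_⟩
    · rw [Finset.mem_Ioi, Fin.lt_def]
      simp only
      omega
    · simp only [stair]
      omega

theorem prod_cells (g : ℕ × ℕ → M) :
    ∏ x ∈ lam.cells, g x =
      ∏ i : Fin (lam.colLen 0), ∏ j ∈ Finset.range (lam.rowLen i), g (i, j) := by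
  rw [Fin.prod_univ_eq_prod_range fun i => ∏ j ∈ Finset.range (lam.rowLen i), g (i, j),
    Finset.prod_sigma']
  refine Finset.prod_bij' (fun x _ => ⟨x.1, x.2⟩) (fun x _ => (x.1, x.2)) ?_ ?_ ?_ ?_ ?_
  · intro x hx
    rw [YoungDiagram.mem_cells] at hx
    simp only [Finset.mem_sigma, Finset.mem_range]
    refine ⟨?_, YoungDiagram.mem_iff_lt_rowLen.1 hx⟩
    exact (YoungDiagram.mem_iff_lt_colLen.1 hx).trans_le (lam.colLen_anti 0 _ (Nat.zero_le _))
  · intro x hx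
    simp only [Finset.mem_sigma, Finset.mem_range] at hx
    rw [YoungDiagram.mem_cells]
    exact YoungDiagram.mem_iff_lt_rowLen.2 hx.2
  all_goals simp

end Hooks

/-- Row j, counted from 0, is the lower one in j pairs of rows. This is the source of the exponent
n(λ). -/
theorem prod_pow_shiftedRow {K : Type*} [CommMonoid K] (q : K) (lam : YoungDiagram) :
    ∏ i : Fin (lam.colLen 0), ∏ j ∈ Finset.Ioi i, q ^ shiftedRow lam j =
      q ^ nStat lam * ∏ i : Fin (lam.colLen 0), ∏ j ∈ Finset.Ioi i, q ^ stair _ j := by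
  have h : ∏ i : Fin (lam.colLen 0), ∏ j ∈ Finset.Ioi i, q ^ lam.rowLen j = q ^ nStat lam := by
    rw [Finset.prod_comm' (t' := Finset.univ) (s' := fun j => Finset.Iio j) (by simp), nStat,
      ← Fin.sum_univ_eq_sum_range fun i => i * lam.rowLen i, ← Finset.prod_pow_eq_pow_sum]
    refine Finset.prod_congr rfl fun j _ => ?_
    rw [Finset.prod_const, Fin.card_Iio, ← pow_mul, mul_comm]
  rw [← h, ← Finset.prod_mul_distrib]
  refine Finset.prod_congr rfl fun i _ => ?_
  rw [← Finset.prod_mul_distrib]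
  refine Finset.prod_congr rfl fun j _ => ?_
  rw [shiftedRow, pow_add]

/-! ### Closed form of the Jacobi-Trudi determinant -/

section JacobiTrudi

variable {K : Type*} [Field K] {q u : K}

theorem det_vandermonde_shiftedRow (q : K) (lam : YoungDiagram) :
    (Matrix.vandermonde fun i => q ^ shiftedRow lam i).det =
      (q ^ nStat lam * ∏ i : Fin (lam.colLen 0), ∏ j ∈ Finset.Ioi i, q ^ stair _ j) *
        ∏ i, ∏ j ∈ Finset.Ioi i, (1 - q ^ (shiftedRow lam i - shiftedRow lam j)) := by
  rw [Matrix.det_vandermonde, ← prod_pow_shiftedRow, ← Finset.prod_mul_distrib]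
  refine Finset.prod_congr rfl fun i _ => ?_
  rw [← Finset.prod_mul_distrib]
  refine Finset.prod_congr rfl fun j hj => ?_
  rw [mul_sub, mul_one, ← pow_add, Nat.add_sub_cancel' (shiftedRow_lt (Finset.mem_Ioi.1 hj)).le]

theorem det_vandermonde_stair (q : K) (N : ℕ) :
    (Matrix.vandermonde fun i => q ^ stair N i).det =
      (∏ i : Fin N, ∏ j ∈ Finset.Ioi i, q ^ stair N j) *
        ∏ i, ∏ j ∈ Finset.Ioi i, (1 - q ^ (stair N i - stair N j)) := by
  rw [Matrix.det_vandermonde, ← Finset.prod_mul_distrib]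
  refine Finset.prod_congr rfl fun i _ => ?_
  rw [← Finset.prod_mul_distrib]
  refine Finset.prod_congr rfl fun j hj => ?_
  have h := Fin.lt_def.1 (Finset.mem_Ioi.1 hj)
  rw [mul_sub, mul_one, ← pow_add, Nat.add_sub_cancel' (by simp only [stair]; omega)]

theorem det_shiftCoeff_mul (hq0 : q ≠ 0) (hq : ∀ l, 0 < l → 1 - q ^ l ≠ 0) {H : PowerSeries K}
    (hH : ∀ m, PowerSeries.coeff m H = pochRatio q u m) {N : ℕ} (l : Fin N → ℕ) :
    (Matrix.of fun i j => shiftCoeff H (l i) (stair N j)).det *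
        ∏ i, ∏ s ∈ Finset.range (N - 1), (1 - u * q ^ ((l i : ℤ) - 1 - s)) =
      (∏ i, pochRatio q u (l i)) *
        (Matrix.of fun i j => (columnPoly q u N (stair N j)).eval (q ^ l i)).det := by
  rw [← Matrix.det_mul_column, mul_comm, ← Matrix.det_mul_column]
  congr 1
  ext i j
  have hk : stair N j < N := by
    have := j.2
    simp only [stair]
    omega
  rw [Matrix.of_apply, Matrix.of_apply, Matrix.of_apply, Matrix.of_apply,
    ← shiftCoeff_mul_prod hq0 hq hH hk, mul_comm]

/-- The hook-content formula. -/
theorem det_shiftCoeff_eq_hookContent (hq0 : q ≠ 0) (hq : ∀ l, 0 < l → 1 - q ^ l ≠ 0)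
    (hu : ∀ k : ℤ, 1 - u * q ^ k ≠ 0) {H : PowerSeries K}
    (hH : ∀ m, PowerSeries.coeff m H = pochRatio q u m) (lam : YoungDiagram) :
    (Matrix.of fun i j => shiftCoeff H (shiftedRow lam i) (stair (lam.colLen 0) j)).det =
      q ^ nStat lam * ∏ x ∈ lam.cells, (1 - u * q ^ content x) / (1 - q ^ hookLength lam x) := by
  have hlt : ∀ i : Fin (lam.colLen 0), stair _ i < lam.colLen 0 := fun i => by
    have := i.2
    simp only [stair]
    omega
  have h1 := det_shiftCoeff_mul hq0 hq hH (shiftedRow lam)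
  have h2 := det_eval_mul_det_vandermonde (fun j : Fin (lam.colLen 0) => columnPoly q u _ (stair _ j))
    (fun j => natDegree_columnPoly_lt q u (hlt j)) (fun i => q ^ shiftedRow lam i)
    (fun i => q ^ stair _ i)
  rw [det_eval_stair hq0, det_vandermonde_shiftedRow, det_vandermonde_stair] at h2
  simp only [eval_columnPoly hq0] at h2
  rw [Finset.prod_mul_distrib] at h2
  -- Part of the diagonal at q^δ cancels the Vandermonde determinant of q^δ. The rest combines with
  -- the numerators of the row factors into contents, and their denominators with the other
  -- Vandermonde determinant into hooks.
  have hE : ∏ i : Fin (lam.colLen 0), ∏ s ∈ Finset.range (stair _ i), (1 - q ^ ((stair _ i : ℤ) - s)) =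
      ∏ i : Fin (lam.colLen 0), ∏ j ∈ Finset.Ioi i, (1 - q ^ (stair _ i - stair _ j)) := by
    refine Finset.prod_congr rfl fun i _ => ?_
    rw [← prod_stair_sub fun x => 1 - q ^ x]
    refine Finset.prod_congr rfl fun s hs => ?_
    rw [← zpow_natCast, Nat.cast_sub (Finset.mem_range.1 hs).le]
  have hC : (∏ i : Fin (lam.colLen 0), ∏ a ∈ Finset.range (shiftedRow lam i), (1 - u * q ^ a)) *
      ∏ i : Fin (lam.colLen 0), ∏ s ∈ Finset.Ico (stair _ i) (lam.colLen 0 - 1), (1 - u * q ^ ((stair _ i : ℤ) - 1 - s)) =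
      (∏ x ∈ lam.cells, (1 - u * q ^ content x)) *
        ∏ i : Fin (lam.colLen 0), ∏ s ∈ Finset.range (lam.colLen 0 - 1),
          (1 - u * q ^ ((shiftedRow lam i : ℤ) - 1 - s)) := by
    rw [prod_cells, ← Finset.prod_mul_distrib, ← Finset.prod_mul_distrib]
    exact Finset.prod_congr rfl fun i _ => prod_contents q u _ _ i.2
  have hD : ∏ i : Fin (lam.colLen 0), ∏ a ∈ Finset.range (shiftedRow lam i), (1 - q ^ (a + 1)) =
      (∏ x ∈ lam.cells, (1 - q ^ hookLength lam x)) *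
        ∏ i : Fin (lam.colLen 0), ∏ j ∈ Finset.Ioi i, (1 - q ^ (shiftedRow lam i - shiftedRow lam j)) := by
    rw [prod_cells, ← Finset.prod_mul_distrib]
    exact Finset.prod_congr rfl fun i _ => prod_hooks_row (fun x => 1 - q ^ x) i
  have hR : ∏ i : Fin (lam.colLen 0), pochRatio q u (shiftedRow lam i) =
      (∏ i : Fin (lam.colLen 0), ∏ a ∈ Finset.range (shiftedRow lam i), (1 - u * q ^ a)) /
        ∏ i : Fin (lam.colLen 0), ∏ a ∈ Finset.range (shiftedRow lam i), (1 - q ^ (a + 1)) := by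
    rw [← Finset.prod_div_distrib]
    exact Finset.prod_congr rfl fun i _ => Finset.prod_div_distrib ..
  have nD : ∏ i : Fin (lam.colLen 0), ∏ a ∈ Finset.range (shiftedRow lam i), (1 - q ^ (a + 1)) ≠ 0 :=
    Finset.prod_ne_zero_iff.2 fun i _ => Finset.prod_ne_zero_iff.2 fun a _ => hq _ a.succ_pos
  have nE : ∏ i : Fin (lam.colLen 0), ∏ j ∈ Finset.Ioi i, (1 - q ^ (stair _ i - stair _ j)) ≠ 0 := by
    refine Finset.prod_ne_zero_iff.2 fun i _ => Finset.prod_ne_zero_iff.2 fun j hj => hq _ ?_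
    have h := Fin.lt_def.1 (Finset.mem_Ioi.1 hj)
    have := j.2
    simp only [stair]
    omega
  have nQ : ∏ i : Fin (lam.colLen 0), ∏ j ∈ Finset.Ioi i, q ^ stair _ j ≠ 0 :=
    Finset.prod_ne_zero_iff.2 fun i _ => Finset.prod_ne_zero_iff.2 fun j _ => pow_ne_zero _ hq0
  have nP : ∏ i : Fin (lam.colLen 0), ∏ s ∈ Finset.range (lam.colLen 0 - 1),
      (1 - u * q ^ ((shiftedRow lam i : ℤ) - 1 - s)) ≠ 0 :=
    Finset.prod_ne_zero_iff.2 fun i _ => Finset.prod_ne_zero_iff.2 fun s _ => hu _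
  rw [hE] at h2
  rw [hR] at h1
  rw [Finset.prod_div_distrib]
  rw [hD] at nD h1
  generalize (∏ i : Fin (lam.colLen 0), ∏ j ∈ Finset.Ioi i,
    (1 - q ^ (shiftedRow lam i - shiftedRow lam j))) = D at *
  generalize (∏ x ∈ lam.cells, (1 - q ^ hookLength lam x)) = X at *
  have nX := left_ne_zero_of_mul nD
  have nD' := right_ne_zero_of_mul nD
  rw [← mul_div_assoc, eq_div_iff nX]
  apply mul_right_cancel₀ nP
  apply mul_right_cancel₀ (mul_ne_zero nQ nE)
  rw [div_mul_eq_mul_div, eq_div_iff nD] at h1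
  apply mul_right_cancel₀ nD'
  simp only [eval_columnPoly hq0] at h1
  linear_combination ((∏ i : Fin (lam.colLen 0), ∏ j ∈ Finset.Ioi i, q ^ stair _ j) *
      ∏ i : Fin (lam.colLen 0), ∏ j ∈ Finset.Ioi i, (1 - q ^ (stair _ i - stair _ j))) * h1 +
    (∏ i : Fin (lam.colLen 0), ∏ a ∈ Finset.range (shiftedRow lam i), (1 - u * q ^ a)) * h2 +
    (∏ i : Fin (lam.colLen 0), ∏ j ∈ Finset.Ioi i, (1 - q ^ (stair _ i - stair _ j))) *
      q ^ nStat lam * (∏ i : Fin (lam.colLen 0), ∏ j ∈ Finset.Ioi i, q ^ stair _ j) * D * hC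

end JacobiTrudi

/-! ### The hook-content formulas -/

theorem det_shiftCoeff_eq_hookContent_neg {K : Type*} [Field K] {q t : K} (hq0 : q ≠ 0)
    (hq : ∀ l, 0 < l → 1 - q ^ l ≠ 0) (ht : ∀ k : ℤ, 1 + t * q ^ k ≠ 0) {H : PowerSeries K}
    (hH : ∀ m, PowerSeries.coeff m H = pochRatio q (-t) m) (lam : YoungDiagram) :
    (Matrix.of fun i j => shiftCoeff H (shiftedRow lam i) (stair (lam.colLen 0) j)).det =
      q ^ nStat lam * ∏ x ∈ lam.cells, (1 + t * q ^ content x) / (1 - q ^ hookLength lam x) := by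
  rw [det_shiftCoeff_eq_hookContent hq0 hq (fun k => by simpa using ht k) hH lam]
  simp only [neg_mul, sub_neg_eq_add]

section HookContentSeries

theorem cycleProd_inv {n : ℕ} {R : Type*} [CommRing R] (p : ℕ → R) (w : Equiv.Perm (Fin n)) :
    cycleProd p w⁻¹ = cycleProd p w := by
  simpa using cycleProd_conj p 1 w

/-- The power sums of the substitution that computes multiplicities in mixed forms. -/
noncomputable def mixedPowerSum (l : ℕ) : QTField := (1 - (-t) ^ l) / (1 - q ^ l)

theorem exists_mixedSeries : ∃ H : PowerSeries QTField, IsPowerSumExp mixedPowerSum H ∧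
    ∀ m, PowerSeries.coeff m H = pochRatio q (-t) m := by
  have h := isPowerSumExp_cycleIndex mixedPowerSum
  exact ⟨_, h, coeff_eq_pochRatio (fun l hl => one_sub_q_pow_ne_zero hl) h⟩

theorem average_spechtCharacter {n : ℕ} {lam : YoungDiagram} (T : Fin n ≃ lam.cells) :
    algebraMap ℚ QTField (n.factorial : ℚ)⁻¹ * ∑ w : Equiv.Perm (Fin n),
      algebraMap ℚ QTField (frobChar (shiftedRow lam) w) * cycleProd mixedPowerSum w =
        hookContentProduct lam := by
  obtain ⟨H, hH, hc⟩ := exists_mixedSeries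
  have h := average_frobChar_mul_cycleProd hH (shiftedRow lam) (sum_shiftedRow T)
  exact h.trans (det_shiftCoeff_eq_hookContent_neg q_ne_zero
    (fun l hl => one_sub_q_pow_ne_zero hl) one_add_t_mul_q_zpow_ne_zero hc lam)

variable {n : ℕ} {lam : YoungDiagram} (T : Fin n ≃ lam.cells) {M : Type*} [AddCommGroup M]
  [Module ℂ M] [FiniteDimensional ℂ M] (σ : Representation ℂ (Equiv.Perm (Fin n)) M)

theorem multSeries_weyl (hn : 1 ≤ n) :
    multSeries (weylARep n) σ = (1 - q) / (1 + t) * multSeries (permRep n) σ :=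
  hilb_weyl σ.dual hn

theorem multSeries_perm_specht (hn : 1 ≤ n) (h : σ.character = spechtCharacter T) :
    multSeries (permRep n) σ = hookContentProduct lam := by
  rw [← average_spechtCharacter T]
  refine hilb_perm σ.dual hn (frobChar (shiftedRow lam)) fun w => ?_
  rw [Representation.char_dual, h, spechtCharacter_eq_frobChar, frobChar, frobChar, cycleProd_inv]

end HookContentSeries

/-! ### The characters of the exterior powers of `V` -/

section ExteriorPowers

variable {n : ℕ}

/-- The generating polynomial of the traces of `w` on the exterior powers of `ℂ^n`. -/
noncomputable def extPoly (w : Equiv.Perm (Fin n)) : Polynomial ℚ :=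
  cycleProd (fun l => 1 - (-Polynomial.X) ^ l) w

/-- The trace of `w` on the exterior powers of `V`. -/
noncomputable def extChar (w : Equiv.Perm (Fin n)) : ℕ → ℚ
  | 0 => (extPoly w).coeff 0
  | r + 1 => (extPoly w).coeff (r + 1) - extChar w r

theorem extPoly_inv (w : Equiv.Perm (Fin n)) : extPoly w⁻¹ = extPoly w := cycleProd_inv _ w

theorem extChar_inv (w : Equiv.Perm (Fin n)) (r : ℕ) : extChar w⁻¹ r = extChar w r := by
  induction r with
  | zero => rw [extChar, extChar, extPoly_inv]
  | succ r ih => rw [extChar, extChar, extPoly_inv, ih]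

/-- The eigenvalues on ℂ^n are those on V together with 1, so the generating polynomial of exterior
traces acquires the factor 1 + X. Comparing coefficients gives the recursion that defines `extChar`.
-/
theorem extPowerRep_weyl_character (hn : 1 ≤ n) (w : Equiv.Perm (Fin n)) (r : ℕ) :
    (extPowerRep (weylARep n) r).character w = (extChar w r : ℂ) := by
  obtain ⟨b, μ, h⟩ := exists_eigenbasis (weylARep n w) (m := orderOf w) (orderOf_pos w).ne'
    (by rw [← map_pow, pow_orderOf_eq_one, map_one])
  have hm := finrank_weyl hn
  -- The dual basis has the same eigenvalues for the inverse of w, which transfers the comparison of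
  -- eigenvalues from the dual spaces.
  have hd : ∀ i, (weylARep n).dual w⁻¹ (b.dualBasis i) = μ i • b.dualBasis i := by
    intro i
    refine b.ext fun j => ?_
    change b.dualBasis i (weylARep n w⁻¹⁻¹ (b j)) = _
    rw [inv_inv, h, map_smul, LinearMap.smul_apply, Module.Basis.dualBasis_apply_self]
    split_ifs with hij
    · rw [hij]
    · simp
  obtain ⟨b', h'⟩ := exists_eigenbasis_perm hn w⁻¹ (by omega) b.dualBasis μ hd
  have h1 := prod_one_add_eigenvalues w⁻¹ _ (permRep_dual_power_sums n w⁻¹ b' _ h')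
  rw [cycleProd_inv, Fin.prod_univ_succ] at h1
  simp only [Fin.cons_zero, Fin.cons_succ, map_one, one_mul] at h1
  have h2 : (extPoly w).map (algebraMap ℚ ℂ) =
      cycleProd (fun l => (1 - (-Polynomial.X) ^ l : Polynomial ℂ)) w := by
    rw [extPoly, ← Polynomial.coe_mapRingHom, cycleProd_map]
    simp
  rw [← h2] at h1
  rw [extPowerRep_trace _ w b μ h]
  induction r with
  | zero =>
    have h3 := congrArg (fun p => Polynomial.coeff p 0) h1
    simp only [Polynomial.mul_coeff_zero, Polynomial.coeff_map] at h3
    simpa [extChar] using h3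
  | succ r ih =>
    have h3 := congrArg (fun p => Polynomial.coeff p (r + 1)) h1
    simp only [add_mul, one_mul, Polynomial.coeff_add, Polynomial.coeff_X_mul,
      Polynomial.coeff_map] at h3
    rw [ih] at h3
    rw [extChar, Rat.cast_sub]
    exact eq_sub_iff_add_eq.2 (h3.trans (by simp))

theorem extPowerRep_weyl_dual_character (hn : 1 ≤ n) (w : Equiv.Perm (Fin n)) (r : ℕ) :
    (extPowerRep (weylARep n) r).dual.character w = (extChar w r : ℂ) := by
  rw [Representation.char_dual, extPowerRep_weyl_character hn, extChar_inv]

theorem hilb_perm_extPowerRep (hn : 1 ≤ n) (r : ℕ) :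
    hilb (permRep n) (extPowerRep (weylARep n) r) =
      algebraMap ℚ QTField (n.factorial : ℚ)⁻¹ * ∑ w : Equiv.Perm (Fin n),
        algebraMap ℚ QTField (extChar w r) * cycleProd mixedPowerSum w :=
  hilb_perm _ hn (fun w => extChar w r) fun w => extPowerRep_weyl_character hn w r

/-- A permutation and its inverse have the same exterior traces, so ⋀^r V and its dual have the same
character. -/
theorem multSeries_weyl_extPowerRep (hn : 1 ≤ n) (r : ℕ) :
    multSeries (weylARep n) (extPowerRep (weylARep n) r) =
      hilb (weylARep n) (extPowerRep (weylARep n) r) := by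
  rw [multSeries, hilb_weyl _ hn, hilb_weyl _ hn, hilb_perm_extPowerRep hn]
  congr 1
  exact hilb_perm _ hn (fun w => extChar w r) fun w => extPowerRep_weyl_dual_character hn w r

end ExteriorPowers

/-! ### Averages of the exterior characters of ℂ^n -/

section Evaluation

variable {K : Type*} [Field K] [Algebra ℚ K] {q t : K}

/-- Negated power sums give the reciprocal series, with H(z)(1 + tz) = H(qz)(1 - z). The
coefficients follow as in the q-binomial theorem. -/
theorem coeff_eq_prod_add (hq : ∀ l, 0 < l → 1 - q ^ l ≠ 0) {H : PowerSeries K}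
    (hH : IsPowerSumExp (fun l => -((1 - (-t) ^ l) / (1 - q ^ l))) H) (m : ℕ) :
    PowerSeries.coeff m H = (-1) ^ m * ∏ i ∈ Finset.range m, (t + q ^ i) / (1 - q ^ (i + 1)) := by
  have h1 : H * (1 - PowerSeries.C (-t) * PowerSeries.X) =
      PowerSeries.rescale q H * (1 - PowerSeries.C 1 * PowerSeries.X) := by
    refine (hH.mul (IsPowerSumExp.linear (-t))).unique ((hH.rescale q).mul (IsPowerSumExp.linear 1))
      fun l => ?_
    have := hq (l + 1) l.succ_pos
    simp only [Pi.add_apply]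
    field_simp
    ring
  induction m with
  | zero =>
    rw [PowerSeries.coeff_zero_eq_constantCoeff_apply, hH.const]
    simp
  | succ m ih =>
    have h2 := congrArg (PowerSeries.coeff (m + 1)) h1
    rw [mul_sub, mul_sub, map_sub, map_sub, mul_one, mul_one, ← mul_assoc, ← mul_assoc,
      PowerSeries.coeff_succ_mul_X, PowerSeries.coeff_succ_mul_X, PowerSeries.coeff_mul_C,
      PowerSeries.coeff_mul_C, PowerSeries.coeff_rescale, PowerSeries.coeff_rescale, ih] at h2
    rw [Finset.prod_range_succ, ← mul_div_assoc, ← mul_div_assoc, eq_div_iff (hq (m + 1) m.succ_pos)]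
    rw [pow_succ (-1 : K)]
    linear_combination h2

/-- The average of the elementary symmetric functions of the eigenvalues on `ℂ^n`. -/
theorem average_extPoly_coeff (hq : ∀ l, 0 < l → 1 - q ^ l ≠ 0) {n r : ℕ} (hr : r ≤ n) :
    algebraMap ℚ K (n.factorial : ℚ)⁻¹ * ∑ w : Equiv.Perm (Fin n),
      algebraMap ℚ K ((extPoly w).coeff r) *
        cycleProd (fun l => (1 - (-t) ^ l) / (1 - q ^ l)) w =
      pochRatio q (-t) (n - r) * ∏ i ∈ Finset.range r, (t + q ^ i) / (1 - q ^ (i + 1)) := by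
  set p : ℕ → K := fun l => (1 - (-t) ^ l) / (1 - q ^ l) with hp
  have h1 := isPowerSumExp_cycleIndex p
  have h2 := isPowerSumExp_cycleIndex fun l => -p l
  have h3 := isPowerSumExp_cycleIndex fun l =>
    Polynomial.C (p l) * (1 - (-Polynomial.X) ^ l : Polynomial K)
  set H := PowerSeries.mk fun n =>
    (n.factorial : ℚ)⁻¹ • ∑ w : Equiv.Perm (Fin n), cycleProd p w with hH
  set H' := PowerSeries.mk fun n =>
    (n.factorial : ℚ)⁻¹ • ∑ w : Equiv.Perm (Fin n), cycleProd (fun l => -p l) w with hH'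
  -- With s the polynomial variable, the power sums p_l (1 - (-s)^l) belong to H(z) H'(-sz). The
  -- coefficient of s^r z^n is a single product.
  have h4 := h3.unique ((h1.map Polynomial.C).mul ((h2.map Polynomial.C).rescale (-Polynomial.X)))
    fun l => by
      simp only [Pi.add_apply, map_neg]
      ring
  have h5 := congrArg (fun s => Polynomial.coeff (PowerSeries.coeff n s) r) h4
  simp only [PowerSeries.coeff_mk, PowerSeries.coeff_mul, PowerSeries.coeff_map,
    PowerSeries.coeff_rescale, Polynomial.finsetSum_coeff] at h5
  have h6 : ∀ x ∈ Finset.HasAntidiagonal.antidiagonal n,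
      (Polynomial.C (PowerSeries.coeff x.1 H) * ((-Polynomial.X) ^ x.2 *
        Polynomial.C (PowerSeries.coeff x.2 H'))).coeff r =
      if x = (n - r, r) then pochRatio q (-t) (n - r) *
        ∏ i ∈ Finset.range r, (t + q ^ i) / (1 - q ^ (i + 1)) else 0 := by
    intro x hx
    have hx := Finset.HasAntidiagonal.mem_antidiagonal.1 hx
    have e : (-Polynomial.X : Polynomial K) ^ x.2 =
        Polynomial.C ((-1) ^ x.2) * Polynomial.X ^ x.2 := by
      rw [neg_pow, map_pow, map_neg, map_one]
    rw [e, Polynomial.coeff_C_mul, Polynomial.coeff_mul_C, Polynomial.coeff_C_mul,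
      Polynomial.coeff_X_pow]
    by_cases h : r = x.2
    · have hx' : x = (n - r, r) := Prod.ext (by simp only; omega) h.symm
      rw [if_pos h, if_pos hx', hx', coeff_eq_pochRatio hq h1, coeff_eq_prod_add hq h2]
      have : ((-1 : K) ^ r) * (-1) ^ r = 1 := by rw [← mul_pow]; simp
      linear_combination (pochRatio q (-t) (n - r) *
        ∏ i ∈ Finset.range r, (t + q ^ i) / (1 - q ^ (i + 1))) * this
    · rw [if_neg h, if_neg fun h' => h (by rw [h'])]
      simp
  rw [Finset.sum_congr rfl h6, Finset.sum_ite_eq', if_pos (by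
    rw [Finset.HasAntidiagonal.mem_antidiagonal]; simp only; omega)] at h5
  rw [← h5, Algebra.smul_def, Polynomial.algebraMap_apply, Polynomial.coeff_C_mul,
    Polynomial.finsetSum_coeff]
  congr 1
  refine Finset.sum_congr rfl fun w _ => ?_
  rw [cycleProd_mul, ← cycleProd_map Polynomial.C, Polynomial.coeff_C_mul, mul_comm]
  congr 1
  have h7 : (extPoly w).map (algebraMap ℚ K) =
      cycleProd (fun l => (1 - (-Polynomial.X) ^ l : Polynomial K)) w := by
    rw [extPoly, ← Polynomial.coe_mapRingHom, cycleProd_map]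
    simp
  rw [← h7, Polynomial.coeff_map]

end Evaluation

/-! ### The recursion for the exterior powers of V -/

section Recursion

variable {K : Type*} [Field K] {q t : K}

theorem eq_of_two_term_recursion (hq : ∀ l, 0 < l → 1 - q ^ l ≠ 0) {n : ℕ} (hn : 1 ≤ n)
    {A : ℕ → K} (h0 : A 0 = pochRatio q (-t) n)
    (h : ∀ r, r + 1 ≤ n → A (r + 1) + A r = pochRatio q (-t) (n - (r + 1)) *
      ∏ i ∈ Finset.range (r + 1), (t + q ^ i) / (1 - q ^ (i + 1)))
    {r : ℕ} (hr : r ≤ n - 1) :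
    A r = (∏ i ∈ Finset.range (n - r), (1 + t * q ^ i)) *
        (∏ i ∈ Finset.range r, (t + q ^ (i + 1))) /
      ((∏ i ∈ Finset.range (n - 1 - r), (1 - q ^ (i + 1))) *
        (∏ i ∈ Finset.range r, (1 - q ^ (i + 1))) * (1 - q ^ n)) := by
  have hP : ∀ m, ∏ i ∈ Finset.range m, (1 - q ^ (i + 1)) ≠ 0 := fun m =>
    Finset.prod_ne_zero_iff.2 fun i _ => hq _ i.succ_pos
  have hR : ∀ m, pochRatio q (-t) m = (∏ i ∈ Finset.range m, (1 + t * q ^ i)) /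
      ∏ i ∈ Finset.range m, (1 - q ^ (i + 1)) := fun m => by
    rw [pochRatio, ← Finset.prod_div_distrib]
    simp only [neg_mul, sub_neg_eq_add]
  induction r with
  | zero =>
    obtain ⟨m, rfl⟩ := Nat.exists_eq_add_of_le' hn
    rw [h0, hR, Nat.sub_zero, Nat.sub_zero, Nat.add_sub_cancel, Finset.prod_range_succ (fun i =>
      1 - q ^ (i + 1)) m]
    simp
  | succ r ih =>
    obtain ⟨m, rfl⟩ : ∃ m, n = m + r + 2 := ⟨n - r - 2, by omega⟩
    have ih := ih (by omega)
    have h1 := h r (by omega)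
    rw [show m + r + 2 - r = m + 1 + 1 by omega, show m + r + 2 - 1 - r = m + 1 by omega] at ih
    rw [show m + r + 2 - (r + 1) = m + 1 by omega, hR, Finset.prod_div_distrib,
      Finset.prod_range_succ' (fun i => t + q ^ i)] at h1
    rw [show m + r + 2 - (r + 1) = m + 1 by omega,
      show m + r + 2 - 1 - (r + 1) = m by omega]
    rw [eq_sub_iff_add_eq.2 h1, ih]
    have n1 := hP m
    have n2 := hP r
    have n3 := hq (m + 1) m.succ_pos
    have n4 := hq (r + 1) r.succ_pos
    have n5 := hq (m + r + 2) (by omega)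
    rw [Finset.prod_range_succ _ (m + 1), Finset.prod_range_succ (fun i => 1 - q ^ (i + 1)) m,
      Finset.prod_range_succ (fun i => 1 - q ^ (i + 1)) r,
      Finset.prod_range_succ (fun i => t + q ^ (i + 1)) r]
    generalize (∏ i ∈ Finset.range m, (1 - q ^ (i + 1))) = P1 at *
    generalize (∏ i ∈ Finset.range r, (1 - q ^ (i + 1))) = P2 at *
    generalize (∏ i ∈ Finset.range (m + 1), (1 + t * q ^ i)) = F at *
    generalize (∏ i ∈ Finset.range r, (t + q ^ (i + 1))) = G at *
    -- With x = q^{m+1} and y = q^{r+1} the induction step is (1 + t)(1 - xy) = (1 + tx)(1 - y) + (t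
    -- + y)(1 - x).
    have e : q ^ (m + r + 2) = q ^ (m + 1) * q ^ (r + 1) := by ring
    rw [e] at n5 ⊢
    generalize q ^ (m + 1) = x at *
    generalize q ^ (r + 1) = y at *
    field_simp
    ring

end Recursion

/-! ### The product formula for the exterior powers -/

section ProductFormula

variable {K : Type*} [Field K] {q t : K}

/-- `(z; a)_k` in an arbitrary field. -/
def pochProd (z a : K) (k : ℕ) : K := ∏ i ∈ Finset.range k, (1 - z * a ^ i)

theorem pochProd_self (q : K) (k : ℕ) :
    pochProd q q k = ∏ i ∈ Finset.range k, (1 - q ^ (i + 1)) :=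
  Finset.prod_congr rfl fun i _ => by rw [pow_succ']

/-- The exponent r + r(r-1)/2 is 1 + ... + r, and each q^i is absorbed by the factor 1 + t q^{-i}.
-/
theorem pow_mul_pochProd_inv (hq0 : q ≠ 0) (r : ℕ) :
    q ^ (r + r.choose 2) * pochProd (-t * q⁻¹) q⁻¹ r =
      ∏ i ∈ Finset.range r, (t + q ^ (i + 1)) := by
  induction r with
  | zero => simp [pochProd]
  | succ r ih =>
    have e : r + 1 + (r + 1).choose 2 = (r + r.choose 2) + (r + 1) := by
      rw [Nat.choose_succ_succ, Nat.choose_one_right]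
      ring
    rw [Finset.prod_range_succ, ← ih, e, pow_add, pochProd, Finset.prod_range_succ, ← pochProd]
    have h : q ^ (r + 1) * (1 - -t * q⁻¹ * q⁻¹ ^ r) = t + q ^ (r + 1) := by
      have : q ^ (r + 1) * (q⁻¹ * q⁻¹ ^ r) = 1 := by
        rw [← pow_succ', ← mul_pow, mul_inv_cancel₀ hq0, one_pow]
      linear_combination t * this
    rw [← h]
    ring

/-- The denominator 1 + t cancels the factor i = 0 of the numerator, and 1 - q turns (q;q)_n into
(q²;q)_{n-1}. -/
theorem normalize_exterior_formula (hq0 : q ≠ 0) (hq : ∀ l, 0 < l → 1 - q ^ l ≠ 0)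
    (ht : 1 + t ≠ 0) {n r : ℕ} (hn : 1 ≤ n) (hr : r ≤ n - 1) :
    (1 - q) / (1 + t) * ((∏ i ∈ Finset.range (n - r), (1 + t * q ^ i)) *
        (∏ i ∈ Finset.range r, (t + q ^ (i + 1))) /
      ((∏ i ∈ Finset.range (n - 1 - r), (1 - q ^ (i + 1))) *
        (∏ i ∈ Finset.range r, (1 - q ^ (i + 1))) * (1 - q ^ n))) =
    q ^ (r + r.choose 2) *
      (pochProd q q (n - 1) / (pochProd q q r * pochProd q q (n - 1 - r))) *
        (pochProd (-t * q) q (n - 1 - r) * pochProd (-t * q⁻¹) q⁻¹ r) /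
          pochProd (q ^ 2) q (n - 1) := by
  obtain ⟨m, rfl⟩ : ∃ m, n = m + r + 1 := ⟨n - 1 - r, by omega⟩
  rw [show m + r + 1 - r = m + 1 by omega, show m + r + 1 - 1 - r = m by omega,
    Nat.add_sub_cancel, ← pow_mul_pochProd_inv hq0, pochProd_self, pochProd_self, pochProd_self]
  have hP : ∀ m, ∏ i ∈ Finset.range m, (1 - q ^ (i + 1)) ≠ 0 := fun m =>
    Finset.prod_ne_zero_iff.2 fun i _ => hq _ i.succ_pos
  have h1 : ∏ i ∈ Finset.range (m + 1), (1 + t * q ^ i) = pochProd (-t * q) q m * (1 + t) := by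
    rw [Finset.prod_range_succ', pow_zero, mul_one]
    congr 1
    refine Finset.prod_congr rfl fun i _ => ?_
    ring
  have h2 : (1 - q) * pochProd (q ^ 2) q (m + r) =
      (∏ i ∈ Finset.range (m + r), (1 - q ^ (i + 1))) * (1 - q ^ (m + r + 1)) := by
    rw [← Finset.prod_range_succ (fun i => 1 - q ^ (i + 1)), Finset.prod_range_succ', mul_comm]
    congr 1
    · refine Finset.prod_congr rfl fun i _ => ?_
      ring
    · ring
  have n1 := hP m
  have n2 := hP r
  have n3 := hP (m + r)
  have n4 := hq (m + r + 1) (by omega)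
  have n5 : pochProd (q ^ 2) q (m + r) ≠ 0 := by
    refine Finset.prod_ne_zero_iff.2 fun i _ => ?_
    have := hq (i + 2) (by omega)
    rwa [add_comm, pow_add] at this
  rw [h1]
  generalize (∏ i ∈ Finset.range m, (1 - q ^ (i + 1))) = P1 at *
  generalize (∏ i ∈ Finset.range r, (1 - q ^ (i + 1))) = P2 at *
  generalize (∏ i ∈ Finset.range (m + r), (1 - q ^ (i + 1))) = P3 at *
  generalize pochProd (q ^ 2) q (m + r) = Z at *
  generalize pochProd (-t * q) q m = F at *
  generalize pochProd (-t * q⁻¹) q⁻¹ r = G at *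
  generalize q ^ (m + r + 1) = y at *
  generalize q ^ (r + r.choose 2) = x at *
  field_simp
  linear_combination F * x * G * h2

end ProductFormula

theorem hilb_weyl_extPowerRep {n : ℕ} (hn : 1 ≤ n) {r : ℕ} (hr : r ≤ n - 1) :
    hilb (weylARep n) (extPowerRep (weylARep n) r) =
      q ^ (r + r.choose 2) * qBinomial (n - 1) r *
        (qPochhammer (-t * q) q (n - 1 - r) * qPochhammer (-t * q⁻¹) q⁻¹ r) /
          qPochhammer (q ^ 2) q (n - 1) := by
  have hq : ∀ l, 0 < l → 1 - q ^ l ≠ 0 := fun l hl => one_sub_q_pow_ne_zero hl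
  refine Eq.trans ?_ (normalize_exterior_formula q_ne_zero hq one_add_t_ne_zero hn hr)
  rw [hilb_weyl _ hn]
  refine congrArg _ ((hilb_perm_extPowerRep hn r).trans ?_)
  refine eq_of_two_term_recursion hq hn (A := fun r => algebraMap ℚ QTField (n.factorial : ℚ)⁻¹ *
    ∑ w : Equiv.Perm (Fin n), algebraMap ℚ QTField (extChar w r) * cycleProd mixedPowerSum w)
    ?_ (fun r hr => ?_) hr
  · refine (average_extPoly_coeff (t := t) hq n.zero_le).trans ?_
    rw [Finset.range_zero, Finset.prod_empty, mul_one, Nat.sub_zero]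
  · refine Eq.trans ?_ (average_extPoly_coeff (t := t) hq hr)
    rw [← mul_add, ← Finset.sum_add_distrib]
    congr 1
    refine Finset.sum_congr rfl fun w _ => ?_
    rw [← add_mul, ← map_add, extChar, sub_add_cancel]
    rfl

/-! ### The grading of the symmetric algebra and of its invariants -/

section Grading

variable {V : Type*} [AddCommGroup V] [Module ℂ V]

theorem mem_symPower_iff {ι : Type*} (b : Module.Basis ι ℂ V) (i : ℕ)
    (x : SymmetricAlgebra ℂ V) : x ∈ symPower V i ↔
      SymmetricAlgebra.equivMvPolynomial b x ∈ MvPolynomial.homogeneousSubmodule ι ℂ i := by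
  rw [← map_symPower b i]
  refine ⟨fun h => ⟨x, h, rfl⟩, ?_⟩
  rintro ⟨y, hy, h⟩
  rwa [← (SymmetricAlgebra.equivMvPolynomial b).injective h]

/-- The projection of the symmetric algebra on its component of degree `i`. -/
noncomputable def symComponent (i : ℕ) : SymmetricAlgebra ℂ V →ₗ[ℂ] SymmetricAlgebra ℂ V :=
  (SymmetricAlgebra.equivMvPolynomial
      (Module.Basis.ofVectorSpace ℂ V)).symm.toLinearEquiv.toLinearMap ∘ₗ
    MvPolynomial.homogeneousComponent i ∘ₗ
      (SymmetricAlgebra.equivMvPolynomial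
        (Module.Basis.ofVectorSpace ℂ V)).toLinearEquiv.toLinearMap

theorem symComponent_of_mem {i k : ℕ} {x : SymmetricAlgebra ℂ V} (hx : x ∈ symPower V k) :
    symComponent i x = if i = k then x else 0 := by
  rw [mem_symPower_iff (Module.Basis.ofVectorSpace ℂ V)] at hx
  change (SymmetricAlgebra.equivMvPolynomial (Module.Basis.ofVectorSpace ℂ V)).symm
    (MvPolynomial.homogeneousComponent i (SymmetricAlgebra.equivMvPolynomial
      (Module.Basis.ofVectorSpace ℂ V) x)) = _
  rw [MvPolynomial.homogeneousComponent_of_mem hx]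
  split_ifs <;> simp

theorem symComponent_mem (i : ℕ) (x : SymmetricAlgebra ℂ V) :
    symComponent i x ∈ symPower V i := by
  rw [mem_symPower_iff (Module.Basis.ofVectorSpace ℂ V)]
  change SymmetricAlgebra.equivMvPolynomial (Module.Basis.ofVectorSpace ℂ V)
    ((SymmetricAlgebra.equivMvPolynomial (Module.Basis.ofVectorSpace ℂ V)).symm
    (MvPolynomial.homogeneousComponent i (SymmetricAlgebra.equivMvPolynomial
      (Module.Basis.ofVectorSpace ℂ V) x))) ∈ _
  rw [AlgEquiv.apply_symm_apply]
  exact MvPolynomial.homogeneousComponent_isHomogeneous _ _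

theorem symAlg_linearMap_ext {M : Type*} [AddCommGroup M] [Module ℂ M]
    {f g : SymmetricAlgebra ℂ V →ₗ[ℂ] M} (h : ∀ k, ∀ x ∈ symPower V k, f x = g x) : f = g := by
  have h1 : f ∘ₗ (SymmetricAlgebra.equivMvPolynomial
        (Module.Basis.ofVectorSpace ℂ V)).symm.toLinearEquiv.toLinearMap =
      g ∘ₗ (SymmetricAlgebra.equivMvPolynomial
        (Module.Basis.ofVectorSpace ℂ V)).symm.toLinearEquiv.toLinearMap := by
    refine MvPolynomial.linearMap_ext fun d => LinearMap.ext fun c => ?_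
    refine h d.degree _ ?_
    rw [mem_symPower_iff (Module.Basis.ofVectorSpace ℂ V)]
    change SymmetricAlgebra.equivMvPolynomial (Module.Basis.ofVectorSpace ℂ V)
      ((SymmetricAlgebra.equivMvPolynomial (Module.Basis.ofVectorSpace ℂ V)).symm _) ∈ _
    rw [AlgEquiv.apply_symm_apply]
    exact MvPolynomial.isHomogeneous_monomial c rfl
  ext x
  have := LinearMap.congr_fun h1 (SymmetricAlgebra.equivMvPolynomial
    (Module.Basis.ofVectorSpace ℂ V) x)
  simpa using this

theorem mul_mem_symPower {k e : ℕ} {x y : SymmetricAlgebra ℂ V} (hx : x ∈ symPower V k)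
    (hy : y ∈ symPower V e) : x * y ∈ symPower V (k + e) := by
  rw [symPower, pow_add]
  exact Submodule.mul_mem_mul hx hy

theorem one_mem_symPower_zero : (1 : SymmetricAlgebra ℂ V) ∈ symPower V 0 := by
  rw [symPower, pow_zero]
  exact Submodule.one_le.1 le_rfl

theorem pow_mem_symPower {k : ℕ} {x : SymmetricAlgebra ℂ V} (hx : x ∈ symPower V k) (l : ℕ) :
    x ^ l ∈ symPower V (l * k) := by
  induction l with
  | zero => simpa using one_mem_symPower_zero
  | succ l ih =>
    rw [pow_succ, add_mul, one_mul]
    exact mul_mem_symPower ih hx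

theorem prod_mem_symPower {ι : Type*} (s : Finset ι) {k : ι → ℕ} {x : ι → SymmetricAlgebra ℂ V}
    (hx : ∀ j ∈ s, x j ∈ symPower V (k j)) : ∏ j ∈ s, x j ∈ symPower V (∑ j ∈ s, k j) := by
  classical
  induction s using Finset.induction_on with
  | empty => simpa using one_mem_symPower_zero
  | insert a s ha ih =>
    rw [Finset.prod_insert ha, Finset.sum_insert ha]
    exact mul_mem_symPower (hx a (Finset.mem_insert_self a s))
      (ih fun j hj => hx j (Finset.mem_insert_of_mem hj))

theorem symComponent_mul {i e : ℕ} {s : SymmetricAlgebra ℂ V} (hs : s ∈ symPower V e)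
    (c : SymmetricAlgebra ℂ V) :
    symComponent i (c * s) = if e ≤ i then symComponent (i - e) c * s else 0 := by
  suffices h : symComponent i ∘ₗ LinearMap.mulRight ℂ s =
      if e ≤ i then LinearMap.mulRight ℂ s ∘ₗ symComponent (i - e) else 0 by
    have h1 := LinearMap.congr_fun h c
    split_ifs at h1 ⊢ <;> exact h1
  refine symAlg_linearMap_ext fun k x hx => ?_
  have h1 := symComponent_of_mem (i := i) (mul_mem_symPower hx hs)
  rw [LinearMap.comp_apply, LinearMap.mulRight_apply, h1]
  split_ifs with h2 h3 h3
  · rw [LinearMap.comp_apply, LinearMap.mulRight_apply, symComponent_of_mem hx, if_pos (by omega)]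
  · omega
  · rw [LinearMap.comp_apply, LinearMap.mulRight_apply, symComponent_of_mem hx, if_neg (by omega),
      zero_mul]
  · rfl

variable {G : Type*} [Group G] (ρ : Representation ℂ G V)

theorem symAlgRep_mem_symPower (g : G) {i : ℕ} {x : SymmetricAlgebra ℂ V}
    (hx : x ∈ symPower V i) : symAlgRep ρ g x ∈ symPower V i :=
  symPower_le_comap ρ i g hx

theorem symAlgRep_mul (g : G) (x y : SymmetricAlgebra ℂ V) :
    symAlgRep ρ g (x * y) = symAlgRep ρ g x * symAlgRep ρ g y :=
  map_mul (SymmetricAlgebra.lift ((SymmetricAlgebra.ι ℂ V) ∘ₗ (ρ g))) x y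

theorem symComponent_symAlgRep (g : G) (i : ℕ) (x : SymmetricAlgebra ℂ V) :
    symComponent i (symAlgRep ρ g x) = symAlgRep ρ g (symComponent i x) := by
  suffices h : symComponent i ∘ₗ symAlgRep ρ g = symAlgRep ρ g ∘ₗ symComponent i from
    LinearMap.congr_fun h x
  refine symAlg_linearMap_ext fun k x hx => ?_
  rw [LinearMap.comp_apply, LinearMap.comp_apply, symComponent_of_mem hx,
    symComponent_of_mem (symAlgRep_mem_symPower ρ g hx)]
  split_ifs
  · rfl
  · rw [map_zero]

/-- The invariants of degree `i` in the symmetric algebra. -/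
noncomputable def gradedInvariants (i : ℕ) : Submodule ℂ (SymmetricAlgebra ℂ V) :=
  (symAlgRep ρ).invariants ⊓ symPower V i

theorem symComponent_mem_gradedInvariants (i : ℕ) {x : SymmetricAlgebra ℂ V}
    (hx : x ∈ (symAlgRep ρ).invariants) : symComponent i x ∈ gradedInvariants ρ i := by
  refine ⟨?_, symComponent_mem i x⟩
  rw [Representation.mem_invariants] at hx
  refine (Representation.mem_invariants _ _).2 fun g => ?_
  rw [← symComponent_symAlgRep, hx]

theorem map_invariants_symPowerRep (i : ℕ) :
    (symPowerRep ρ i).invariants.map (symPowVal i) = gradedInvariants ρ i := by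
  ext x
  constructor
  · rintro ⟨y, hy, rfl⟩
    refine ⟨?_, y.2⟩
    rw [SetLike.mem_coe, Representation.mem_invariants] at hy
    exact (Representation.mem_invariants _ _).2 fun g => congrArg (symPowVal i) (hy g)
  · rintro ⟨h1, h2⟩
    refine ⟨⟨x, h2⟩, ?_, rfl⟩
    exact (Representation.mem_invariants _ _).2 fun g =>
      Subtype.ext ((Representation.mem_invariants _ _).1 h1 g)

theorem finrank_gradedInvariants (i : ℕ) : Module.finrank ℂ (gradedInvariants ρ i) =
    Module.finrank ℂ (symPowerRep ρ i).invariants := by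
  rw [← map_invariants_symPowerRep]
  exact (Submodule.equivMapOfInjective _ (symPowVal_injective i) _).finrank_eq.symm

instance [FiniteDimensional ℂ V] (i : ℕ) : FiniteDimensional ℂ (gradedInvariants ρ i) := by
  rw [← map_invariants_symPowerRep]
  infer_instance

/-! ### Polynomial rings of invariants -/

variable {m : ℕ} {d : Fin m → ℕ} {f : Fin m → SymmetricAlgebra ℂ V}

theorem aeval_monomial_mem_symPower (hf : ∀ j, f j ∈ symPower V (d j)) (e : Fin m →₀ ℕ) (c : ℂ) :
    MvPolynomial.aeval f (MvPolynomial.monomial e c) ∈ symPower V (Finsupp.weight d e) := by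
  rw [MvPolynomial.aeval_monomial, ← Algebra.smul_def, Finsupp.weight_apply]
  exact Submodule.smul_mem _ _ (prod_mem_symPower _ fun j _ => pow_mem_symPower (hf j) _)

/-- Evaluation at generators of degrees d carries the grading by weight d to the grading by degree.
-/
theorem symComponent_aeval (hf : ∀ j, f j ∈ symPower V (d j)) (i : ℕ)
    (p : MvPolynomial (Fin m) ℂ) : symComponent i (MvPolynomial.aeval f p) =
      MvPolynomial.aeval f (MvPolynomial.weightedHomogeneousComponent d i p) := by
  suffices h : symComponent i ∘ₗ (MvPolynomial.aeval f).toLinearMap =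
      (MvPolynomial.aeval f).toLinearMap ∘ₗ MvPolynomial.weightedHomogeneousComponent d i from
    LinearMap.congr_fun h p
  refine MvPolynomial.linearMap_ext fun e => LinearMap.ext fun c => ?_
  change symComponent i (MvPolynomial.aeval f (MvPolynomial.monomial e c)) =
    MvPolynomial.aeval f (MvPolynomial.weightedHomogeneousComponent d i (MvPolynomial.monomial e c))
  rw [symComponent_of_mem (aeval_monomial_mem_symPower hf e c),
    MvPolynomial.weightedHomogeneousComponent_of_mem
      (MvPolynomial.isWeightedHomogeneous_monomial d e c rfl)]
  split_ifs
  · rfl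
  · rw [map_zero]

theorem map_weightedHomogeneousSubmodule (hf : ∀ j, f j ∈ symPower V (d j))
    (hadj : ∀ p, p ∈ Algebra.adjoin ℂ (Set.range f) ↔ p ∈ (symAlgRep ρ).invariants) (i : ℕ) :
    (MvPolynomial.weightedHomogeneousSubmodule ℂ d i).map (MvPolynomial.aeval f).toLinearMap =
      gradedInvariants ρ i := by
  have hmem : ∀ x, x ∈ (symAlgRep ρ).invariants ↔ ∃ p : MvPolynomial (Fin m) ℂ,
      MvPolynomial.aeval f p = x := by
    intro x
    rw [← hadj, Algebra.adjoin_range_eq_range_aeval]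
    rfl
  ext x
  constructor
  · rintro ⟨p, hp, rfl⟩
    have h := symComponent_mem_gradedInvariants ρ i ((hmem _).2 ⟨p, rfl⟩)
    rwa [symComponent_aeval hf, MvPolynomial.weightedHomogeneousComponent_eq_self hp] at h
  · rintro ⟨h1, h2⟩
    obtain ⟨p, rfl⟩ := (hmem _).1 h1
    refine ⟨_, MvPolynomial.weightedHomogeneousComponent_isWeightedHomogeneous i p, ?_⟩
    rw [AlgHom.toLinearMap_apply, ← symComponent_aeval hf, symComponent_of_mem h2, if_pos rfl]

/-- Algebraic independence makes evaluation injective, so the monomials of weight i in the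
generators form a basis of the invariants of degree i. -/
theorem finrank_gradedInvariants_eq_card (hf : ∀ j, f j ∈ symPower V (d j))
    (hind : AlgebraicIndependent ℂ f)
    (hadj : ∀ p, p ∈ Algebra.adjoin ℂ (Set.range f) ↔ p ∈ (symAlgRep ρ).invariants) (i : ℕ) :
    Module.finrank ℂ (gradedInvariants ρ i) = Nat.card {e : Fin m →₀ ℕ | Finsupp.weight d e = i} := by
  rw [← map_weightedHomogeneousSubmodule ρ hf hadj i,
    ← (Submodule.equivMapOfInjective (MvPolynomial.aeval f).toLinearMap hind _).finrank_eq,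
    MvPolynomial.weightedHomogeneousSubmodule_eq_finsupp_supported]
  exact Module.finrank_eq_nat_card_basis (MvPolynomial.basisRestrictSupport ℂ _)

end Grading

/-- The generating function of the monomials by weight. -/
theorem prod_one_sub_mul_mk_card {m : ℕ} {d : Fin m → ℕ} (hd : ∀ j, 0 < d j) :
    (∏ j, (1 - PowerSeries.X ^ d j : PowerSeries ℚ)) *
      PowerSeries.mk (fun i => (Nat.card {e : Fin m →₀ ℕ | Finsupp.weight d e = i} : ℚ)) = 1 := by
  classical
  have h1 : PowerSeries.mk (fun i => (Nat.card {e : Fin m →₀ ℕ | Finsupp.weight d e = i} : ℚ)) =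
      ∏ j, PowerSeries.mk fun l => if d j ∣ l then (1 : ℚ) else 0 := by
    ext i
    rw [PowerSeries.coeff_mk, PowerSeries.coeff_prod]
    simp only [PowerSeries.coeff_mk, Finset.prod_ite_zero, Finset.mem_univ, true_implies,
      Finset.prod_const_one]
    rw [Finset.sum_boole, Nat.card_coe_set_eq, ← Set.ncard_coe_finset]
    congr 1
    -- A monomial e corresponds to the composition of i into the multiples e_j d_j; positivity of
    -- d_j makes this injective.
    refine Set.ncard_congr (fun e _ => Finsupp.equivFunOnFinite.symm fun j => e j * d j) ?_ ?_ ?_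
    · intro e he
      rw [Set.mem_ofPred_eq, Finsupp.weight_apply, Finsupp.sum_fintype _ _ (by simp)] at he
      rw [Finset.mem_coe, Finset.mem_filter, Finset.mem_finsuppAntidiag]
      refine ⟨⟨by simpa using he, Finset.subset_univ _⟩, fun j => ?_⟩
      exact Dvd.intro_left (e j) rfl
    · intro e e' _ _ h
      ext j
      have := DFunLike.congr_fun h j
      exact Nat.eq_of_mul_eq_mul_right (hd j) this
    · intro e he
      rw [Finset.mem_coe, Finset.mem_filter, Finset.mem_finsuppAntidiag] at he
      have hj : ∀ j, e j / d j * d j = e j := fun j => Nat.div_mul_cancel (he.2 j)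
      refine ⟨Finsupp.equivFunOnFinite.symm fun j => e j / d j, ?_, ?_⟩
      · rw [Set.mem_ofPred_eq, Finsupp.weight_apply, Finsupp.sum_fintype _ _ (by simp)]
        simpa [hj] using he.1.1
      · ext j
        exact hj j
  rw [h1, ← Finset.prod_mul_distrib]
  refine Finset.prod_eq_one fun j _ => ?_
  ext l
  rw [sub_mul, one_mul, map_sub, PowerSeries.coeff_mk, PowerSeries.coeff_X_pow_mul',
    PowerSeries.coeff_mk, PowerSeries.coeff_one]
  rcases Nat.eq_zero_or_pos l with rfl | hl
  · simp [(hd j).ne']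
  · rw [if_neg hl.ne']
    by_cases h2 : d j ≤ l
    · rw [if_pos h2, if_congr (Nat.dvd_sub_iff_left h2 dvd_rfl) rfl rfl, sub_self]
    · rw [if_neg h2, if_neg fun h => h2 (Nat.le_of_dvd hl h), sub_zero]

/-! ### Hilbert series of modules of covariants -/

section Covariants

variable {V : Type*} [AddCommGroup V] [Module ℂ V] {U : Type*} [AddCommGroup U] [Module ℂ U]
  {G : Type*} [Group G] (ρ : Representation ℂ G V) (σ : Representation ℂ G U)

variable (V U) in
/-- The component of degree `i` of `S(V) ⊗ U`. -/
noncomputable def gradedTensor (i : ℕ) : Submodule ℂ (SymmetricAlgebra ℂ V ⊗[ℂ] U) :=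
  LinearMap.range ((symPower V i).subtype.rTensor U)

/-- The invariants of degree `i` in `S(V) ⊗ U`. -/
noncomputable def gradedCovariants (i : ℕ) : Submodule ℂ (SymmetricAlgebra ℂ V ⊗[ℂ] U) :=
  ((symAlgRep ρ).tprod σ).invariants ⊓ gradedTensor V U i

theorem rTensor_symPowVal_injective (i : ℕ) :
    Function.Injective ((symPowVal (V := V) i).rTensor U) :=
  Module.Flat.rTensor_preserves_injective_linearMap _ (symPowVal_injective i)

theorem tprod_rTensor_symPowVal (g : G) (i : ℕ) (y : SymPow V i ⊗[ℂ] U) :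
    (symAlgRep ρ).tprod σ g ((symPowVal i).rTensor U y) =
      (symPowVal i).rTensor U ((symPowerRep ρ i).tprod σ g y) := by
  induction y using TensorProduct.induction_on with
  | zero => simp only [map_zero]
  | tmul s u => rfl
  | add x y hx hy => simp only [map_add, hx, hy]

theorem map_invariants_tprod (i : ℕ) :
    ((symPowerRep ρ i).tprod σ).invariants.map ((symPowVal i).rTensor U) =
      gradedCovariants ρ σ i := by
  ext x
  constructor
  · rintro ⟨y, hy, rfl⟩
    refine ⟨(Representation.mem_invariants _ _).2 fun g => ?_, ⟨y, rfl⟩⟩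
    rw [tprod_rTensor_symPowVal, (Representation.mem_invariants _ _).1 hy]
  · rintro ⟨h1, h2⟩
    obtain ⟨y, hy⟩ : ∃ y : SymPow V i ⊗[ℂ] U, (symPowVal i).rTensor U y = x := h2
    refine ⟨y, (Representation.mem_invariants _ _).2 fun g => ?_, hy⟩
    apply rTensor_symPowVal_injective (U := U) i
    rw [← tprod_rTensor_symPowVal, hy]
    exact (Representation.mem_invariants _ _).1 h1 g

theorem finrank_gradedCovariants (i : ℕ) : Module.finrank ℂ (gradedCovariants ρ σ i) =
    Module.finrank ℂ ((symPowerRep ρ i).tprod σ).invariants := by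
  rw [← map_invariants_tprod]
  exact (Submodule.equivMapOfInjective _ (rTensor_symPowVal_injective i) _).finrank_eq.symm

theorem rTensor_symComponent_smul {e : ℕ} {x : SymmetricAlgebra ℂ V ⊗[ℂ] U}
    (hx : x ∈ gradedTensor V U e) (i : ℕ) (c : SymmetricAlgebra ℂ V) :
    (symComponent i).rTensor U (c • x) = if e ≤ i then symComponent (i - e) c • x else 0 := by
  obtain ⟨y, rfl⟩ := hx
  induction y using TensorProduct.induction_on with
  | zero => simp
  | tmul s u =>
    change symComponent i (c * s.1) ⊗ₜ[ℂ] u = _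
    rw [symComponent_mul s.2]
    split_ifs
    · rfl
    · rw [TensorProduct.zero_tmul]
  | add x y hx hy =>
    rw [map_add, smul_add, map_add, hx, hy]
    split_ifs
    · rw [smul_add]
    · rw [add_zero]

theorem smul_mem_gradedTensor {k e : ℕ} {c : SymmetricAlgebra ℂ V} (hc : c ∈ symPower V k)
    {x : SymmetricAlgebra ℂ V ⊗[ℂ] U} (hx : x ∈ gradedTensor V U e) :
    c • x ∈ gradedTensor V U (k + e) := by
  obtain ⟨y, rfl⟩ := hx
  induction y using TensorProduct.induction_on with
  | zero => rw [map_zero, smul_zero]; exact Submodule.zero_mem _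
  | tmul s u => exact ⟨(⟨c * s.1, mul_mem_symPower hc s.2⟩ : symPower V (k + e)) ⊗ₜ u, rfl⟩
  | add x y hx hy => rw [map_add, smul_add]; exact Submodule.add_mem _ hx hy

theorem tprod_smul (g : G) (c : SymmetricAlgebra ℂ V) (x : SymmetricAlgebra ℂ V ⊗[ℂ] U) :
    (symAlgRep ρ).tprod σ g (c • x) = symAlgRep ρ g c • (symAlgRep ρ).tprod σ g x := by
  induction x using TensorProduct.induction_on with
  | zero => simp
  | tmul s u =>
    change symAlgRep ρ g (c * s) ⊗ₜ[ℂ] σ g u = (symAlgRep ρ g c * symAlgRep ρ g s) ⊗ₜ[ℂ] σ g u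
    rw [symAlgRep_mul]
  | add x y hx hy => rw [smul_add, map_add, hx, hy, map_add, smul_add]

variable {m : ℕ} {e : Fin m → ℕ} {θ : Fin m → SymmetricAlgebra ℂ V ⊗[ℂ] U}

/-- The coefficients of degree `i - e`. -/
noncomputable def coefficientSpace (e i : ℕ) : Submodule ℂ (SymmetricAlgebra ℂ V) :=
  if e ≤ i then gradedInvariants ρ (i - e) else ⊥

instance [FiniteDimensional ℂ V] (e i : ℕ) : FiniteDimensional ℂ (coefficientSpace ρ e i) := by
  by_cases h : e ≤ i
  · rw [coefficientSpace, if_pos h]; infer_instance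
  · rw [coefficientSpace, if_neg h]; infer_instance

theorem finrank_coefficientSpace (e i : ℕ) : Module.finrank ℂ (coefficientSpace ρ e i) =
    if e ≤ i then Module.finrank ℂ (gradedInvariants ρ (i - e)) else 0 := by
  by_cases h : e ≤ i
  · rw [coefficientSpace, if_pos h, if_pos h]
  · rw [coefficientSpace, if_neg h, if_neg h, finrank_bot]

theorem coefficientSpace_le (e i : ℕ) : coefficientSpace ρ e i ≤ (symAlgRep ρ).invariants := by
  rw [coefficientSpace]
  split_ifs
  · exact inf_le_left
  · exact bot_le

/-- The linear combinations of the elements `θ j`. -/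
noncomputable def basisCombination (e : Fin m → ℕ) (θ : Fin m → SymmetricAlgebra ℂ V ⊗[ℂ] U)
    (i : ℕ) : (∀ j, coefficientSpace ρ (e j) i) →ₗ[ℂ] SymmetricAlgebra ℂ V ⊗[ℂ] U where
  toFun c := ∑ j, (c j).1 • θ j
  map_add' c c' := by
    rw [← Finset.sum_add_distrib]
    exact Finset.sum_congr rfl fun j _ => add_smul _ _ _
  map_smul' a c := by
    rw [RingHom.id_apply, Finset.smul_sum]
    exact Finset.sum_congr rfl fun j _ => smul_assoc _ _ _

/-- In degree i the coefficient of θ_j may be taken of degree i - e_j. Uniqueness of coefficients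
gives injectivity of the combination map, and projection to degree i gives surjectivity. -/
theorem finrank_gradedCovariants_eq_sum [FiniteDimensional ℂ V]
    (hθ : ∀ j, θ j ∈ gradedTensor V U (e j))
    (hθ' : ∀ j, θ j ∈ ((symAlgRep ρ).tprod σ).invariants)
    (hu : ∀ x ∈ ((symAlgRep ρ).tprod σ).invariants,
      ∃! c : Fin m → SymmetricAlgebra ℂ V,
        (∀ j, c j ∈ (symAlgRep ρ).invariants) ∧ x = ∑ j, c j • θ j) (i : ℕ) :
    Module.finrank ℂ (gradedCovariants ρ σ i) =
      ∑ j, if e j ≤ i then Module.finrank ℂ (gradedInvariants ρ (i - e j)) else 0 := by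
  have hinv : ∀ c : Fin m → SymmetricAlgebra ℂ V, (∀ j, c j ∈ (symAlgRep ρ).invariants) →
      ∑ j, c j • θ j ∈ ((symAlgRep ρ).tprod σ).invariants := by
    intro c hc
    refine Submodule.sum_mem _ fun j _ => (Representation.mem_invariants _ _).2 fun g => ?_
    rw [tprod_smul, (Representation.mem_invariants _ _).1 (hc j),
      (Representation.mem_invariants _ _).1 (hθ' j)]
  have hinj : Function.Injective (basisCombination ρ e θ i) := by
    intro c c' h
    have hc : ∀ j, (c j).1 ∈ (symAlgRep ρ).invariants := fun j => coefficientSpace_le ρ _ _ (c j).2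
    have hc' : ∀ j, (c' j).1 ∈ (symAlgRep ρ).invariants :=
      fun j => coefficientSpace_le ρ _ _ (c' j).2
    have h1 := (hu _ (hinv _ hc)).unique ⟨hc, rfl⟩ ⟨hc', h⟩
    funext j
    exact Subtype.ext (congrFun h1 j)
  have hrange : LinearMap.range (basisCombination ρ e θ i) = gradedCovariants ρ σ i := by
    ext x
    constructor
    · rintro ⟨c, rfl⟩
      change ∑ j, (c j).1 • θ j ∈ gradedCovariants ρ σ i
      refine ⟨hinv _ fun j => coefficientSpace_le ρ _ _ (c j).2, Submodule.sum_mem _ fun j _ => ?_⟩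
      generalize c j = y
      obtain ⟨y, hc⟩ := y
      rw [coefficientSpace] at hc
      change y • θ j ∈ _
      split_ifs at hc with h
      · have h1 := smul_mem_gradedTensor hc.2 (hθ j)
        rwa [Nat.sub_add_cancel h] at h1
      · rw [(Submodule.mem_bot ℂ).1 hc, zero_smul]
        exact Submodule.zero_mem _
    · rintro ⟨h1, h2⟩
      obtain ⟨c, ⟨hc, hx⟩, -⟩ := hu x h1
      -- The given coefficients need not be known to be homogeneous, but x and the θ_j are, so the
      -- components of degree i - e_j already represent x.
      refine ⟨fun j => ⟨if e j ≤ i then symComponent (i - e j) (c j) else 0, ?_⟩, ?_⟩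
      · rw [coefficientSpace]
        split_ifs
        · exact symComponent_mem_gradedInvariants ρ _ (hc j)
        · exact Submodule.zero_mem _
      · have h3 := rTensor_symComponent_smul h2 i 1
        rw [if_pos le_rfl, Nat.sub_self, symComponent_of_mem one_mem_symPower_zero, if_pos rfl,
          one_smul] at h3
        rw [← h3, hx, map_sum]
        change ∑ j, (if e j ≤ i then symComponent (i - e j) (c j) else 0) • θ j = _
        refine Finset.sum_congr rfl fun j _ => ?_
        rw [rTensor_symComponent_smul (hθ j)]
        split_ifs
        · rfl
        · exact zero_smul _ _
  rw [← hrange, LinearMap.finrank_range_of_inj hinj, Module.finrank_pi_fintype]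
  exact Finset.sum_congr rfl fun j _ => finrank_coefficientSpace ρ _ _

end Covariants

/-! ### Monotone sequences determined by products and sums of powers -/

section Determination

/-- Power sums are recovered from the logarithmic derivative; cancelling H requires a domain. -/
theorem IsPowerSumExp.exponents_eq {R : Type*} [CommRing R] [IsDomain R] {p p' : ℕ → R}
    {H : PowerSeries R} (h : IsPowerSumExp p H) (h' : IsPowerSumExp p' H) (l : ℕ) :
    p (l + 1) = p' (l + 1) := by
  have hH : H ≠ 0 := by
    rintro rfl
    simpa using h.const
  have := congrArg (PowerSeries.coeff l) (mul_right_cancel₀ hH (h.deriv.symm.trans h'.deriv))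
  simpa using this

theorem monotone_eq_of_divisor_sums {m : ℕ} {d d' : Fin m → ℕ} (hd : Monotone d)
    (hd' : Monotone d') (h0 : ∀ j, 0 < d j) (h0' : ∀ j, 0 < d' j)
    (h : ∀ l, 0 < l → ∑ j, (if d j ∣ l then d j else 0) = ∑ j, (if d' j ∣ l then d' j else 0)) :
    d = d' := by
  induction m with
  | zero => exact Subsingleton.elim _ _
  | succ m ih =>
    -- At l = d 0 the sum is positive, so some d' j divides d 0, whence d' 0 ≤ d 0. By symmetry the
    -- minima agree and can be removed.
    have key : ∀ {d d' : Fin (m + 1) → ℕ}, Monotone d' → (∀ j, 0 < d j) →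
        (∀ l, 0 < l → ∑ j, (if d j ∣ l then d j else 0) = ∑ j, (if d' j ∣ l then d' j else 0)) →
        d' 0 ≤ d 0 := by
      intro d d' hd' h0 h
      have h1 : 0 < ∑ j, (if d j ∣ d 0 then d j else 0) :=
        lt_of_lt_of_le (by simpa using h0 0) (Finset.single_le_sum (f := fun j =>
          if d j ∣ d 0 then d j else 0) (fun _ _ => Nat.zero_le _) (Finset.mem_univ 0))
      rw [h _ (h0 0)] at h1
      obtain ⟨j, -, hj⟩ := Finset.exists_ne_zero_of_sum_ne_zero h1.ne'
      have hj' : d' j ∣ d 0 := by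
        by_contra hn
        exact hj (if_neg hn)
      exact (hd' (Fin.zero_le j)).trans (Nat.le_of_dvd (h0 0) hj')
    have e0 : d 0 = d' 0 :=
      le_antisymm (key hd h0' fun l hl => (h l hl).symm) (key hd' h0 h)
    have e1 : (fun j : Fin m => d j.succ) = fun j => d' j.succ := by
      refine ih (fun a b hab => hd (Fin.succ_le_succ_iff.2 hab))
        (fun a b hab => hd' (Fin.succ_le_succ_iff.2 hab)) (fun j => h0 _) (fun j => h0' _)
        fun l hl => ?_
      have h1 := h l hl
      rw [Fin.sum_univ_succ, Fin.sum_univ_succ, e0] at h1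
      exact Nat.add_left_cancel h1
    funext j
    refine Fin.cases e0 (fun j => congrFun e1 j) j

theorem monotone_eq_of_prod_one_sub {m : ℕ} {d d' : Fin m → ℕ} (hd : Monotone d)
    (hd' : Monotone d') (h0 : ∀ j, 0 < d j) (h0' : ∀ j, 0 < d' j)
    (h : ∏ j, (1 - PowerSeries.X ^ d j : PowerSeries ℚ) = ∏ j, (1 - PowerSeries.X ^ d' j)) :
    d = d' := by
  refine monotone_eq_of_divisor_sums hd hd' h0 h0' fun l hl => ?_
  have h1 := IsPowerSumExp.prod Finset.univ fun j _ => isPowerSumExp_one_sub_pow (R := ℚ) (h0 j)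
  have h2 := IsPowerSumExp.prod Finset.univ fun j _ => isPowerSumExp_one_sub_pow (R := ℚ) (h0' j)
  rw [h] at h1
  have h3 := h1.exponents_eq h2 (l - 1)
  rw [Nat.sub_add_cancel hl, Finset.sum_apply, Finset.sum_apply, Finset.sum_neg_distrib,
    Finset.sum_neg_distrib, neg_inj] at h3
  exact_mod_cast h3

theorem monotone_eq_of_sum_pow {m : ℕ} {e e' : Fin m → ℕ} (he : Monotone e) (he' : Monotone e')
    (h : ∑ j, (PowerSeries.X ^ e j : PowerSeries ℚ) = ∑ j, PowerSeries.X ^ e' j) : e = e' := by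
  have h1 : Finset.univ.val.map e = Finset.univ.val.map e' := by
    ext l
    have h2 := congrArg (PowerSeries.coeff l) h
    simp only [map_sum, PowerSeries.coeff_X_pow, Finset.sum_boole] at h2
    rw [Multiset.count_map, Multiset.count_map]
    exact_mod_cast h2
  -- Equal multisets give equal divisor sums. The shift by one makes all entries positive, as the
  -- comparison requires.
  have h2 : (fun j => e j + 1) = fun j => e' j + 1 := by
    refine monotone_eq_of_divisor_sums (fun a b hab => Nat.succ_le_succ (he hab))
      (fun a b hab => Nat.succ_le_succ (he' hab)) (fun _ => Nat.succ_pos _)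
      (fun _ => Nat.succ_pos _) fun l _ => ?_
    have h3 := congrArg (fun s => (s.map fun a => if a + 1 ∣ l then a + 1 else 0).sum) h1
    simp only [Multiset.map_map] at h3
    exact h3
  funext j
  exact Nat.succ_injective (congrFun h2 j)

end Determination

/-! ### Multiplicities without differential forms -/

section FunctionPart

variable {G : Type*} [Group G] [Fintype G] {V : Type*} [AddCommGroup V] [Module ℂ V]
  [FiniteDimensional ℂ V] {U : Type*} [AddCommGroup U] [Module ℂ U] [FiniteDimensional ℂ U]
  (ρ : Representation ℂ G V) (σ : Representation ℂ G U)

theorem coeff_one_prod {m : ℕ} (μ : Fin m → ℂ) :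
    (∏ j, (1 + Polynomial.C (μ j) * Polynomial.X)).coeff 1 = ∑ j, μ j := by
  induction m with
  | zero => simp [Polynomial.coeff_one]
  | succ m ih =>
    have h : (∏ j : Fin m, (1 + Polynomial.C (μ j.succ) * Polynomial.X)).coeff 0 = 1 := by
      simp [Polynomial.coeff_zero_eq_eval_zero, Polynomial.eval_prod]
    rw [Fin.prod_univ_succ, Fin.sum_univ_succ, Polynomial.mul_coeff_one, ih, h]
    simp [Polynomial.coeff_one]
    ring

theorem extPowerRep_zero_character (g : G) : (extPowerRep ρ 0).character g = 1 := by
  obtain ⟨b, μ, h⟩ := exists_eigenbasis (ρ g) (m := orderOf g) (orderOf_pos g).ne'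
    (by rw [← map_pow, pow_orderOf_eq_one, map_one])
  rw [extPowerRep_trace ρ g b μ h]
  simp [Polynomial.coeff_zero_eq_eval_zero, Polynomial.eval_prod]

theorem extPowerRep_one_character (g : G) : (extPowerRep ρ 1).character g = ρ.character g := by
  obtain ⟨b, μ, h⟩ := exists_eigenbasis (ρ g) (m := orderOf g) (orderOf_pos g).ne'
    (by rw [← map_pow, pow_orderOf_eq_one, map_one])
  rw [extPowerRep_trace ρ g b μ h, coeff_one_prod]
  exact (trace_of_eigenbasis b _ μ h).symm

/-- Only characters enter the dimension, so ⋀^1 V can be exchanged for V itself. -/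
theorem mixedDim_zero_eq_finrank_gradedCovariants (i : ℕ) (τ : Representation ℂ G V)
    (hτ : ∀ g, τ.character g = σ.character g) : mixedDim ρ σ i 0 =
      Module.finrank ℂ (gradedCovariants ρ.dual τ i) := by
  have : Invertible (Nat.card G : ℂ) := invertibleOfNonzero (by
    rw [Nat.card_eq_fintype_card]; exact_mod_cast Fintype.card_ne_zero)
  have h : (mixedDim ρ σ i 0 : ℂ) = Module.finrank ℂ (gradedCovariants ρ.dual τ i) := by
    rw [mixedDim_eq, finrank_gradedCovariants, ← Representation.card_inv_mul_sum_char_eq_finrank,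
      Nat.card_eq_fintype_card]
    congr 1
    refine Finset.sum_congr rfl fun g _ => ?_
    rw [Representation.char_tensor, Pi.mul_apply, extPowerRep_zero_character, hτ]
    ring
  exact_mod_cast h

theorem mixedDim_zero_eq_finrank_gradedInvariants (i : ℕ) (hσ : ∀ g, σ.character g = 1) :
    mixedDim ρ σ i 0 = Module.finrank ℂ (gradedInvariants ρ.dual i) := by
  have : Invertible (Nat.card G : ℂ) := invertibleOfNonzero (by
    rw [Nat.card_eq_fintype_card]; exact_mod_cast Fintype.card_ne_zero)
  have h : (mixedDim ρ σ i 0 : ℂ) = Module.finrank ℂ (gradedInvariants ρ.dual i) := by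
    rw [mixedDim_eq, finrank_gradedInvariants, ← Representation.card_inv_mul_sum_char_eq_finrank,
      Nat.card_eq_fintype_card]
    congr 1
    refine Finset.sum_congr rfl fun g _ => ?_
    rw [extPowerRep_zero_character, hσ]
    ring
  exact_mod_cast h

/-- The specialization `t = 0`. -/
noncomputable def evalTZero : PowerSeries (Polynomial ℚ) →+* PowerSeries ℚ :=
  PowerSeries.map (Polynomial.evalRingHom 0)

theorem evalTZero_hilbPoly :
    evalTZero (hilbPoly ρ σ) = PowerSeries.mk fun i => (mixedDim ρ σ i 0 : ℚ) := by
  ext i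
  simp [evalTZero, hilbPoly, Polynomial.eval_finsetSum, Finset.sum_range_succ']

end FunctionPart

/-! ### The invariants and covariants of the Weyl group -/

section Weyl

/-- Denominators are cleared so that the identity descends to ℚ[t][[q]], where t = 0 can be
substituted. The case r = 1 below serves the same purpose. -/
theorem exterior_formula_zero {K : Type*} [Field K] {q t : K} (hq : ∀ l, 0 < l → 1 - q ^ l ≠ 0)
    (N : ℕ) : q ^ (0 + Nat.choose 0 2) *
      (pochProd q q N / (pochProd q q 0 * pochProd q q (N - 0))) *
        (pochProd (-t * q) q (N - 0) * pochProd (-t * q⁻¹) q⁻¹ 0) / pochProd (q ^ 2) q N *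
      ∏ i ∈ Finset.range N, (1 - q ^ (i + 2)) = ∏ i ∈ Finset.range N, (1 + t * q ^ (i + 1)) := by
  have h1 : pochProd q q N ≠ 0 := by
    rw [pochProd_self]
    exact Finset.prod_ne_zero_iff.2 fun i _ => hq _ i.succ_pos
  have h2 : pochProd (q ^ 2) q N = ∏ i ∈ Finset.range N, (1 - q ^ (i + 2)) :=
    Finset.prod_congr rfl fun i _ => by ring
  have h3 : pochProd (-t * q) q N = ∏ i ∈ Finset.range N, (1 + t * q ^ (i + 1)) :=
    Finset.prod_congr rfl fun i _ => by ring
  have h4 : ∏ i ∈ Finset.range N, (1 - q ^ (i + 2)) ≠ 0 :=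
    Finset.prod_ne_zero_iff.2 fun i _ => hq _ (by omega)
  have h5 : ∀ z a : K, pochProd z a 0 = 1 := fun z a => Finset.prod_range_zero _
  rw [Nat.sub_zero, h2, h3, h5, h5, div_mul_cancel₀ _ h4, one_mul, div_self h1]
  simp

theorem exterior_formula_one {K : Type*} [Field K] {q t : K} (hq0 : q ≠ 0)
    (hq : ∀ l, 0 < l → 1 - q ^ l ≠ 0)
    {N : ℕ} (hN : 1 ≤ N) : q ^ (1 + Nat.choose 1 2) *
      (pochProd q q N / (pochProd q q 1 * pochProd q q (N - 1))) *
        (pochProd (-t * q) q (N - 1) * pochProd (-t * q⁻¹) q⁻¹ 1) / pochProd (q ^ 2) q N *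
      (∏ i ∈ Finset.range N, (1 - q ^ (i + 2))) * (1 - q) =
        (1 - q ^ N) * (∏ i ∈ Finset.range (N - 1), (1 + t * q ^ (i + 1))) * (q + t) := by
  obtain ⟨m, rfl⟩ := Nat.exists_eq_add_of_le' hN
  have h1 : pochProd q q m ≠ 0 := by
    rw [pochProd_self]
    exact Finset.prod_ne_zero_iff.2 fun i _ => hq _ i.succ_pos
  have h2 : pochProd (q ^ 2) q (m + 1) = ∏ i ∈ Finset.range (m + 1), (1 - q ^ (i + 2)) :=
    Finset.prod_congr rfl fun i _ => by ring
  have h3 : pochProd (-t * q) q m = ∏ i ∈ Finset.range m, (1 + t * q ^ (i + 1)) :=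
    Finset.prod_congr rfl fun i _ => by ring
  have h4 : ∏ i ∈ Finset.range (m + 1), (1 - q ^ (i + 2)) ≠ 0 :=
    Finset.prod_ne_zero_iff.2 fun i _ => hq _ (by omega)
  have h5 : ∀ z a : K, pochProd z a 1 = 1 - z := fun z a => by
    rw [pochProd, Finset.prod_range_one, pow_zero, mul_one]
  have h6 : pochProd q q (m + 1) = pochProd q q m * (1 - q ^ (m + 1)) := by
    rw [pochProd_self, pochProd_self, Finset.prod_range_succ]
  have h7 := hq 1 one_pos
  rw [pow_one] at h7
  rw [Nat.add_sub_cancel, h2, h3, h5, h5, h6, div_mul_cancel₀ _ h4]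
  generalize (∏ i ∈ Finset.range m, (1 + t * q ^ (i + 1))) = F
  have h8 : q ^ (1 + Nat.choose 1 2) = q := by simp
  rw [h8]
  field_simp
  ring

variable {n : ℕ}

theorem hilbert_invariants (hn : 1 ≤ n) :
    PowerSeries.mk (fun i => (Module.finrank ℂ (gradedInvariants (weylARep n).dual i) : ℚ)) *
      ∏ i ∈ Finset.range (n - 1), (1 - PowerSeries.X ^ (i + 2)) = 1 := by
  have h : hilbPoly (weylARep n) (extPowerRep (weylARep n) 0) *
      ∏ i ∈ Finset.range (n - 1), (1 - PowerSeries.X ^ (i + 2)) =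
        ∏ i ∈ Finset.range (n - 1), (1 + PowerSeries.C Polynomial.X * PowerSeries.X ^ (i + 1)) := by
    apply toQT_injective
    simp only [map_mul, map_prod, map_sub, map_add, map_one, map_pow, toQT_X, toQT_C_X,
      toQT_hilbPoly]
    rw [hilb_weyl_extPowerRep hn (Nat.zero_le _)]
    exact exterior_formula_zero (fun l hl => one_sub_q_pow_ne_zero hl) _
  have h1 := congrArg evalTZero h
  rw [map_mul, evalTZero_hilbPoly] at h1
  simp only [mixedDim_zero_eq_finrank_gradedInvariants _ _ _
    (extPowerRep_zero_character (weylARep n))] at h1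
  simpa [evalTZero, map_prod] using h1

theorem hilbert_covariants (hn : 2 ≤ n) :
    PowerSeries.mk (fun i =>
        (Module.finrank ℂ (gradedCovariants (weylARep n).dual (weylARep n) i) : ℚ)) *
      (∏ i ∈ Finset.range (n - 1), (1 - PowerSeries.X ^ (i + 2))) * (1 - PowerSeries.X) =
        (1 - PowerSeries.X ^ (n - 1)) * PowerSeries.X := by
  have h : hilbPoly (weylARep n) (extPowerRep (weylARep n) 1) *
      (∏ i ∈ Finset.range (n - 1), (1 - PowerSeries.X ^ (i + 2))) * (1 - PowerSeries.X) =
        (1 - PowerSeries.X ^ (n - 1)) * (∏ i ∈ Finset.range (n - 1 - 1),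
          (1 + PowerSeries.C Polynomial.X * PowerSeries.X ^ (i + 1))) *
            (PowerSeries.X + PowerSeries.C Polynomial.X) := by
    apply toQT_injective
    simp only [map_mul, map_prod, map_sub, map_add, map_one, map_pow, toQT_X, toQT_C_X,
      toQT_hilbPoly]
    rw [hilb_weyl_extPowerRep (by omega) (by omega)]
    exact exterior_formula_one q_ne_zero (fun l hl => one_sub_q_pow_ne_zero hl) (by omega)
  have h1 := congrArg evalTZero h
  rw [map_mul, map_mul, evalTZero_hilbPoly] at h1
  simp only [mixedDim_zero_eq_finrank_gradedCovariants _ _ _ _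
    fun g => (extPowerRep_one_character (weylARep n) g).symm] at h1
  simpa [evalTZero, map_prod] using h1

/-- Degrees enter only through the Hilbert series of the invariants, which is known from the case r
= 0 and determines a monotone sequence of degrees. -/
theorem exponents_eq (hn : 1 ≤ n) {e : Fin (n - 1) → ℕ} (h : IsExponents (weylARep n) e) :
    e = fun i => i.val + 1 := by
  obtain ⟨hmono, f, hf, hind, hadj⟩ := h
  have h1 := prod_one_sub_mul_mk_card (d := fun i => e i + 1) fun j => Nat.succ_pos _
  simp only [← finrank_gradedInvariants_eq_card (weylARep n).dual hf hind hadj] at h1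
  have h2 := hilbert_invariants hn
  rw [← Fin.prod_univ_eq_prod_range fun i => (1 - PowerSeries.X ^ (i + 2) : PowerSeries ℚ)] at h2
  have h3 := monotone_eq_of_prod_one_sub (d' := fun i : Fin (n - 1) => i.val + 2) hmono
    (fun a b hab => Nat.add_le_add_right hab 2) (fun _ => Nat.succ_pos _) (fun _ => by simp)
    (left_inv_eq_right_inv h1 h2)
  funext j
  have := congrFun h3 j
  omega

/-- The Hilbert series of the covariants is Σ q^{e_j} times that of the invariants. The case r = 1
makes the quotient q + ... + q^{n-1}; it needs n ≥ 2, and for n = 1 both sequences are empty. -/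
theorem coexponents_eq (hn : 1 ≤ n) {e : Fin (n - 1) → ℕ} (h : IsCoexponents (weylARep n) e) :
    e = fun i => i.val + 1 := by
  rcases hn.eq_or_lt with rfl | hn'
  · exact Subsingleton.elim (α := Fin 0 → ℕ) _ _
  obtain ⟨hmono, θ, hθ, hθ', hu⟩ := h
  refine monotone_eq_of_sum_pow hmono (fun a b hab => Nat.add_le_add_right hab 1) ?_
  have h1 := hilbert_invariants hn
  have h2 := hilbert_covariants hn'
  have h3 : PowerSeries.mk (fun i =>
        (Module.finrank ℂ (gradedCovariants (weylARep n).dual (weylARep n) i) : ℚ)) =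
      (∑ j, PowerSeries.X ^ e j) * PowerSeries.mk fun i =>
        (Module.finrank ℂ (gradedInvariants (weylARep n).dual i) : ℚ) := by
    ext i
    rw [PowerSeries.coeff_mk, finrank_gradedCovariants_eq_sum _ _ hθ hθ' hu, Finset.sum_mul,
      map_sum, Nat.cast_sum]
    refine Finset.sum_congr rfl fun j _ => ?_
    rw [PowerSeries.coeff_X_pow_mul', PowerSeries.coeff_mk]
    split_ifs <;> simp
  have h4 : (1 - PowerSeries.X : PowerSeries ℚ) ≠ 0 := by
    intro h0
    have := congrArg PowerSeries.constantCoeff h0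
    simp at this
  apply mul_right_cancel₀ h4
  have h5 : (∑ j : Fin (n - 1), (PowerSeries.X ^ (j.val + 1) : PowerSeries ℚ)) *
      (1 - PowerSeries.X) = (1 - PowerSeries.X ^ (n - 1)) * PowerSeries.X := by
    rw [Fin.sum_univ_eq_sum_range fun j => (PowerSeries.X ^ (j + 1) : PowerSeries ℚ)]
    simp only [pow_succ]
    rw [← Finset.sum_mul, ← geom_sum_mul_neg]
    ring
  rw [h5, ← h2, h3, mul_assoc _ (PowerSeries.mk _), h1, mul_one]

end Weyl

/-! ### Elementary symmetric functions of a geometric progression -/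

section ElementarySymmetric

variable {K : Type*} [Field K] {q t : K}

theorem sum_powersetCard_prod_eq_coeff {m : ℕ} (r : ℕ) (x : Fin m → K) :
    ∑ A ∈ Finset.powersetCard r (Finset.univ : Finset (Fin m)), ∏ i ∈ A, x i =
      PowerSeries.coeff r (∏ i, (1 + PowerSeries.C (x i) * PowerSeries.X)) := by
  rw [Finset.prod_one_add, map_sum, Finset.powersetCard_eq_filter, Finset.sum_filter]
  refine Finset.sum_congr rfl fun A _ => ?_
  rw [Finset.prod_mul_distrib, Finset.prod_const, ← map_prod, PowerSeries.coeff_C_mul,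
    PowerSeries.coeff_X_pow]
  by_cases h : A.card = r
  · rw [if_pos h, if_pos h.symm, mul_one]
  · rw [if_neg h, if_neg fun h' => h h'.symm, mul_zero]

theorem rescale_C (q a : K) : PowerSeries.rescale q (PowerSeries.C a) = PowerSeries.C a := by
  ext k
  rw [PowerSeries.coeff_rescale, PowerSeries.coeff_C]
  split_ifs with h <;> simp [h]

/-- The finite q-binomial theorem, from F(qz)(1 + qz) = F(z)(1 + q^{N+1} z). -/
theorem coeff_prod_one_add_geometric (hq : ∀ l, 0 < l → 1 - q ^ l ≠ 0) {N r : ℕ} (hr : r ≤ N) :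
    PowerSeries.coeff r (∏ i ∈ Finset.range N,
      (1 + PowerSeries.C (q ^ (i + 1)) * PowerSeries.X)) =
      q ^ (r + r.choose 2) * (pochProd q q N / (pochProd q q r * pochProd q q (N - r))) := by
  have hP : ∀ m, pochProd q q m ≠ 0 := fun m => by
    rw [pochProd_self]
    exact Finset.prod_ne_zero_iff.2 fun i _ => hq _ i.succ_pos
  have hS : ∀ m, pochProd q q (m + 1) = pochProd q q m * (1 - q ^ (m + 1)) := fun m => by
    rw [pochProd_self, pochProd_self, Finset.prod_range_succ]
  induction r with
  | zero =>
    rw [PowerSeries.coeff_zero_eq_constantCoeff_apply, map_prod, Nat.sub_zero,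
      show pochProd q q 0 = 1 from Finset.prod_range_zero _, one_mul, div_self (hP N)]
    simp
  | succ r ih =>
    have ih := ih (by omega)
    set F : PowerSeries K := ∏ i ∈ Finset.range N,
      (1 + PowerSeries.C (q ^ (i + 1)) * PowerSeries.X) with hF
    have h1 : PowerSeries.rescale q F * (1 + PowerSeries.C q * PowerSeries.X) =
        F * (1 + PowerSeries.C (q ^ (N + 1)) * PowerSeries.X) := by
      rw [hF, ← Finset.prod_range_succ (fun i => 1 + PowerSeries.C (q ^ (i + 1)) * PowerSeries.X),
        Finset.prod_range_succ', map_prod, zero_add, pow_one]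
      congr 1
      refine Finset.prod_congr rfl fun i _ => ?_
      rw [map_add, map_one, map_mul, PowerSeries.rescale_X, rescale_C, ← mul_assoc,
        ← map_mul, ← pow_succ]
    have h2 := congrArg (PowerSeries.coeff (r + 1)) h1
    rw [mul_add, mul_add, map_add, map_add, mul_one, mul_one, ← mul_assoc, ← mul_assoc,
      PowerSeries.coeff_succ_mul_X, PowerSeries.coeff_succ_mul_X, PowerSeries.coeff_mul_C,
      PowerSeries.coeff_mul_C, PowerSeries.coeff_rescale, PowerSeries.coeff_rescale, ih] at h2
    obtain ⟨m, rfl⟩ : ∃ m, N = m + r + 1 := ⟨N - r - 1, by omega⟩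
    rw [show m + r + 1 - r = m + 1 by omega] at h2
    rw [show m + r + 1 - (r + 1) = m by omega]
    have e : r + 1 + (r + 1).choose 2 = (r + r.choose 2) + (r + 1) := by
      rw [Nat.choose_succ_succ, Nat.choose_one_right]
      ring
    have n1 := hP m
    have n2 := hP r
    have n3 := hq (m + 1) m.succ_pos
    have n4 := hq (r + 1) r.succ_pos
    rw [hS m] at h2
    rw [e, pow_add, hS r]
    have e2 : q ^ (m + r + 1 + 1) = q ^ (m + 1) * q ^ (r + 1) := by ring
    rw [e2] at h2
    apply mul_right_cancel₀ n4
    generalize PowerSeries.coeff (r + 1) F = c at *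
    have h3 : c * (1 - q ^ (r + 1)) = q ^ (r + r.choose 2) * (pochProd q q (m + r + 1) /
        (pochProd q q r * (pochProd q q m * (1 - q ^ (m + 1))))) *
          (q ^ (r + 1) * (1 - q ^ (m + 1))) := by
      rw [pow_succ q r] at h2 ⊢
      linear_combination -h2
    rw [h3]
    generalize q ^ (r + r.choose 2) = x at *
    field_simp

theorem prod_fin_lt {M : Type*} [CommMonoid M] {N k : ℕ} (hk : k ≤ N) (g : ℕ → M) :
    ∏ i : Fin N with i.val < k, g i = ∏ i ∈ Finset.range k, g i := by
  rw [Finset.prod_filter, Fin.prod_univ_eq_prod_range fun i => if i < k then g i else 1,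
    ← Finset.prod_filter]
  congr 1
  ext i
  simp only [Finset.mem_filter, Finset.mem_range]
  omega

theorem exterior_formula_exponents (hq : ∀ l, 0 < l → 1 - q ^ l ≠ 0) {N r : ℕ} (hr : r ≤ N) :
    q ^ (r + r.choose 2) * (pochProd q q N / (pochProd q q r * pochProd q q (N - r))) *
      (pochProd (-t * q) q (N - r) * pochProd (-t * q⁻¹) q⁻¹ r) / pochProd (q ^ 2) q N =
    (∑ A ∈ Finset.powersetCard r (Finset.univ : Finset (Fin N)), ∏ i ∈ A, q ^ (i.val + 1)) *
      ((∏ i : Fin N with i.val < r, (1 + q ^ (-((i.val + 1 : ℕ) : ℤ)) * t)) *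
        ∏ i : Fin N with i.val < N - r, (1 + q ^ (i.val + 1) * t)) /
      ∏ i : Fin N, (1 - q ^ (i.val + 1 + 1)) := by
  rw [sum_powersetCard_prod_eq_coeff r fun i : Fin N => q ^ (i.val + 1),
    Fin.prod_univ_eq_prod_range fun i =>
      (1 + PowerSeries.C (q ^ (i + 1)) * PowerSeries.X : PowerSeries K),
    coeff_prod_one_add_geometric hq hr, prod_fin_lt hr fun i => 1 + q ^ (-((i + 1 : ℕ) : ℤ)) * t,
    prod_fin_lt (Nat.sub_le N r) fun i => 1 + q ^ (i + 1) * t,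
    Fin.prod_univ_eq_prod_range fun i => 1 - q ^ (i + 1 + 1)]
  have h1 : pochProd (-t * q) q (N - r) = ∏ i ∈ Finset.range (N - r), (1 + q ^ (i + 1) * t) :=
    Finset.prod_congr rfl fun i _ => by ring
  have h2 : pochProd (q ^ 2) q N = ∏ i ∈ Finset.range N, (1 - q ^ (i + 1 + 1)) :=
    Finset.prod_congr rfl fun i _ => by ring
  have h3 : pochProd (-t * q⁻¹) q⁻¹ r =
      ∏ i ∈ Finset.range r, (1 + q ^ (-((i + 1 : ℕ) : ℤ)) * t) := by
    refine Finset.prod_congr rfl fun i _ => ?_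
    rw [zpow_neg, zpow_natCast, ← inv_pow]
    ring
  rw [h1, h2, h3, mul_comm (∏ i ∈ Finset.range r, _)]

end ElementarySymmetric

theorem hilb_weyl_extPowerRep_exponents {n : ℕ} (hn : 1 ≤ n) {r : ℕ} (hr : r ≤ n - 1) :
    hilb (weylARep n) (extPowerRep (weylARep n) r) =
      elemSymm r (fun i : Fin (n - 1) => q ^ (i.val + 1)) *
        ((∏ i : Fin (n - 1) with i.val < r, (1 + q ^ (-((i.val + 1 : ℕ) : ℤ)) * t)) *
          ∏ i : Fin (n - 1) with i.val < n - 1 - r, (1 + q ^ (i.val + 1) * t)) /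
        ∏ i : Fin (n - 1), (1 - q ^ (i.val + 1 + 1)) := by
  rw [hilb_weyl_extPowerRep hn hr]
  exact exterior_formula_exponents (fun l hl => one_sub_q_pow_ne_zero hl) hr

theorem mixedHilb_weyl {n : ℕ} (hn : 1 ≤ n) {e e' : Fin (n - 1) → ℕ}
    (he : IsExponents (weylARep n) e) (he' : IsCoexponents (weylARep n) e') :
    mixedHilb (weylARep n) = ∑ r ∈ Finset.range (n - 1 + 1), Polynomial.X ^ r * Polynomial.C
      (elemSymm r (fun i => q ^ e' i) *
        ((∏ i : Fin (n - 1) with i.val < r, (1 + q ^ (-(e' i : ℤ)) * t)) *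
          ∏ i : Fin (n - 1) with i.val < n - 1 - r, (1 + q ^ e i * t)) /
        ∏ i : Fin (n - 1), (1 - q ^ (e i + 1))) := by
  have h1 := exponents_eq hn he
  have h2 := coexponents_eq hn he'
  subst h1 h2
  rw [mixedHilb, finrank_weyl hn]
  refine Finset.sum_congr rfl fun r hr => ?_
  rw [hilb_weyl_extPowerRep_exponents hn (Nat.lt_succ_iff.1 (Finset.mem_range.1 hr))]
  exact Polynomial.X_pow_mul.symm

theorem corollary3p2 (n : ℕ) (hn : 1 ≤ n) :
    -- the hook-content formulas for every irreducible character of `W(A_{n-1})`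
    (∀ (lam : YoungDiagram) (T : Fin n ≃ lam.cells)
        (M : Type*) [AddCommGroup M] [Module ℂ M] [FiniteDimensional ℂ M]
        (σ : Representation ℂ (Equiv.Perm (Fin n)) M), σ.character = spechtCharacter T →
      multSeries (weylARep n) σ =
          (1 - q) / (1 + t) * multSeries (permRep n) σ ∧
      multSeries (weylARep n) σ =
          (1 - q) / (1 + t) * hookContentProduct lam) ∧
    -- the product formula for the characters of the exterior powers of `V`
    (∀ r : ℕ, r ≤ n - 1 →
      multSeries (weylARep n) (extPowerRep (weylARep n) r) =
        q ^ (r + r.choose 2) * qBinomial (n - 1) r *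
          (qPochhammer (-t * q) q (n - 1 - r) *
            qPochhammer (-t * q⁻¹) q⁻¹ r) /
          qPochhammer (q ^ 2) q (n - 1)) ∧
    -- the formula for the mixed Hilbert series in terms of exponents `e` and coexponents `e'`
    (∀ e e' : Fin (n - 1) → ℕ, IsExponents (weylARep n) e → IsCoexponents (weylARep n) e' →
      mixedHilb (weylARep n) =
        ∑ r ∈ Finset.range (n - 1 + 1), Polynomial.X ^ r * Polynomial.C
          (elemSymm r (fun i => q ^ e' i) *
            ((∏ i : Fin (n - 1) with i.val < r,
                (1 + q ^ (-(e' i : ℤ)) * t)) *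
              ∏ i : Fin (n - 1) with i.val < n - 1 - r,
                (1 + q ^ e i * t)) /
            ∏ i : Fin (n - 1), (1 - q ^ (e i + 1)))) := by
  refine ⟨fun lam T M _ _ _ σ h => ⟨multSeries_weyl σ hn, ?_⟩, fun r hr => ?_,
    fun e e' he he' => mixedHilb_weyl hn he he'⟩
  · rw [multSeries_weyl σ hn, multSeries_perm_specht T σ hn h]
  · rw [multSeries_weyl_extPowerRep hn, hilb_weyl_extPowerRep hn hr]
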